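/- \textbf{Proposition.} The parameterized problem \textsc{Weak RHorn-Backdoor Set Detection} is $\mathrm{W}[2]$-hard under fpt-reductions, and it remains $\mathrm{W}[2]$-hard when the input is restricted to 3CNF formulas. Here a clause is a finite set of literals without a complementary pair, a CNF formula is a finite set of clauses, and a 3CNF formula is a CNF formula all of whose clauses have at most three literals. For an assignment $\tau\colon B\to\{0,1\}$, $F[\tau]$ is obtained from $F$ by deleting all clauses with a literal that is true under $\tau$ and removing from the remaining clauses all literals that are false under $\tau$. A CNF formula is Horn if each clause has at most one positive literal, and it belongs to RHorn (renamable Horn) if for some set $X$ of variables it becomes Horn when all literals on variables of $X$ are complemented. A weak RHorn-backdoor set of $F$ is a set $B$ of variables such that for some $\tau\colon B\to\{0,1\}$ the formula $F[\tau]$ is satisfiable and belongs to RHorn. The problem is: given a CNF formula $F$ and the parameter $k\ge 0$, does $F$ have a weak RHorn-backdoor set of size at most $k$? The class $\mathrm{W}[2]$ consists of all parameterized problems that are fpt-reducible, for some first-order $\Pi_2$-formula $\varphi(X)=\forall\bar x\,\exists\bar y\,\psi$ ($\psi$ quantifier-free over a finite relational vocabulary, $X$ a free relation variable), to the problem: given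 a finite structure $\mathcal A$ and the parameter $k$, is there a relation $S$ with exactly $k$ tuples such that $\mathcal A\models\varphi(S)$? A problem is $\mathrm{W}[2]$-hard if every problem in $\mathrm{W}[2]$ is fpt-reducible to it. An fpt-reduction maps $(x,k)$ to an equivalent instance $(x',k')$ with $k'\le g(k)$ in time $f(k)\cdot|x|^{O(1)}$, with $f,g$ computable. -/

import Mathlib

/-! ## CNF formulas -/

namespace CNFFormula

/-- A literal `x ^ ε`: the pair `(x, true)` is `x`, the pair `(x, false)` is `¬ x`. -/
abbrev Literal (V : Type) : Type := V × Bool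

/-- A finite set of finite sets of literals. It is a CNF formula if it satisfies `IsCNF`. -/
abbrev ClauseSet (V : Type) : Type := Finset (Finset (Literal V))

variable {V : Type} [DecidableEq V]

/-- `F` is a CNF formula: no member of `F` contains a complementary pair of literals. -/
def IsCNF (F : ClauseSet V) : Prop :=
  ∀ C ∈ F, ∀ x : V, ¬ ((x, true) ∈ C ∧ (x, false) ∈ C)

/-- Each clause contains at most `r` literals. -/
def HasWidthAtMost (r : ℕ) (F : ClauseSet V) : Prop :=
  ∀ C ∈ F, C.card ≤ r

/-- The variables that occur in `F`. -/
def vars (F : ClauseSet V) : Finset V :=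
  F.biUnion fun C => C.image Prod.fst

/-- The literals set to 1 by the assignment `τ` on `X`. An element of `2 ^ X` is given by a function
on all variables, of which only the values on `X` matter. -/
def trueLits (X : Finset V) (τ : V → Bool) : Finset (Literal V) :=
  X.image fun x => (x, τ x)

/-- The literals set to 0 by the assignment `τ` on `X`. -/
def falseLits (X : Finset V) (τ : V → Bool) : Finset (Literal V) :=
  X.image fun x => (x, !τ x)

/-- The formula `F[τ]` for `τ ∈ 2 ^ X`: clauses with a true literal are deleted, and the false
literals are removed from the remaining clauses. -/
def restrict (F : ClauseSet V) (X : Finset V) (τ : V → Bool) : ClauseSet V :=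
  (F.filter fun C => C ∩ trueLits X τ = ∅).image fun C => C \ falseLits X τ

/-- `F[τ] = ∅` for some assignment `τ` of the variables of `F`. -/
def Satisfiable (F : ClauseSet V) : Prop :=
  ∃ τ : V → Bool, restrict F (vars F) τ = ∅

/-- Each clause contains at most one positive literal. -/
def Horn (F : ClauseSet V) : Prop :=
  ∀ C ∈ F, (C.filter fun l => l.2 = true).card ≤ 1

/-- The renaming `r_X(F)`: all literals on variables of `X` are complemented. -/
def rename (X : Finset V) (F : ClauseSet V) : ClauseSet V :=
  F.image fun C => C.image fun l => if l.1 ∈ X then (l.1, !l.2) else l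

/-- Renamable Horn formulas: some renaming is Horn. -/
def RHorn (F : ClauseSet V) : Prop :=
  ∃ X : Finset V, Horn (rename X F)

/-- `B` is a weak backdoor set of `F` with respect to the base class `𝒞`. -/
def IsWeakBackdoor (𝒞 : ClauseSet V → Prop) (F : ClauseSet V) (B : Finset V) : Prop :=
  ∃ τ : V → Bool, Satisfiable (restrict F B τ) ∧ 𝒞 (restrict F B τ)

end CNFFormula

/-! ## Parameterized problems, fpt-reductions and the class W[2] -/

namespace Parameterized

/-- A parameterized problem over a finite alphabet: a set of pairs of a word and a parameter. -/
structure Problem where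
  /-- the alphabet -/
  Alphabet : Type
  [finite : Fintype Alphabet]
  /-- the yes-instances -/
  yes : Set (List Alphabet × ℕ)

/-- The word on the input (or output) stack of a machine that represents `(w, k)`: the number `k`
in unary, with tally mark `none`, followed by `w`. -/
def tapeWord {α : Type} (p : List α × ℕ) : List (Option α) :=
  List.replicate p.2 none ++ p.1.map some

/-- `T` is computed by a (multi-stack) Turing machine in time `f(k) * p(|w|)` on input `(w, k)`,
for a computable function `f` and a polynomial `p`. -/
def FPTComputable {α β : Type} (T : List α × ℕ → List β × ℕ) : Prop :=
  ∃ (M : Turing.TM2ComputableAux (Option α) (Option β)) (f : ℕ → ℕ) (p : Polynomial ℕ),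
    Computable f ∧ ∀ (w : List α) (k : ℕ),
      Nonempty (Turing.TM2OutputsInTime M.tm
        ((tapeWord (w, k)).map M.inputAlphabet.invFun)
        (some ((tapeWord (T (w, k))).map M.outputAlphabet.invFun))
        (f k * p.eval w.length))

/-- There is an fpt-reduction (parameterized many-one reduction) from `P` to `Q`. -/
def FPTReducible (P Q : Problem) : Prop :=
  ∃ T : List P.Alphabet × ℕ → List Q.Alphabet × ℕ,
    FPTComputable T ∧
    (∃ g : ℕ → ℕ, Computable g ∧ ∀ w k, (T (w, k)).2 ≤ g k) ∧
    ∀ w k, (w, k) ∈ P.yes ↔ T (w, k) ∈ Q.yes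

/-- Quantifier-free first-order formulas, in `v` individual variables, over the relational
vocabulary with the relation symbols `R : Fin r` of arity `ar R`, and with one additional relation
variable `X` of arity `s`. -/
inductive QFFormula {r : ℕ} (ar : Fin r → ℕ) (s v : ℕ) : Type
  | eq (i j : Fin v) : QFFormula ar s v
  | rel (R : Fin r) (t : Fin (ar R) → Fin v) : QFFormula ar s v
  | relVar (t : Fin s → Fin v) : QFFormula ar s v
  | not (ψ : QFFormula ar s v) : QFFormula ar s v
  | and (ψ χ : QFFormula ar s v) : QFFormula ar s v
  | or (ψ χ : QFFormula ar s v) : QFFormula ar s v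

/-- A finite structure for the vocabulary `ar`, with universe `{0, …, n - 1}`, `n ≥ 1`. Its relations
are given by the list of all facts `R(a₁, …, a_q)` that hold. -/
structure FinStructure {r : ℕ} (ar : Fin r → ℕ) where
  /-- the number of elements -/
  n : ℕ
  /-- the universe is not empty -/
  pos : 0 < n
  /-- the facts -/
  facts : List (Σ R : Fin r, Fin (ar R) → Fin n)

/-- Truth of a quantifier-free formula in `A`, where the relation variable is interpreted by `S` and
the individual variables by `e`. -/
def QFFormula.Holds {r : ℕ} {ar : Fin r → ℕ} {s v : ℕ} (A : FinStructure ar)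
    (S : Finset (Fin s → Fin A.n)) (e : Fin v → Fin A.n) : QFFormula ar s v → Prop
  | .eq i j => e i = e j
  | .rel R t => ⟨R, fun i => e (t i)⟩ ∈ A.facts
  | .relVar t => (fun i => e (t i)) ∈ S
  | .not ψ => ¬ ψ.Holds A S e
  | .and ψ χ => ψ.Holds A S e ∧ χ.Holds A S e
  | .or ψ χ => ψ.Holds A S e ∨ χ.Holds A S e

/-- A `Π₂`-formula `φ(X) = ∀ x₁ ⋯ ∀ x_m ∃ y₁ ⋯ ∃ y_l ψ` with `ψ` quantifier-free, over a finite
relational vocabulary, and with one free relation variable `X`. -/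
structure PiTwoFormula where
  /-- the number of relation symbols -/
  r : ℕ
  /-- the arities of the relation symbols -/
  ar : Fin r → ℕ
  /-- the arity of the relation variable -/
  s : ℕ
  /-- the number of universally quantified variables -/
  m : ℕ
  /-- the number of existentially quantified variables -/
  l : ℕ
  /-- the quantifier-free part -/
  matrix : QFFormula ar s (m + l)

/-- `A ⊨ φ(S)`. -/
def PiTwoFormula.Models (φ : PiTwoFormula) (A : FinStructure φ.ar)
    (S : Finset (Fin φ.s → Fin A.n)) : Prop :=
  ∀ x : Fin φ.m → Fin A.n, ∃ y : Fin φ.l → Fin A.n, φ.matrix.Holds A S (Fin.append x y)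

/-- The word that describes a finite structure. The symbol `inr true` is a tally mark. The number of
elements is written in unary; then follow the facts, each written as its relation symbol followed by
its arguments, each argument written as a separator `inr false` followed by the element in unary. -/
def FinStructure.word {r : ℕ} {ar : Fin r → ℕ} (A : FinStructure ar) : List (Fin r ⊕ Bool) :=
  List.replicate A.n (Sum.inr true) ++
    A.facts.flatMap fun a => Sum.inl a.1 ::
      (List.ofFn a.2).flatMap fun i => Sum.inr false :: List.replicate i.val (Sum.inr true)

/-- The parameterized problem `p-WD-φ` of weighted Fagin definability: given a finite structure `A`
and the parameter `k`, is there a relation `S` with exactly `k` tuples such that `A ⊨ φ(S)`? -/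
def weightedDefinability (φ : PiTwoFormula) : Problem where
  Alphabet := Fin φ.r ⊕ Bool
  yes := {p | ∃ A : FinStructure φ.ar, p.1 = A.word ∧
    ∃ S : Finset (Fin φ.s → Fin A.n), S.card = p.2 ∧ φ.Models A S}

/-- The class W[2], which is the second level of the W-hierarchy: the closure under fpt-reductions
of the problems `p-WD-φ` for `Π₂`-formulas `φ(X)` (the definition of Flum and Grohe). -/
def WTwo : Set Problem :=
  {P | ∃ φ : PiTwoFormula, FPTReducible P (weightedDefinability φ)}

/-- `Q` is W[2]-hard (under fpt-reductions). -/
def WTwoHard (Q : Problem) : Prop :=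
  ∀ P ∈ WTwo, FPTReducible P Q

end Parameterized

/-! ## Weak backdoor set detection -/

namespace BackdoorDetection

open CNFFormula Parameterized

/-- Propositional variables of input formulas: their names are the binary words. -/
abbrev Var : Type := List Bool

/-- An input formula as it is written down: a list of clauses, which are lists of literals. -/
abbrev FormulaText : Type := List (List (Literal Var))

/-- The set of clauses that is written down as `E`. -/
def FormulaText.toClauseSet (E : FormulaText) : ClauseSet Var :=
  (E.map List.toFinset).toFinset

/-- The alphabet used to write down formulas. -/
abbrev Letter : Type := Bool ⊕ Option Bool

/-- The word of a formula. A clause begins with `inr none`; a literal begins with `inr (some ε)`,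
where `ε` is its sign, and continues with the name of its variable, written in the letters `inl`. -/
def FormulaText.word (E : FormulaText) : List Letter :=
  E.flatMap fun C => Sum.inr none ::
    C.flatMap fun l => Sum.inr (some l.2) :: l.1.map Sum.inl

/-- Weak `𝒞`-Backdoor Set Detection for input formulas in the class `𝒟`. Instance: a CNF formula
`F ∈ 𝒟` and an integer `k ≥ 0`. Parameter: `k`. Question: does `F` have a weak `𝒞`-backdoor set of
size at most `k`? -/
def weakBackdoorDetection (𝒞 𝒟 : ClauseSet Var → Prop) : Problem where
  Alphabet := Letter
  yes := {p | ∃ E : FormulaText, p.1 = FormulaText.word E ∧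
    IsCNF (FormulaText.toClauseSet E) ∧ 𝒟 (FormulaText.toClauseSet E) ∧
    ∃ B : Finset Var, B.card ≤ p.2 ∧ IsWeakBackdoor 𝒞 (FormulaText.toClauseSet E) B}

end BackdoorDetection

/-! Every problem in W[2] has an fpt-reduction to `weightedDefinability φ` for one fixed Π₂-formula
φ. It therefore suffices to reduce that problem, in polynomial time and without increasing the
parameter, to backdoor detection on formulas of width three (`reduction`, `reduction_mem_iff`).

Logic. Introduce `k` selectors, and let the name `0 :: j :: l` say that selector `j` selects the
tuple `l`. If a set `U` of at most `k` names lets every selector select something, then each selects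
exactly one tuple. Hence "`l` is not selected" can be said monotonically: every selector selects a
tuple other than `l`. So the whole instance becomes a condition `InstFormula` monotone in `U`. It
expands to polynomial size because the number of quantifiers of φ is fixed
(`exists_models_of_instFormula`, `exists_instFormula_of_models`).

Networks. A monotone condition is represented by a directed graph with a source and a target whose
edges may be cut by selected names: it holds iff every path from source to target is cut.
Conjunction is parallel connection (`Definable.all`), disjunction is connection in series
(`Definable.ex`).

Backdoors. For a renaming set `X`, let `ρ` be its complement; a literal `(v, b)` becomes positive
iff `b` is the truth value of `ρ v`. An edge from `x` to `y` with label `u` gives the clause `x ∨ ¬y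
∨ u`. Unless it is deleted by setting `u` to true, or `x` or `y` is touched, a Horn renaming forces
`ρ x → ρ y`. Three clauses with two literals force the source into `ρ` and the target out of it.
Such a `ρ` exists iff the uncut edges contain no path from source to target. The network is copied
`k + 1` times, so a backdoor of size `k` leaves the nodes of some copy untouched
(`exists_of_isWeakBackdoor`, `exists_isWeakBackdoor`).

Machines. The reduction must be carried out by a Turing machine. Polynomial-time functions are given
by programs on binary trees, with closure under composition, pairing, case distinction and folds of
bounded size (`PolyTime.foldl`). The programs are compiled to stack machines and run on the output
of the machine of the given fpt-reduction (`FPTComputable.polyTime_comp`). -/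

/-! ## Structured stack programs and their compilation to stack machines -/

namespace StackProgram

open Turing Function

/-- Structured programs over a family of stacks. The command `case k b` pops a symbol from the
stack `k` and continues with `b`, and `loop k b` pops symbols from `k` until `k` is empty, running
`b` after each successful pop. -/
inductive Cmd {K : Type} (Γ : K → Type) : Type
  | skip : Cmd Γ
  | push (k : K) (a : Γ k) : Cmd Γ
  | case (k : K) (b : Option (Γ k) → Cmd Γ) : Cmd Γ
  | seq (p q : Cmd Γ) : Cmd Γ
  | loop (k : K) (b : Γ k → Cmd Γ) : Cmd Γ

/-! ### Big-step semantics with exact step counts -/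

section Semantics

variable {K : Type} {Γ : K → Type} [DecidableEq K]

/-- Big-step semantics: `Big c S S' t` if `c` transforms the stacks `S` into `S'` in `t` steps. -/
inductive Big : Cmd Γ → (∀ k, List (Γ k)) → (∀ k, List (Γ k)) → ℕ → Prop
  | skip (S) : Big .skip S S 1
  | push (S k a) : Big (.push k a) S (update S k (a :: S k)) 1
  | case {S S' k b t} : Big (b (S k).head?) (update S k (S k).tail) S' t →
      Big (.case k b) S S' (t + 1)
  | seq {S S' S'' p q t t'} : Big p S S' t → Big q S' S'' t' → Big (.seq p q) S S'' (t + t')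
  | loop_nil {S k b} : S k = [] → Big (.loop k b) S S 1
  | loop_cons {S S' S'' k b a l t t'} : S k = a :: l → Big (b a) (update S k l) S' t →
      Big (.loop k b) S' S'' t' → Big (.loop k b) S S'' (t + t' + 1)

end Semantics

/-- The labels of the compiled program. -/
def Lab {K : Type} {Γ : K → Type} : Cmd Γ → Type
  | .skip => Unit
  | .push _ _ => Unit
  | .case k b => Option (Σ o : Option (Γ k), Lab (b o))
  | .seq p q => Lab p ⊕ Lab q
  | .loop k b => Option (Σ a : Γ k, Lab (b a))

/-- The label at which the compiled program starts. -/
def Cmd.entry {K : Type} {Γ : K → Type} : (c : Cmd Γ) → Lab c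
  | .skip => ()
  | .push _ _ => ()
  | .case _ _ => (none : Option _)
  | .seq p _ => Sum.inl p.entry
  | .loop _ _ => (none : Option _)

/-- A machine needs finitely many labels; branching is over finite alphabets, so structural
induction on the command applies. -/
theorem nonempty_fintype_lab {K : Type} {Γ : K → Type} [∀ k, Fintype (Γ k)] (c : Cmd Γ) :
    Nonempty (Fintype (Lab c)) := by
  classical
  induction c with
  | skip => exact ⟨inferInstanceAs (Fintype Unit)⟩
  | push k a => exact ⟨inferInstanceAs (Fintype Unit)⟩
  | case k b ih =>
    have := fun o => (ih o).some
    exact ⟨inferInstanceAs (Fintype (Option (Σ o : Option (Γ k), Lab (b o))))⟩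
  | seq p q ihp ihq =>
    have := ihp.some
    have := ihq.some
    exact ⟨inferInstanceAs (Fintype (Lab p ⊕ Lab q))⟩
  | loop k b ih =>
    have := fun o => (ih o).some
    exact ⟨inferInstanceAs (Fintype (Option (Σ a : Γ k, Lab (b a))))⟩

/-! ### Compilation of commands to machine statements -/

section Compile

variable {K₁ K : Type} {Γ₁ : K₁ → Type} {Γ : K → Type} {L σ₁ : Type}

/-- The statement at a label of the compiled program, in a machine with additional stacks `K₁` and
additional state `σ₁`. The second component of the state holds the label for the next jump. -/
def Cmd.stmt : (c : Cmd Γ) → (Lab c → L) → L → Lab c →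
    TM2.Stmt (Sum.elim Γ₁ Γ) L (σ₁ × L)
  | .skip, _, exit, _ => .goto fun _ => exit
  | .push k a, _, exit, _ => .push (Sum.inr k) (fun _ => a) (.goto fun _ => exit)
  | .case k b, ι, exit, l =>
    match (l : Option (Σ o : Option (Γ k), Lab (b o))) with
    | none => .pop (Sum.inr k)
        (fun v (o : Option (Γ k)) => (v.1, ι (some ⟨o, (b o).entry⟩ : Option (Σ o, Lab (b o)))))
        (.goto fun v => v.2)
    | some ⟨o, l'⟩ => (b o).stmt (fun l => ι (some ⟨o, l⟩ : Option (Σ o, Lab (b o)))) exit l'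
  | .seq p q, ι, exit, l =>
    match (l : Lab p ⊕ Lab q) with
    | .inl l' => p.stmt (fun l => ι (.inl l : Lab p ⊕ Lab q)) (ι (.inr q.entry : Lab p ⊕ Lab q)) l'
    | .inr l' => q.stmt (fun l => ι (.inr l : Lab p ⊕ Lab q)) exit l'
  | .loop k b, ι, exit, l =>
    match (l : Option (Σ a : Γ k, Lab (b a))) with
    | none => .pop (Sum.inr k)
        (fun v (o : Option (Γ k)) => (v.1, match o with
          | none => exit
          | some a => ι (some ⟨a, (b a).entry⟩ : Option (Σ a, Lab (b a)))))
        (.goto fun v => v.2)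
    | some ⟨a, l'⟩ => (b a).stmt (fun l => ι (some ⟨a, l⟩ : Option (Σ a, Lab (b a))))
        (ι (none : Option (Σ a, Lab (b a)))) l'

/-- The stacks of the composed machine. -/
def join (S₁ : ∀ k, List (Γ₁ k)) (S : ∀ k, List (Γ k)) : ∀ k, List (Sum.elim Γ₁ Γ k)
  | .inl k => S₁ k
  | .inr k => S k

variable [DecidableEq K₁] [DecidableEq K]

/-- The type family is passed explicitly because `Sum.elim Γ₁ Γ (Sum.inr k)` agrees with `Γ k` only
by unfolding. -/
theorem update_join_inr (S₁ : ∀ k, List (Γ₁ k)) (S : ∀ k, List (Γ k)) (k : K) (x : List (Γ k)) :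
    update (join S₁ S) (Sum.inr k) x = join S₁ (update S k x) := by
  funext j
  rcases j with j | j
  · exact update_of_ne (β := fun k => List (Sum.elim Γ₁ Γ k)) (by simp) _ _
  · by_cases h : j = k
    · subst h
      exact (update_self (β := fun k => List (Sum.elim Γ₁ Γ k)) _ _ _).trans
        (update_self (β := fun k => List (Γ k)) j x S).symm
    · exact (update_of_ne (β := fun k => List (Sum.elim Γ₁ Γ k)) (by simpa using h) _ _).trans
        (update_of_ne (β := fun k => List (Γ k)) h x S).symm

theorem update_join_inl (S₁ : ∀ k, List (Γ₁ k)) (S : ∀ k, List (Γ k)) (k : K₁) (x : List (Γ₁ k)) :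
    update (join S₁ S) (Sum.inl k) x = join (update S₁ k x) S := by
  funext j
  rcases j with j | j
  · by_cases h : j = k
    · subst h
      exact (update_self (β := fun k => List (Sum.elim Γ₁ Γ k)) _ _ _).trans
        (update_self (β := fun k => List (Γ₁ k)) j x S₁).symm
    · exact (update_of_ne (β := fun k => List (Sum.elim Γ₁ Γ k)) (by simpa using h) _ _).trans
        (update_of_ne (β := fun k => List (Γ₁ k)) h x S₁).symm
  · exact update_of_ne (β := fun k => List (Sum.elim Γ₁ Γ k)) (by simp) _ _

end Compile

/-! ### Exact step counting for machines -/

section Steps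

variable {K : Type} {Γ : K → Type} {L σ : Type} [DecidableEq K]

/-- The machine `M` passes from `c` to `c'` in exactly `n` steps. -/
inductive Steps (M : L → TM2.Stmt Γ L σ) : ℕ → TM2.Cfg Γ L σ → TM2.Cfg Γ L σ → Prop
  | refl (c) : Steps M 0 c c
  | head {n c c' c''} : TM2.step M c = some c' → Steps M n c' c'' → Steps M (n + 1) c c''

theorem Steps.trans {M : L → TM2.Stmt Γ L σ} {n m : ℕ} {c c' c'' : TM2.Cfg Γ L σ}
    (h : Steps M n c c') (h' : Steps M m c' c'') : Steps M (n + m) c c'' := by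
  induction h with
  | refl => simpa using h'
  | @head n _ _ _ h _ ih => rw [Nat.add_right_comm]; exact .head h (ih h')

theorem Steps.single {M : L → TM2.Stmt Γ L σ} {c c' : TM2.Cfg Γ L σ}
    (h : TM2.step M c = some c') : Steps M 1 c c' := .head h (.refl _)

theorem iterate_bind_none {α : Type} (f : α → Option α) (n : ℕ) :
    (flip bind f)^[n] none = none := by
  induction n with
  | zero => rfl
  | succ n ih => rw [iterate_succ_apply]; exact ih

/-- Translates between the inductive relation, convenient for concatenating runs, and the iterated
partial step in `TM2OutputsInTime`. -/
theorem steps_iff_iterate {M : L → TM2.Stmt Γ L σ} {n : ℕ} {c c' : TM2.Cfg Γ L σ} :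
    Steps M n c c' ↔ (flip bind (TM2.step M))^[n] (some c) = some c' := by
  induction n generalizing c with
  | zero =>
    constructor
    · rintro ⟨⟩; rfl
    · intro h; cases h; exact .refl _
  | succ n ih =>
    rw [iterate_succ_apply]
    constructor
    · rintro (_ | ⟨h, h'⟩)
      rw [show flip bind (TM2.step M) (some c) = TM2.step M c from rfl, h]
      exact ih.1 h'
    · intro h
      rw [show flip bind (TM2.step M) (some c) = TM2.step M c from rfl] at h
      cases hc : TM2.step M c with
      | none => rw [hc, iterate_bind_none] at h; cases h
      | some d => rw [hc] at h; exact .head hc (ih.2 h)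

end Steps

/-! ### Correctness of the compilation -/

section Simulation

variable {K₁ K : Type} {Γ₁ : K₁ → Type} {Γ : K → Type} {L σ₁ : Type}
variable [DecidableEq K₁] [DecidableEq K]

/-- Each unit of big-step time is one machine step, since a pop or push and the following jump form
a single statement. The embedding `ι` and the exit label are arbitrary, so the induction hypotheses
apply to commands nested in larger ones. The final jump register `l'` is irrelevant, hence
existentially quantified. -/
theorem steps_of_big {M : L → TM2.Stmt (Sum.elim Γ₁ Γ) L (σ₁ × L)} (S₁ : ∀ k, List (Γ₁ k))
    {c : Cmd Γ} {S S' : ∀ k, List (Γ k)} {t : ℕ} (h : Big c S S' t) :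
    ∀ (ι : Lab c → L) (exit : L), (∀ l, M (ι l) = c.stmt ι exit l) → ∀ v : σ₁ × L,
      ∃ l', Steps M t ⟨some (ι c.entry), v, join S₁ S⟩ ⟨some exit, (v.1, l'), join S₁ S'⟩ := by
  induction h with
  | skip S =>
    intro ι exit hM v
    exact ⟨v.2, .single (by rw [TM2.step, hM]; rfl)⟩
  | push S k a =>
    intro ι exit hM v
    refine ⟨v.2, .single ?_⟩
    rw [TM2.step, hM, ← update_join_inr]
    rfl
  | @case S S' k b t _ ih =>
    intro ι exit hM v
    obtain ⟨l', h⟩ := ih (fun l => ι (some ⟨(S k).head?, l⟩ : Option (Σ o, Lab (b o)))) exit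
      (fun l => hM _) (v.1, ι (some ⟨(S k).head?, Cmd.entry _⟩ : Option (Σ o, Lab (b o))))
    refine ⟨l', .head ?_ h⟩
    rw [TM2.step, hM, ← update_join_inr]
    rfl
  | @seq S S' S'' p q t t' _ _ ihp ihq =>
    intro ι exit hM v
    obtain ⟨l₁, h₁⟩ := ihp (fun l => ι (.inl l : Lab p ⊕ Lab q)) (ι (.inr q.entry : Lab p ⊕ Lab q))
      (fun l => hM _) v
    obtain ⟨l₂, h₂⟩ := ihq (fun l => ι (.inr l : Lab p ⊕ Lab q)) exit (fun l => hM _) (v.1, l₁)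
    exact ⟨l₂, h₁.trans h₂⟩
  | @loop_nil S k b hS =>
    intro ι exit hM v
    refine ⟨exit, .single ?_⟩
    have hs : update S k (S k).tail = S := by rw [hS, List.tail_nil, ← hS, update_eq_self]
    rw [TM2.step, hM]
    conv_rhs => rw [← hs, ← update_join_inr]
    show some (TM2.Cfg.mk _ _ _) = _
    simp only [join, hS]
    rfl
  | @loop_cons S S' S'' k b a l t t' hS _ _ ih₁ ih₂ =>
    intro ι exit hM v
    obtain ⟨l₁, h₁⟩ := ih₁ (fun l => ι (some ⟨a, l⟩ : Option (Σ a, Lab (b a))))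
      (ι (none : Option (Σ a, Lab (b a)))) (fun l => hM _)
      (v.1, ι (some ⟨a, Cmd.entry _⟩ : Option (Σ a, Lab (b a))))
    obtain ⟨l₂, h₂⟩ := ih₂ ι exit hM (v.1, l₁)
    refine ⟨l₂, .head ?_ (h₁.trans h₂)⟩
    have hs : update S k (S k).tail = update S k l := by rw [hS, List.tail_cons]
    rw [TM2.step, hM, ← hs, ← update_join_inr]
    show some (TM2.Cfg.mk _ _ _) = _
    simp only [join, hS]
    rfl

end Simulation

end StackProgram

/-! ## A machine followed by a structured program -/

namespace StackProgram

open Turing Function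

theorem initList_stk (M : FinTM2) (x : List (M.Γ M.k₀)) :
    (initList M x).stk = update (fun _ => []) M.k₀ x := by
  funext k
  by_cases h : k = M.k₀
  · subst h; simp [initList]
  · simp [initList, h]

theorem haltList_stk (M : FinTM2) (x : List (M.Γ M.k₁)) :
    (haltList M x).stk = update (fun _ => []) M.k₁ x := by
  funext k
  by_cases h : k = M.k₁
  · subst h; simp [haltList]
  · simp [haltList, h]

/-! ### Output length is bounded by input length and time -/

section Growth

variable {K : Type} {Γ : K → Type} {L σ : Type}

/-- The number of push operations in a statement. -/
def pushes : TM2.Stmt Γ L σ → ℕ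
  | .push _ _ q => pushes q + 1
  | .peek _ _ q => pushes q
  | .pop _ _ q => pushes q
  | .load _ q => pushes q
  | .branch _ p q => pushes p + pushes q
  | .goto _ => 0
  | .halt => 0

variable [DecidableEq K]

theorem length_stepAux_le (q : TM2.Stmt Γ L σ) (v : σ) (S : ∀ k, List (Γ k)) (k : K) :
    ((TM2.stepAux q v S).stk k).length ≤ (S k).length + pushes q := by
  induction q generalizing v S with
  | push j f q ih =>
    refine (ih _ _).trans ?_
    by_cases h : k = j
    · subst h; simp [pushes]; omega
    · simp [pushes, update_of_ne h]; try omega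
  | peek j f q ih => exact ih _ _
  | pop j f q ih =>
    refine (ih _ _).trans ?_
    by_cases h : k = j
    · subst h; simp [pushes]
    · simp [pushes, update_of_ne h]
  | load f q ih => exact ih _ _
  | branch f p q ihp ihq =>
    rw [TM2.stepAux, pushes]
    cases f v
    · exact (ihq _ _).trans (by omega)
    · exact (ihp _ _).trans (by omega)
  | goto f => simp [pushes]
  | halt => simp [pushes]

/-- One step executes one statement, which contains at most `d` pushes. -/
theorem length_steps_le {M : L → TM2.Stmt Γ L σ} {d : ℕ} (hd : ∀ l, pushes (M l) ≤ d) {n : ℕ}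
    {c c' : TM2.Cfg Γ L σ} (h : Steps M n c c') (k : K) :
    (c'.stk k).length ≤ (c.stk k).length + d * n := by
  induction h with
  | refl => simp
  | @head n c c' c'' h _ ih =>
    obtain ⟨_ | l, v, S⟩ := c
    · simp at h
    · rw [TM2.step, Option.some.injEq] at h
      have := length_stepAux_le (M l) v S k
      rw [h] at this
      have := hd l
      rw [Nat.mul_succ]
      simp only
      omega

end Growth

/-- The length of the output of a machine is at most linear in the length of its input and the
number of steps. -/
theorem exists_length_output_le (M : FinTM2) : ∃ d : ℕ, ∀ x y t,
    TM2OutputsInTime M x (some y) t → y.length ≤ x.length + d * t := by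
  have := M.ΛFin
  refine ⟨∑ l, pushes (M.m l), fun x y t h => ?_⟩
  have hs : Steps M.m h.steps (initList M x) (haltList M y) :=
    steps_iff_iterate.2 h.evals_in_steps
  have := length_steps_le
    (fun l => Finset.single_le_sum (f := fun l => pushes (M.m l)) (fun _ _ => Nat.zero_le _)
      (Finset.mem_univ l)) hs M.k₁
  rw [haltList_stk, initList_stk, update_self] at this
  have hx : (update (fun _ => []) M.k₀ x M.k₁).length ≤ x.length := by
    generalize M.k₁ = k
    by_cases hk : k = M.k₀
    · subst hk; simp
    · simp [update_of_ne hk]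
  have := Nat.mul_le_mul_left (∑ l, pushes (M.m l)) h.steps_le_m
  omega

/-! ### Embedding the first machine into the composed machine -/

section Lift

variable {K₁ K : Type} {Γ₁ : K₁ → Type} {Γ : K → Type} {L L₁ σ₁ : Type}

/-- A statement of the first machine, as a statement of the composed machine. -/
def liftStmt (ι : L₁ → L) (exit : L) :
    TM2.Stmt Γ₁ L₁ σ₁ → TM2.Stmt (Sum.elim Γ₁ Γ) L (σ₁ × L)
  | .push k f q => .push (Sum.inl k) (fun v => f v.1) (liftStmt ι exit q)
  | .peek k f q => .peek (Sum.inl k) (fun v o => (f v.1 o, v.2)) (liftStmt ι exit q)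
  | .pop k f q => .pop (Sum.inl k) (fun v o => (f v.1 o, v.2)) (liftStmt ι exit q)
  | .load f q => .load (fun v => (f v.1, v.2)) (liftStmt ι exit q)
  | .branch f p q => .branch (fun v => f v.1) (liftStmt ι exit p) (liftStmt ι exit q)
  | .goto f => .goto fun v => ι (f v.1)
  | .halt => .goto fun _ => exit

/-- A configuration of the first machine, as a configuration of the composed machine. -/
def liftCfg (ι : L₁ → L) (exit : L) (l : L) (S : ∀ k, List (Γ k)) (c : TM2.Cfg Γ₁ L₁ σ₁) :
    TM2.Cfg (Sum.elim Γ₁ Γ) L (σ₁ × L) :=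
  ⟨some (c.l.elim exit ι), (c.var, l), join c.stk S⟩

variable [DecidableEq K₁] [DecidableEq K]

theorem stepAux_liftStmt (ι : L₁ → L) (exit : L) (q : TM2.Stmt Γ₁ L₁ σ₁) (v : σ₁) (l : L)
    (S₁ : ∀ k, List (Γ₁ k)) (S : ∀ k, List (Γ k)) :
    TM2.stepAux (liftStmt ι exit q) (v, l) (join S₁ S) =
      liftCfg ι exit l S (TM2.stepAux q v S₁) := by
  induction q generalizing v S₁ with
  | push k f q ih =>
    rw [TM2.stepAux, ← ih, ← update_join_inl]; rfl
  | peek k f q ih => rw [TM2.stepAux, ← ih]; rfl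
  | pop k f q ih => rw [TM2.stepAux, ← ih, ← update_join_inl]; rfl
  | load f q ih => rw [TM2.stepAux, ← ih]; rfl
  | branch f p q ihp ihq =>
    rw [liftStmt, TM2.stepAux, TM2.stepAux]
    cases f v
    · exact ihq _ _
    · exact ihp _ _
  | goto f => rfl
  | halt => rfl

/-- The simulation is step by step; a halt of the first machine turns into a jump to `exit`, and the
stacks of the program are not touched. -/
theorem steps_liftCfg {M₁ : L₁ → TM2.Stmt Γ₁ L₁ σ₁}
    {M : L → TM2.Stmt (Sum.elim Γ₁ Γ) L (σ₁ × L)} {ι : L₁ → L} {exit : L}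
    (hM : ∀ l, M (ι l) = liftStmt ι exit (M₁ l)) (l : L) (S : ∀ k, List (Γ k)) {n : ℕ}
    {c c' : TM2.Cfg Γ₁ L₁ σ₁} (h : Steps M₁ n c c') :
    Steps M n (liftCfg ι exit l S c) (liftCfg ι exit l S c') := by
  induction h with
  | refl => exact .refl _
  | @head n c c' c'' h _ ih =>
    refine .head ?_ ih
    obtain ⟨_ | l₁, v, S₁⟩ := c
    · simp at h
    · rw [TM2.step, Option.some.injEq] at h
      rw [← h, ← stepAux_liftStmt, ← hM]
      rfl

end Lift

/-! ### The composed machine -/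

section Compose

variable {K : Type} {Γ : K → Type} [DecidableEq K]

/-- The labels of the composed machine: the labels of the first machine; the labels of the loop that
moves the output of the first machine to the input stack of the program; the labels of the
program; and a final label. -/
abbrev ComposeLab (M : FinTM2) (c : Cmd Γ) (inp : K) : Type :=
  M.Λ ⊕ Option (Γ inp) ⊕ Lab c ⊕ Unit

/-- The statements of the composed machine. -/
def composeStmt (M : FinTM2) (c : Cmd Γ) (inp : K) (e : M.Γ M.k₁ → Γ inp) :
    ComposeLab M c inp →
      TM2.Stmt (Sum.elim M.Γ Γ) (ComposeLab M c inp) (M.σ × ComposeLab M c inp)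
  | .inl l => liftStmt Sum.inl (.inr (.inl none)) (M.m l)
  | .inr (.inl none) => .pop (Sum.inl M.k₁)
      (fun v (o : Option (M.Γ M.k₁)) =>
        (v.1, o.elim (.inr (.inr (.inl c.entry))) fun a => .inr (.inl (some (e a)))))
      (.goto fun v => v.2)
  | .inr (.inl (some a)) => .push (Sum.inr inp) (fun _ => a) (.goto fun _ => .inr (.inl none))
  | .inr (.inr (.inl l)) =>
      c.stmt (fun l => .inr (.inr (.inl l))) (.inr (.inr (.inr ()))) l
  -- The halting configuration `haltList` prescribes the initial state, so the state is reset before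
  -- halting.
  | .inr (.inr (.inr ())) => .load (fun _ => (M.initialState, .inl M.main)) .halt

/-- The machine that runs `M`, moves its output to the stack `inp`, and runs the program `c`, which
leaves its output on the stack `out`. -/
noncomputable def compose [Fintype K] [∀ k, Fintype (Γ k)] (M : FinTM2) (c : Cmd Γ) (inp out : K)
    (e : M.Γ M.k₁ → Γ inp) : FinTM2 :=
  letI := M.ΛFin
  letI := M.σFin
  letI := M.kFin
  letI : Fintype (Lab c) := (nonempty_fintype_lab c).some
  { K := M.K ⊕ K
    k₀ := .inl M.k₀
    k₁ := .inr out
    Γ := Sum.elim M.Γ Γ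
    Λ := ComposeLab M c inp
    main := .inl M.main
    σ := M.σ × ComposeLab M c inp
    initialState := (M.initialState, .inl M.main)
    Γk₀Fin := M.Γk₀Fin
    m := composeStmt M c inp e }

/-- Each symbol costs a pop and a push, and one more pop detects the end. The transfer reverses the
word. -/
theorem steps_transfer (M : FinTM2) (c : Cmd Γ) (inp : K) (e : M.Γ M.k₁ → Γ inp)
    (y : List (M.Γ M.k₁)) (S₁ : ∀ k, List (M.Γ k)) (S : ∀ k, List (Γ k))
    (v : M.σ × ComposeLab M c inp) (hy : S₁ M.k₁ = y) :
    ∃ l', Steps (composeStmt M c inp e) (2 * y.length + 1)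
      ⟨some (.inr (.inl none)), v, join S₁ S⟩
      ⟨some (.inr (.inr (.inl c.entry))), (v.1, l'),
        join (update S₁ M.k₁ []) (update S inp ((y.map e).reverse ++ S inp))⟩ := by
  induction y generalizing S₁ S v with
  | nil =>
    refine ⟨.inr (.inr (.inl c.entry)), .single ?_⟩
    rw [List.map_nil, List.reverse_nil, List.nil_append, update_eq_self, ← update_join_inl]
    show some (TM2.Cfg.mk _ _ _) = _
    simp only [join, hy]
    rfl
  | cons a y ih =>
    obtain ⟨l', h⟩ := ih (update S₁ M.k₁ y) (update S inp (e a :: S inp))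
      (v.1, .inr (.inl (some (e a)))) (update_self _ _ _)
    rw [update_idem, update_idem, update_self] at h
    refine ⟨l', ?_⟩
    rw [show 2 * (a :: y).length + 1 = 2 * y.length + 1 + 1 + 1 by simp; ring]
    rw [List.map_cons, List.reverse_cons, List.append_assoc, List.singleton_append]
    refine .head (c' := ⟨some (.inr (.inl (some (e a)))), (v.1, .inr (.inl (some (e a)))),
      join (update S₁ M.k₁ y) S⟩) ?_ (.head ?_ h)
    · rw [← update_join_inl]
      show some (TM2.Cfg.mk _ _ _) = _
      simp only [join, hy]
      rfl
    · rw [← update_join_inr]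
      rfl

/-- Four runs are concatenated: the first machine, the transfer, the program, and the final reset.
The program must leave all stacks but `out` empty, as a halting configuration requires. -/
theorem compose_outputs [Fintype K] [∀ k, Fintype (Γ k)] (M : FinTM2) (c : Cmd Γ) (inp out : K)
    (e : M.Γ M.k₁ → Γ inp)
    {x : List (M.Γ M.k₀)} {y : List (M.Γ M.k₁)} {z : List (Γ out)} {t t' : ℕ}
    (h : TM2OutputsInTime M x (some y) t)
    (hc : Big c (update (fun _ => []) inp (y.map e).reverse) (update (fun _ => []) out z) t') :
    Nonempty (TM2OutputsInTime (compose M c inp out e) x (some z)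
      (t + (2 * y.length + 1) + t' + 1)) := by
  have h₁ : Steps M.m h.steps (initList M x) (haltList M y) :=
    steps_iff_iterate.2 h.evals_in_steps
  have h₁' := steps_liftCfg (M := composeStmt M c inp e) (ι := Sum.inl)
    (exit := .inr (.inl none)) (fun l => rfl) (.inl M.main) (fun _ => []) h₁
  obtain ⟨l₂, h₂⟩ := steps_transfer M c inp e y (haltList M y).stk (fun _ => [])
    (M.initialState, .inl M.main) (by rw [haltList_stk, update_self])
  obtain ⟨l₃, h₃⟩ := steps_of_big (M := composeStmt M c inp e)
    (update (haltList M y).stk M.k₁ []) hc (fun l => .inr (.inr (.inl l))) (.inr (.inr (.inr ())))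
    (fun l => rfl) (M.initialState, l₂)
  -- The output stack was the only nonempty stack of the halted machine, so emptying it clears all
  -- stacks.
  have hs : update (haltList M y).stk M.k₁ [] = fun _ => [] := by
    rw [haltList_stk, update_idem]
    exact update_eq_self M.k₁ (fun _ => [])
  rw [List.append_nil] at h₂
  have h₄ : TM2.step (composeStmt M c inp e) ⟨some (.inr (.inr (.inr ()))),
      ((M.initialState, l₂).1, l₃),
      join (update (haltList M y).stk M.k₁ []) (update (fun _ => []) out z)⟩ =
      some (haltList (compose M c inp out e) z) := by
    have hz : (haltList (compose M c inp out e) z).stk =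
        join (fun _ => []) (update (fun _ => []) out z) := by
      have h : (fun _ => [] : ∀ k, List ((compose M c inp out e).Γ k)) =
          join (fun _ => []) (fun _ => []) := by
        funext k; rcases k with k | k <;> rfl
      refine (haltList_stk (compose M c inp out e) z).trans (Eq.trans ?_
        (update_join_inr (fun _ => []) (fun _ => []) out z))
      rw [h]
      rfl
    rw [hs, ← hz]
    rfl
  have h₀ : liftCfg Sum.inl (.inr (.inl none)) (.inl M.main) (fun _ => []) (initList M x) =
      initList (compose M c inp out e) x := by
    have hz : (initList (compose M c inp out e) x).stk =
        join (initList M x).stk (fun _ => []) := by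
      have h : (fun _ => [] : ∀ k, List ((compose M c inp out e).Γ k)) =
          join (fun _ => []) (fun _ => []) := by
        funext k; rcases k with k | k <;> rfl
      rw [initList_stk M]
      refine (initList_stk (compose M c inp out e) x).trans (Eq.trans ?_
        (update_join_inl (fun _ => []) (fun _ => []) M.k₀ x))
      rw [h]
      rfl
    exact congrArg (TM2.Cfg.mk (some (Sum.inl M.main)) (M.initialState, Sum.inl M.main)) hz.symm
  rw [h₀] at h₁'
  have hfin := ((h₁'.trans h₂).trans h₃).trans (.single h₄)
  exact ⟨{ steps := _
           evals_in_steps := steps_iff_iterate.1 hfin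
           steps_le_m := by have := h.steps_le_m; omega }⟩

end Compose

end StackProgram

/-! ## Programs on binary trees -/

namespace StackProgram

open Function

/-- Binary trees, the universal data type of the programs below. -/
inductive Tree : Type
  | nil : Tree
  | node (a b : Tree) : Tree
  deriving DecidableEq

namespace Tree

/-- The prefix code of a tree. -/
def code : Tree → List Bool
  | nil => [false]
  | node a b => true :: (a.code ++ b.code)

/-- The length of the code of a tree. -/
def size (x : Tree) : ℕ := x.code.length

@[simp] theorem size_nil : size nil = 1 := rfl

@[simp] theorem size_node (a b : Tree) : size (node a b) = a.size + b.size + 1 := by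
  simp [size, code]

theorem size_pos (x : Tree) : 0 < x.size := by cases x <;> simp

/-- The left subtree. -/
def left : Tree → Tree
  | nil => nil
  | node a _ => a

/-- The right subtree. -/
def right : Tree → Tree
  | nil => nil
  | node _ b => b

/-- The code is self-delimiting, which allows trees to lie on a stack without separators. -/
theorem code_append_inj {x y : Tree} {l l' : List Bool} (h : x.code ++ l = y.code ++ l') :
    x = y ∧ l = l' := by
  induction x generalizing y l l' with
  | nil => cases y <;> simp_all [code]
  | node a b iha ihb =>
    cases y with
    | nil => simp [code] at h
    | node a' b' =>
      simp only [code, List.cons_append, List.cons.injEq, true_and, List.append_assoc] at h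
      obtain ⟨rfl, h₁⟩ := iha h
      obtain ⟨rfl, h₂⟩ := ihb h₁
      exact ⟨rfl, h₂⟩

theorem code_injective : Injective code := fun x y h =>
  (code_append_inj (l := []) (l' := []) (by simpa using h)).1

end Tree

/-- The stacks of the tree programs: the data stack, two auxiliary stacks, a counter and a flag. -/
inductive Stk : Type
  | data | aux | aux' | cnt | flag
  deriving DecidableEq

instance : Fintype Stk := ⟨{.data, .aux, .aux', .cnt, .flag}, fun k => by cases k <;> simp⟩

/-- Programs over the stacks `Stk` with binary alphabet. -/
abbrev TreeCmd : Type := Cmd fun _ : Stk => Bool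

/-- The contents of the stacks. -/
def st (d a b c f : List Bool) : Stk → List Bool
  | .data => d
  | .aux => a
  | .aux' => b
  | .cnt => c
  | .flag => f

section

variable (d a b c f x : List Bool)

@[simp] theorem st_data : st d a b c f .data = d := rfl
@[simp] theorem st_aux : st d a b c f .aux = a := rfl
@[simp] theorem st_aux' : st d a b c f .aux' = b := rfl
@[simp] theorem st_cnt : st d a b c f .cnt = c := rfl
@[simp] theorem st_flag : st d a b c f .flag = f := rfl

@[simp] theorem update_data : update (st d a b c f) .data x = st x a b c f := by
  funext k; cases k <;> rfl
@[simp] theorem update_aux : update (st d a b c f) .aux x = st d x b c f := by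
  funext k; cases k <;> rfl
@[simp] theorem update_aux' : update (st d a b c f) .aux' x = st d a x c f := by
  funext k; cases k <;> rfl
@[simp] theorem update_cnt : update (st d a b c f) .cnt x = st d a b x f := by
  funext k; cases k <;> rfl
@[simp] theorem update_flag : update (st d a b c f) .flag x = st d a b c x := by
  funext k; cases k <;> rfl

end

/-! ### Upper bounds for running times -/

section Runs

variable {K : Type} {Γ : K → Type} [DecidableEq K]

/-- The program `c` transforms `S` into `S'` in at most `n` steps. -/
def Runs (c : Cmd Γ) (S S' : ∀ k, List (Γ k)) (n : ℕ) : Prop :=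
  ∃ t ≤ n, Big c S S' t

variable {S S' S'' : ∀ k, List (Γ k)} {n m : ℕ} {k : K}

theorem Runs.mono {c : Cmd Γ} (h : Runs c S S' n) (hn : n ≤ m) : Runs c S S' m :=
  let ⟨t, ht, hb⟩ := h
  ⟨t, ht.trans hn, hb⟩

theorem Runs.skip : Runs .skip S S 1 := ⟨1, le_rfl, .skip _⟩

theorem Runs.push {a : Γ k} (h : S' = update S k (a :: S k)) : Runs (.push k a) S S' 1 :=
  ⟨1, le_rfl, h ▸ .push _ _ _⟩

theorem Runs.case {b : Option (Γ k) → Cmd Γ}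
    (h : Runs (b (S k).head?) (update S k (S k).tail) S' n) : Runs (.case k b) S S' (n + 1) :=
  let ⟨t, ht, hb⟩ := h
  ⟨t + 1, by omega, .case hb⟩

theorem Runs.case_cons {b : Option (Γ k) → Cmd Γ} {a : Γ k} {l : List (Γ k)} (hS : S k = a :: l)
    (h : Runs (b (some a)) (update S k l) S' n) : Runs (.case k b) S S' (n + 1) :=
  .case (by rw [hS]; exact h)

theorem Runs.case_nil {b : Option (Γ k) → Cmd Γ} (hS : S k = [])
    (h : Runs (b none) S S' n) : Runs (.case k b) S S' (n + 1) :=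
  .case (by rw [hS, List.tail_nil, ← hS, update_eq_self, hS]; exact h)

theorem Runs.seq {p q : Cmd Γ} (h : Runs p S S' n) (h' : Runs q S' S'' m) :
    Runs (.seq p q) S S'' (n + m) :=
  let ⟨t, ht, hb⟩ := h
  let ⟨t', ht', hb'⟩ := h'
  ⟨t + t', by omega, .seq hb hb'⟩

theorem Runs.loop_nil {b : Γ k → Cmd Γ} (h : S k = []) : Runs (.loop k b) S S 1 :=
  ⟨1, le_rfl, .loop_nil h⟩

theorem Runs.loop_cons {b : Γ k → Cmd Γ} {a : Γ k} {l : List (Γ k)} (hS : S k = a :: l)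
    (h : Runs (b a) (update S k l) S' n) (h' : Runs (.loop k b) S' S'' m) :
    Runs (.loop k b) S S'' (n + m + 1) :=
  let ⟨t, ht, hb⟩ := h
  let ⟨t', ht', hb'⟩ := h'
  ⟨t + t' + 1, by omega, .loop_cons hS hb hb'⟩

end Runs

/-! ### Elementary operations on the topmost trees -/

/-- The loop that moves trees from the data stack to the stack `k`, reversing their codes. The
number of trees is given by the counter. -/
def scanLoop (k : Stk) : TreeCmd :=
  .loop .cnt fun _ => .case .data fun
    | some true => .seq (.push k true) (.seq (.push .cnt true) (.push .cnt true))
    | some false => .push k false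
    | none => .skip

/-- Moves a tree from the data stack to the stack `k`, reversing its code. -/
def scan (k : Stk) : TreeCmd := .seq (.push .cnt true) (scanLoop k)

/-- The rest of the run is a hypothesis, because the loop goes on with the remaining tallies `c`
after reading `x`. An inner node replaces one tally by two, so the two induction hypotheses are
chained. A node symbol costs five steps: two pops and three pushes. -/
theorem runs_scanLoop_aux (x : Tree) {r a b c f : List Bool} {S' : Stk → List Bool} {n : ℕ}
    (h : Runs (scanLoop .aux) (st r (x.code.reverse ++ a) b c f) S' n) :
    Runs (scanLoop .aux) (st (x.code ++ r) a b (true :: c) f) S' (5 * x.size + n) := by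
  induction x generalizing r a c n with
  | nil =>
    refine (Runs.loop_cons rfl (Runs.case_cons rfl (Runs.push rfl)) (m := n) ?_).mono
      (by simp +arith)
    show Runs (scanLoop .aux) _ _ _
    simpa [Tree.code] using h
  | node x y ihx ihy =>
    refine (Runs.loop_cons rfl (Runs.case_cons rfl
      ((Runs.push rfl).seq ((Runs.push rfl).seq (Runs.push rfl)))) (n := 4)
      (m := 5 * x.size + (5 * y.size + n)) ?_).mono (by simp; omega)
    simp only [update_cnt, update_data, update_aux, st_cnt, st_aux, List.append_eq,
      List.append_assoc]
    refine ihx (ihy ?_)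
    simpa [Tree.code] using h

theorem runs_scanLoop_aux' (x : Tree) {r a b c f : List Bool} {S' : Stk → List Bool} {n : ℕ}
    (h : Runs (scanLoop .aux') (st r a (x.code.reverse ++ b) c f) S' n) :
    Runs (scanLoop .aux') (st (x.code ++ r) a b (true :: c) f) S' (5 * x.size + n) := by
  induction x generalizing r b c n with
  | nil =>
    refine (Runs.loop_cons rfl (Runs.case_cons rfl (Runs.push rfl)) (m := n) ?_).mono
      (by simp +arith)
    show Runs (scanLoop .aux') _ _ _
    simpa [Tree.code] using h
  | node x y ihx ihy =>
    refine (Runs.loop_cons rfl (Runs.case_cons rfl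
      ((Runs.push rfl).seq ((Runs.push rfl).seq (Runs.push rfl)))) (n := 4)
      (m := 5 * x.size + (5 * y.size + n)) ?_).mono (by simp; omega)
    simp only [update_cnt, update_data, update_aux', st_cnt, st_aux', List.append_eq,
      List.append_assoc]
    refine ihx (ihy ?_)
    simpa [Tree.code] using h

theorem runs_scan_aux (x : Tree) (r a b f : List Bool) :
    Runs (scan .aux) (st (x.code ++ r) a b [] f) (st r (x.code.reverse ++ a) b [] f)
      (5 * x.size + 2) :=
  ((Runs.push (update_cnt _ _ _ _ _ _).symm).seq (runs_scanLoop_aux x (.loop_nil rfl))).mono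
    (by omega)

theorem runs_scan_aux' (x : Tree) (r a b f : List Bool) :
    Runs (scan .aux') (st (x.code ++ r) a b [] f) (st r a (x.code.reverse ++ b) [] f)
      (5 * x.size + 2) :=
  ((Runs.push (update_cnt _ _ _ _ _ _).symm).seq (runs_scanLoop_aux' x (.loop_nil rfl))).mono
    (by omega)

/-- Moves the stack `k` to the stack `j`, reversing it. -/
def pour (k j : Stk) : TreeCmd := .loop k fun a => .push j a

theorem runs_pour {k j : Stk} (hkj : k ≠ j) (l : List Bool) (S S' : Stk → List Bool)
    (hS : S k = l) (hS' : S' = update (update S j (l.reverse ++ S j)) k []) :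
    Runs (pour k j) S S' (2 * l.length + 1) := by
  induction l generalizing S with
  | nil =>
    rw [List.reverse_nil, List.nil_append, update_eq_self, ← hS, update_eq_self] at hS'
    subst hS'
    exact .loop_nil hS
  | cons a l ih =>
    refine (Runs.loop_cons hS (.push rfl) (ih _ ?_ ?_)).mono (by simp; omega)
    · rw [update_of_ne hkj, update_self]
    · rw [hS', update_self, update_of_ne hkj.symm]
      funext i
      by_cases hk : i = k
      · subst hk; simp
      · by_cases hj : i = j
        · subst hj; simp [update_of_ne hk]
        · simp [update_of_ne hk, update_of_ne hj]

/-- Empties the stack `k`. -/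
def clear (k : Stk) : TreeCmd := .loop k fun _ => .skip

theorem runs_clear {k : Stk} (l : List Bool) (S S' : Stk → List Bool)
    (hS : S k = l) (hS' : S' = update S k []) :
    Runs (clear k) S S' (2 * l.length + 1) := by
  induction l generalizing S with
  | nil => rw [← hS, update_eq_self] at hS'; subst hS'; exact .loop_nil hS
  | cons a l ih =>
    refine (Runs.loop_cons hS .skip (ih _ ?_ ?_)).mono (by simp; omega)
    · rw [update_self]
    · rw [hS', update_idem]

/-- The stacks at the beginning and at the end of a tree program. -/
abbrev dst (d : List Bool) : Stk → List Bool := st d [] [] [] []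

/-- Removes the top tree from the data stack. -/
def drop : TreeCmd := .seq (scan .aux) (clear .aux)

theorem runs_drop (x : Tree) (r : List Bool) :
    Runs drop (dst (x.code ++ r)) (dst r) (7 * x.size + 3) :=
  ((runs_scan_aux x r [] [] []).seq (runs_clear _ _ _ rfl (by simp))).mono
    (by simp [Tree.size]; omega)

/-- Removes the second tree from the data stack. -/
def dropSnd : TreeCmd :=
  .seq (scan .aux) (.seq (scan .aux') (.seq (clear .aux') (pour .aux .data)))

theorem runs_dropSnd (x y : Tree) (r : List Bool) :
    Runs dropSnd (dst (x.code ++ (y.code ++ r))) (dst (x.code ++ r))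
      (7 * (x.size + y.size) + 6) :=
  ((runs_scan_aux x _ [] [] []).seq ((runs_scan_aux' y _ _ [] []).seq
    ((runs_clear _ _ _ rfl rfl).seq (runs_pour (by simp) _ _ _ rfl (by simp))))).mono
    (by simp [Tree.size]; omega)

/-- Exchanges the two topmost trees of the data stack. -/
def swap : TreeCmd :=
  .seq (scan .aux) (.seq (scan .aux') (.seq (pour .aux .data) (pour .aux' .data)))

theorem runs_swap (x y : Tree) (r : List Bool) :
    Runs swap (dst (x.code ++ (y.code ++ r))) (dst (y.code ++ (x.code ++ r)))
      (7 * (x.size + y.size) + 6) :=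
  ((runs_scan_aux x _ [] [] []).seq ((runs_scan_aux' y _ _ [] []).seq
    ((runs_pour (by simp) _ _ _ rfl rfl).seq (runs_pour (by simp) _ _ _ rfl (by simp))))).mono
    (by simp [Tree.size]; omega)

/-- The loop that moves the first auxiliary stack to both the data stack and the second auxiliary
stack. -/
def copyLoop : TreeCmd := .loop .aux fun a => .seq (.push .data a) (.push .aux' a)

theorem runs_copyLoop (l d b : List Bool) :
    Runs copyLoop (st d l b [] []) (st (l.reverse ++ d) [] (l.reverse ++ b) [] [])
      (3 * l.length + 1) := by
  induction l generalizing d b with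
  | nil => exact .loop_nil rfl
  | cons a l ih =>
    refine (Runs.loop_cons rfl ((Runs.push rfl).seq (Runs.push rfl)) (m := 3 * l.length + 1) ?_).mono
      (by simp; omega)
    show Runs copyLoop _ _ _
    simpa using ih (a :: d) (a :: b)

/-- Duplicates the top tree of the data stack. -/
def dup : TreeCmd :=
  .seq (scan .aux) (.seq copyLoop (.seq (pour .aux' .aux) (pour .aux .data)))

theorem runs_dup (x : Tree) (r : List Bool) :
    Runs dup (dst (x.code ++ r)) (dst (x.code ++ (x.code ++ r))) (12 * x.size + 5) :=
  ((runs_scan_aux x _ [] [] []).seq ((runs_copyLoop _ _ _).seq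
    ((runs_pour (by simp) _ _ _ rfl rfl).seq (runs_pour (by simp) _ _ _ rfl (by simp))))).mono
    (by simp [Tree.size]; omega)

/-- The loop that compares the two auxiliary stacks, and raises the flag when they differ. -/
def cmpLoop : TreeCmd :=
  .loop .aux fun a => .case .aux' fun
    | some b => if a = b then .skip else .push .flag true
    | none => .push .flag true

/-- The loop never stops at a mismatch but always empties the first auxiliary stack. The verdict
lies in what is left: a mismatch or a too short second word raises the flag, and a too long one
leaves symbols behind. -/
theorem runs_cmpLoop (l d b f : List Bool) :
    ∃ b' f', b'.length ≤ b.length ∧ f'.length ≤ f.length + l.length ∧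
      (b' = [] ∧ f' = [] ↔ f = [] ∧ l = b) ∧
      Runs cmpLoop (st d l b [] f) (st d [] b' [] f') (3 * l.length + 1) := by
  induction l generalizing b f with
  | nil => exact ⟨b, f, le_rfl, by simp, by tauto, .loop_nil rfl⟩
  | cons a l ih =>
    rcases b with _ | ⟨b, bs⟩
    · obtain ⟨b', f', hb, hf, h, hr⟩ := ih [] (true :: f)
      refine ⟨b', f', by simpa using hb, by simp at hf ⊢; omega, by simpa using h, ?_⟩
      exact (Runs.loop_cons rfl (Runs.case_nil rfl (.push rfl)) (by show Runs cmpLoop _ _ _; simpa using hr)).mono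
        (by simp; omega)
    · by_cases hab : a = b
      · obtain ⟨b', f', hb, hf, h, hr⟩ := ih bs f
        refine ⟨b', f', by simp; omega, by simp; omega, by simpa [hab] using h, ?_⟩
        exact (Runs.loop_cons rfl (Runs.case_cons rfl (by simp only [hab]; exact .skip))
          (by show Runs cmpLoop _ _ _; simpa using hr)).mono (by simp; omega)
      · obtain ⟨b', f', hb, hf, h, hr⟩ := ih bs (true :: f)
        refine ⟨b', f', by simp; omega, by simp at hf ⊢; omega, by simpa [hab] using h, ?_⟩
        exact (Runs.loop_cons rfl (Runs.case_cons rfl (by simp only [hab]; exact .push rfl))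
          (by show Runs cmpLoop _ _ _; simpa using hr)).mono (by simp; omega)

/-- The Boolean `b` as a tree. -/
def Tree.ofBool (b : Bool) : Tree := if b then .node .nil .nil else .nil

/-- Raises the flag if the second auxiliary stack is not empty, and empties the latter. -/
def raise : TreeCmd := .loop .aux' fun _ => .push .flag true

/-- Lowers the flag, and puts on the data stack whether it was down. -/
def readFlag : TreeCmd :=
  .case .flag fun
    | none => .seq (.push .data false) (.seq (.push .data false) (.push .data true))
    | some _ => .seq (clear .flag) (.push .data false)

/-- Replaces the two topmost trees of the data stack by the truth value of their equality. -/
def eqCmd : TreeCmd :=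
  .seq (scan .aux) (.seq (scan .aux') (.seq cmpLoop (.seq raise readFlag)))

theorem runs_raise (b d f : List Bool) :
    ∃ f', f'.length = f.length + b.length ∧
      Runs raise (st d [] b [] f) (st d [] [] [] f')
        (2 * b.length + 1) := by
  induction b generalizing f with
  | nil => exact ⟨f, by simp, .loop_nil rfl⟩
  | cons a b ih =>
    obtain ⟨f', hf, h⟩ := ih (true :: f)
    refine ⟨f', by simp at hf ⊢; omega, ?_⟩
    rw [raise]
    refine Runs.mono (Runs.loop_cons rfl (.push rfl) (m := 2 * b.length + 1) ?_) (by simp; omega)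
    show Runs raise _ _ _
    simpa using h

theorem runs_eqCmd (x y : Tree) (r : List Bool) :
    Runs eqCmd (dst (x.code ++ (y.code ++ r))) (dst ((Tree.ofBool (decide (x = y))).code ++ r))
      (16 * (x.size + y.size) + 16) := by
  obtain ⟨b', f', hb, hf, h, hr⟩ := runs_cmpLoop x.code.reverse r y.code.reverse []
  obtain ⟨f'', hf', hr'⟩ := runs_raise b' r f'
  -- Leftover symbols have been converted into flags, so an empty flag stack means equal codes,
  -- hence equal trees.
  have hxy : f'' = [] ↔ x = y := by
    rw [← List.length_eq_zero_iff, hf', Nat.add_eq_zero_iff, List.length_eq_zero_iff,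
      List.length_eq_zero_iff, and_comm, h]
    simp [Tree.code_injective.eq_iff]
  simp only [List.length_reverse, List.length_nil, ← Tree.size.eq_1] at hb hf hr
  have hx : Runs readFlag (st r [] [] [] f'') (dst ((Tree.ofBool (decide (x = y))).code ++ r))
      (2 * f''.length + 5) := by
    rcases f'' with _ | ⟨a, f''⟩
    · have := hxy.1 rfl
      refine (Runs.case_nil rfl ((Runs.push rfl).seq ((Runs.push rfl).seq (Runs.push ?_)))).mono
        (by simp)
      simp [Tree.ofBool, this, Tree.code]
    · have : x ≠ y := fun h => by simp [h] at hxy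
      refine (Runs.case_cons rfl ((runs_clear f'' _ _ rfl rfl).seq (Runs.push ?_))).mono
        (by simp; omega)
      simp [Tree.ofBool, this, Tree.code]
  refine ((runs_scan_aux x (y.code ++ r) [] [] []).seq ((runs_scan_aux' y r
    (x.code.reverse ++ []) [] []).seq (Runs.seq (m := 2 * y.size + 1 + (2 * f''.length + 5))
    (by simpa using hr) ((hr'.mono (by omega)).seq hx)))).mono (by omega)

end StackProgram

/-! ## Polynomial-time functions on encoded data -/

namespace StackProgram

open Function

/-- An encoding of a type by binary trees. -/
class Enc (α : Type) where
  /-- the encoding -/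
  enc : α → Tree
  enc_injective : Injective enc

export Enc (enc enc_injective)

/-- The size of the encoding. -/
def esize {α : Type} [Enc α] (a : α) : ℕ := (enc a).size

/-- The code of the encoding. -/
def ecode {α : Type} [Enc α] (a : α) : List Bool := (enc a).code

theorem esize_pos {α : Type} [Enc α] (a : α) : 0 < esize a := Tree.size_pos _

instance : Enc Tree := ⟨id, injective_id⟩

instance : Enc Unit := ⟨fun _ => .nil, fun _ _ _ => rfl⟩

instance : Enc Bool := ⟨Tree.ofBool, fun a b h => by cases a <;> cases b <;> simp_all [Tree.ofBool]⟩

instance {α β : Type} [Enc α] [Enc β] : Enc (α × β) :=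
  ⟨fun p => .node (enc p.1) (enc p.2), fun p q h => by
    simp only [Tree.node.injEq, enc_injective.eq_iff] at h
    exact Prod.ext h.1 h.2⟩

instance {α : Type} [Enc α] : Enc (Option α) :=
  ⟨fun o => o.elim .nil fun a => .node .nil (enc a), fun o o' h => by
    cases o <;> cases o' <;> simp_all [enc_injective.eq_iff]⟩

instance {α β : Type} [Enc α] [Enc β] : Enc (α ⊕ β) :=
  ⟨Sum.elim (fun a => .node .nil (enc a)) fun b => .node (.node .nil .nil) (enc b),
    fun s s' h => by cases s <;> cases s' <;> simp_all [enc_injective.eq_iff]⟩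

/-- The encoding of a list. -/
def encList {α : Type} [Enc α] : List α → Tree
  | [] => .nil
  | a :: l => .node (enc a) (encList l)

theorem encList_injective {α : Type} [Enc α] : Injective (encList (α := α)) := fun l => by
  induction l with
  | nil => intro l' h; cases l' <;> simp_all [encList]
  | cons a l ih =>
    intro l' h
    cases l' with
    | nil => simp [encList] at h
    | cons b l' =>
      simp only [encList, Tree.node.injEq, enc_injective.eq_iff] at h
      rw [h.1, ih h.2]

instance {α : Type} [Enc α] : Enc (List α) := ⟨encList, encList_injective⟩

/-- The encoding of a natural number in unary. -/
def encNat : ℕ → Tree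
  | 0 => .nil
  | n + 1 => .node .nil (encNat n)

instance : Enc ℕ := ⟨encNat, fun n => by
  induction n with
  | zero => intro m h; cases m <;> simp_all [encNat]
  | succ n ih =>
    intro m h
    cases m with
    | zero => simp [encNat] at h
    | succ m => rw [ih (by simpa [encNat] using h)]⟩

instance {n : ℕ} : Enc (Fin n) := ⟨fun i => enc i.val, fun _ _ h => Fin.ext (enc_injective h)⟩

section

variable {α β : Type} [Enc α] [Enc β]

@[simp] theorem esize_pair (a : α) (b : β) : esize (a, b) = esize a + esize b + 1 :=
  Tree.size_node _ _

@[simp] theorem esize_nil : esize ([] : List α) = 1 := rfl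

@[simp] theorem esize_cons (a : α) (l : List α) : esize (a :: l) = esize a + esize l + 1 :=
  Tree.size_node _ _

@[simp] theorem esize_zero : esize 0 = 1 := rfl

@[simp] theorem esize_succ (n : ℕ) : esize (n + 1) = esize n + 2 := by
  show (Tree.node .nil (encNat n)).size = (encNat n).size + 2
  simp; omega

theorem esize_nat (n : ℕ) : esize n = 2 * n + 1 := by
  induction n with
  | zero => rfl
  | succ n ih => rw [esize_succ, ih]; ring

theorem esize_append (l l' : List α) : esize (l ++ l') + 1 = esize l + esize l' := by
  induction l with
  | nil => simp; omega
  | cons a l ih => rw [List.cons_append, esize_cons, esize_cons]; omega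

theorem length_le_esize (l : List α) : 2 * l.length + 1 ≤ esize l := by
  induction l with
  | nil => simp
  | cons a l ih => have := esize_pos a; simp; omega

theorem ecode_pair (a : α) (b : β) : ecode (a, b) = true :: (ecode a ++ ecode b) := rfl

end

theorem eval_mono_nat (p : Polynomial ℕ) {a b : ℕ} (h : a ≤ b) : p.eval a ≤ p.eval b := by
  rw [Polynomial.eval_eq_sum_range, Polynomial.eval_eq_sum_range]
  gcongr

/-- The function `f` is computable in polynomial time, by a tree program. -/
def PolyTime {α β : Type} [Enc α] [Enc β] (f : α → β) : Prop :=
  ∃ (c : TreeCmd) (p : Polynomial ℕ), ∀ a, esize (f a) ≤ p.eval (esize a) ∧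
    ∀ r, Runs c (dst (ecode a ++ r)) (dst (ecode (f a) ++ r)) (p.eval (esize a))

namespace PolyTime

open Polynomial

variable {α β γ σ : Type} [Enc α] [Enc β] [Enc γ] [Enc σ]

/-- A function with the same values up to the encoding. -/
theorem of_enc {γ' : Type} [Enc γ'] {f : α → γ} {g : α → γ'} (hf : PolyTime f)
    (h : ∀ a, enc (g a) = enc (f a)) : PolyTime g := by
  obtain ⟨c, p, hc⟩ := hf
  refine ⟨c, p, fun a => ?_⟩
  have := hc a
  simp only [esize, ecode, ← h] at this
  exact this

theorem id : PolyTime (fun a : α => a) :=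
  ⟨.skip, X + 1, fun a => ⟨by simp, fun r => Runs.skip.mono (by simp)⟩⟩

/-- The size bound in `PolyTime` bounds the input of the second program, so its running time is
polynomial in the original input. -/
theorem comp {f : β → γ} {g : α → β} (hf : PolyTime f) (hg : PolyTime g) :
    PolyTime fun a => f (g a) := by
  obtain ⟨c, p, hc⟩ := hf
  obtain ⟨d, q, hd⟩ := hg
  refine ⟨.seq d c, q + p.comp q, fun a => ⟨?_, fun r => ?_⟩⟩
  · rw [eval_add, eval_comp]
    exact ((hc _).1.trans (eval_mono_nat p (hd a).1)).trans (Nat.le_add_left _ _)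
  · rw [eval_add, eval_comp]
    exact ((hd a).2 r).seq (((hc _).2 r).mono (eval_mono_nat p (hd a).1))

end PolyTime

theorem runs_popData (b : Bool) (l : List Bool) :
    Runs (.case .data fun _ => .skip : TreeCmd) (dst (b :: l)) (dst l) 2 :=
  Runs.case_cons rfl (by rw [update_data]; exact .skip)

/-- Pushes a word to the data stack. -/
def pushAll : List Bool → TreeCmd
  | [] => .skip
  | b :: l => .seq (pushAll l) (.push .data b)

theorem runs_pushAll (l d : List Bool) : Runs (pushAll l) (dst d) (dst (l ++ d)) (l.length + 1) := by
  induction l with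
  | nil => exact .skip
  | cons b l ih => exact (ih.seq (Runs.push (by simp))).mono (by simp)

namespace PolyTime

open Polynomial

variable {α β γ σ : Type} [Enc α] [Enc β] [Enc γ] [Enc σ]

theorem const (b : β) : PolyTime fun _ : α => b := by
  refine ⟨.seq drop (pushAll (ecode b)), C (esize b + 4) + 7 * X, fun a => ⟨?_, fun r => ?_⟩⟩
  · simp; omega
  · refine ((runs_drop _ r).seq (runs_pushAll _ _)).mono ?_
    simp only [eval_add, eval_mul, eval_C, eval_X, eval_ofNat, esize, Tree.size, ecode]
    omega

theorem pair {f : α → β} {g : α → γ} (hf : PolyTime f) (hg : PolyTime g) :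
    PolyTime fun a => (f a, g a) := by
  obtain ⟨c, p, hc⟩ := hf
  obtain ⟨d, q, hd⟩ := hg
  -- The second component is computed first on a copy of the input. After the exchange the first is
  -- computed above it, and the final `true` is the symbol of the node that joins them.
  refine ⟨.seq dup (.seq d (.seq swap (.seq c (.push .data true)))),
    20 * X + 20 + 20 * q + 20 * p, fun a => ⟨?_, fun r => ?_⟩⟩
  · have := (hc a).1
    have := (hd a).1
    simp only [esize_pair, eval_add, eval_mul, eval_X, eval_ofNat]
    omega
  · have := (hd a).1
    refine ((runs_dup (enc a) r).seq (((hd a).2 (ecode a ++ r)).seq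
      ((runs_swap (enc (g a)) (enc a) r).seq (((hc a).2 (ecode (g a) ++ r)).seq
      (Runs.push ?_))))).mono ?_
    · simp [ecode_pair]
    · simp only [eval_add, eval_mul, eval_X, eval_ofNat, esize] at this ⊢
      omega

theorem left {f : α → β} {g : α → γ} (hf : PolyTime f) (h : ∀ a, enc (g a) = (enc (f a)).left) :
    PolyTime g := by
  refine (comp (f := Tree.left) (g := fun a => enc (f a)) ?_ (hf.of_enc fun _ => rfl)).of_enc h
  refine ⟨.case .data fun | some true => dropSnd | _ => .push .data false, 7 * X + 7,
    fun a => ?_⟩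
  rw [eval_add, eval_mul, eval_X, eval_ofNat]
  rcases a with _ | ⟨a, b⟩
  · exact ⟨by decide, fun r => (Runs.case_cons rfl (.push (by simp [ecode, Tree.left, enc, Tree.code]))).mono (by omega)⟩
  · refine ⟨?_, fun r => (Runs.case_cons (a := true) (l := a.code ++ (b.code ++ r)) ?_ ?_).mono
      (n := 7 * (a.size + b.size) + 6 + 1) ?_⟩
    · simp [esize, enc, Tree.left]; omega
    · simp [ecode, enc, Tree.code]
    · rw [update_data]; exact runs_dropSnd a b r
    · simp [esize, enc]; omega

theorem right {f : α → β} {g : α → γ} (hf : PolyTime f) (h : ∀ a, enc (g a) = (enc (f a)).right) :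
    PolyTime g := by
  refine (comp (f := Tree.right) (g := fun a => enc (f a)) ?_ (hf.of_enc fun _ => rfl)).of_enc h
  refine ⟨.case .data fun | some true => drop | _ => .push .data false, 7 * X + 7,
    fun a => ?_⟩
  rw [eval_add, eval_mul, eval_X, eval_ofNat]
  rcases a with _ | ⟨a, b⟩
  · exact ⟨by decide, fun r => (Runs.case_cons rfl (.push (by simp [ecode, Tree.right, enc, Tree.code]))).mono (by omega)⟩
  · refine ⟨?_, fun r => (Runs.case_cons (a := true) (l := a.code ++ (b.code ++ r)) ?_ ?_).mono
      (n := 7 * a.size + 3 + 1) ?_⟩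
    · simp [esize, enc, Tree.right]; omega
    · simp [ecode, enc, Tree.code]
    · rw [update_data]; exact runs_drop a (b.code ++ r)
    · simp [esize, enc]; omega

theorem fst {f : α → β × γ} (hf : PolyTime f) : PolyTime fun a => (f a).1 :=
  hf.left fun _ => rfl

theorem snd {f : α → β × γ} (hf : PolyTime f) : PolyTime fun a => (f a).2 :=
  hf.right fun _ => rfl

theorem ite {p : α → Bool} {f g : α → β} (hp : PolyTime p) (hf : PolyTime f) (hg : PolyTime g) :
    PolyTime fun a => if p a then f a else g a := by
  obtain ⟨b, o, hb⟩ := hp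
  obtain ⟨c, p', hc⟩ := hf
  obtain ⟨d, q, hd⟩ := hg
  refine ⟨.seq dup (.seq b (.case .data fun
    | some true => .seq drop (.seq drop c)
    | _ => d)), 20 * X + 40 + o + p' + q, fun a => ⟨?_, fun r => ?_⟩⟩
  · have := (hc a).1
    have := (hd a).1
    simp only [eval_add]
    split <;> omega
  · refine ((runs_dup (enc a) r).seq (((hb a).2 (ecode a ++ r)).seq (Runs.case_cons
      -- The value `true` has the code `true, false, false`; once its first symbol is popped, two
      -- leaves remain to be dropped.
      (l := (if p a then [false, false] else []) ++ (ecode a ++ r)) (a := p a)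
      (n := p'.eval (esize a) + q.eval (esize a) + 20) ?_ ?_))).mono ?_
    · cases p a <;> rfl
    · cases hp : p a
      · have h := ((hd a).2 r).mono (m := p'.eval (esize a) + q.eval (esize a) + 20) (by omega)
        simpa [hp] using h
      · have h := ((runs_drop .nil (Tree.nil.code ++ (ecode a ++ r))).seq
          ((runs_drop .nil (ecode a ++ r)).seq ((hc a).2 r))).mono
          (m := p'.eval (esize a) + q.eval (esize a) + 20) (by simp; omega)
        simpa [hp, Tree.code] using h
    · simp only [eval_add, eval_mul, eval_X, eval_ofNat, esize]
      omega

theorem decide_eq [DecidableEq β] {f g : α → β} (hf : PolyTime f) (hg : PolyTime g) :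
    PolyTime fun a => decide (f a = g a) := by
  have h : PolyTime fun x : Tree × Tree => decide (x.1 = x.2) := by
    -- Popping the node symbol of a pair leaves the codes of its components on top of the stack.
    refine ⟨.seq (.case .data fun _ => .skip) eqCmd, 20 * X + 20, fun a => ⟨?_, fun r => ?_⟩⟩
    · simp only [eval_add, eval_mul, eval_X, eval_ofNat]
      have : esize (decide (a.1 = a.2)) ≤ 3 := by cases decide (a.1 = a.2) <;> decide
      omega
    · have h := (runs_popData true (a.1.code ++ (a.2.code ++ r))).seq (runs_eqCmd a.1 a.2 r)
      refine Runs.mono (n := 2 + (16 * (a.1.size + a.2.size) + 16)) ?_ ?_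
      · simpa [ecode, enc, Tree.code] using h
      · have : esize a = a.1.size + a.2.size + 1 := Tree.size_node _ _
        simp only [eval_add, eval_mul, eval_X, eval_ofNat]
        omega
  refine (h.comp (g := fun a => (enc (f a), enc (g a)))
    ((hf.of_enc fun _ => rfl).pair (hg.of_enc fun _ => rfl))).of_enc fun a => ?_
  simp only [enc_injective.eq_iff]

/-! ### Folds -/

/-- The test of a fold: whether the left subtree of the top tree is a node. The flag is raised again
after the body has been run. -/
def foldLoop (c : TreeCmd) : TreeCmd :=
  .loop .flag fun _ => .case .data fun
    | some true => .case .data fun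
      | some true => .seq (.push .data true) (.seq (.push .data true) (.seq c (.push .flag true)))
      -- The list is empty: both popped symbols are restored, and the flag stays down, which ends
      -- the loop.
      | _ => .seq (.push .data false) (.push .data true)
    | _ => .push .data false

/-- The data stack holds the triple of remaining list, current state and parameter. Since `m` bounds
the states after all prefixes of the list, one bound on the running time of the body serves every
iteration. -/
theorem runs_foldLoop {h : α × σ × β → σ} {c : TreeCmd} {p : Polynomial ℕ}
    (hc : ∀ y : (β × List β) × σ × α, ∀ r, Runs c (dst (ecode y ++ r))
      (dst (ecode (y.1.2, h (y.2.2, y.2.1, y.1.1), y.2.2) ++ r)) (p.eval (esize y)))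
    (a : α) (r : List Bool) (l : List β) (s : σ) (n m : ℕ) (hn : esize l ≤ n)
    (hm : ∀ l', l' <+: l → esize (l'.foldl (fun s b => h (a, s, b)) s) ≤ m) :
    Runs (foldLoop c) (st (ecode (l, s, a) ++ r) [] [] [] [true])
      (dst (ecode (([] : List β), l.foldl (fun s b => h (a, s, b)) s, a) ++ r))
      (l.length * (p.eval (n + m + esize a + 2) + 10) + 10) := by
  induction l generalizing s with
  | nil =>
    refine Runs.mono (Runs.loop_cons rfl (Runs.case_cons (a := true)
      (l := false :: true :: (ecode s ++ (ecode a ++ r))) ?_ (Runs.case_cons (a := false)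
      (l := true :: (ecode s ++ (ecode a ++ r))) ?_ ((Runs.push rfl).seq (Runs.push rfl))))
      (S'' := dst (ecode (([] : List β), s, a) ++ r)) (m := 1) ?_) (by simp +arith)
    · simp [ecode, enc, encList, Tree.code]
    · simp
    · have h₀ : Runs (foldLoop c) (dst (ecode (([] : List β), s, a) ++ r))
        (dst (ecode (([] : List β), s, a) ++ r)) 1 := Runs.loop_nil rfl
      refine Eq.mp (congrArg (fun S => Runs (foldLoop c) S _ 1) ?_) h₀
      simp [ecode, enc, encList, Tree.code]
  | cons b l ih =>
    have hl : esize l ≤ n := by rw [esize_cons] at hn; omega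
    have hs := hm [] (List.nil_prefix)
    rw [List.foldl_nil] at hs
    have ih := ih (h (a, s, b)) hl fun l' hl' => by
      have := hm (b :: l') ((List.prefix_cons_inj b).2 hl')
      simpa using this
    have hb := (hc ((b, l), s, a) r).mono (m := p.eval (n + m + esize a + 2)) (eval_mono_nat p (by
      rw [esize_cons] at hn
      simp only [esize_pair]
      omega))
    refine Runs.mono (Runs.loop_cons rfl (Runs.case_cons (a := true)
      (l := true :: (ecode b ++ (ecode l ++ true :: (ecode s ++ (ecode a ++ r))))) ?_ (Runs.case_cons
      (a := true) (l := (ecode b ++ (ecode l ++ true :: (ecode s ++ (ecode a ++ r))))) ?_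
      ((Runs.push rfl).seq ((Runs.push rfl).seq (Runs.seq (n := p.eval (n + m + esize a + 2))
      (S' := dst (ecode (l, h (a, s, b), a) ++ r)) ?_ (Runs.push rfl))))))
      (m := l.length * (p.eval (n + m + esize a + 2) + 10) + 10) ?_) ?_
    · simp [ecode, enc, encList, Tree.code]
    · simp
    · convert hb using 1
      simp [ecode, enc, encList, Tree.code]
    · show Runs (foldLoop c) _ _ _
      simpa using ih
    · simp only [List.length_cons]
      ring_nf
      omega

/-- The bound `m` on intermediate states is essential: iterating a polynomial-time step without it
could produce results of exponential size. -/
theorem foldl {L : α → List β} {A : α → σ} {h : α × σ × β → σ} (hL : PolyTime L)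
    (hA : PolyTime A) (hh : PolyTime h) (m : Polynomial ℕ)
    (hm : ∀ a l, l <+: L a →
      esize (l.foldl (fun s b => h (a, s, b)) (A a)) ≤ m.eval (esize a)) :
    PolyTime fun a => (L a).foldl (fun s b => h (a, s, b)) (A a) := by
  -- A nonempty list has the encoding of the pair of its head and tail, so the body of the loop can
  -- be taken as a function on such pairs.
  obtain ⟨c, p, hc⟩ : PolyTime fun y : (β × List β) × σ × α =>
      (y.1.2, h (y.2.2, y.2.1, y.1.1), y.2.2) :=
    id.fst.snd.pair ((hh.comp (id.snd.snd.pair (id.snd.fst.pair id.fst.fst))).pair id.snd.snd)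
  have h₁ : PolyTime fun a => ((L a, A a, a) : List β × σ × α) := hL.pair (hA.pair id)
  obtain ⟨d, q, hd⟩ := h₁
  have h₂ : PolyTime fun a => ((([] : List β), (L a).foldl (fun s b => h (a, s, b)) (A a), a) :
      List β × σ × α) := by
    refine ⟨.seq d (.seq (.push .flag true) (foldLoop c)),
      q + 20 + m + X + q * (p.comp (q + m + X + 2) + 10), fun a => ⟨?_, fun r => ?_⟩⟩
    · have := hm a _ List.prefix_rfl
      simp only [eval_add, eval_X, eval_ofNat, esize_pair, esize_nil]
      omega
    · have hq := (hd a).1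
      rw [esize_pair] at hq
      have hlen := length_le_esize (L a)
      have := runs_foldLoop (fun y => (hc y).2) a r (L a) (A a) (q.eval (esize a))
        (m.eval (esize a)) (by omega) (hm a)
      refine (((hd a).2 r).seq ((Runs.push (by simp)).seq this)).mono ?_
      simp only [eval_add, eval_mul, eval_comp, eval_X, eval_ofNat]
      have : (L a).length ≤ q.eval (esize a) := by omega
      have := Nat.mul_le_mul_right
        (p.eval (q.eval (esize a) + m.eval (esize a) + esize a + 2) + 10) this
      omega
  exact h₂.snd.fst

end PolyTime

end StackProgram

/-! ## Polynomial-time functions on lists and numbers -/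

namespace StackProgram

open Function

theorem esize_reverse {α : Type} [Enc α] (l : List α) : esize l.reverse = esize l := by
  induction l with
  | nil => rfl
  | cons a l ih =>
    have := esize_append l.reverse [a]
    rw [List.reverse_cons, esize_cons]
    rw [esize_cons, esize_nil] at this
    omega

theorem esize_le_of_prefix {α : Type} [Enc α] {l l' : List α} (h : l <+: l') :
    esize l ≤ esize l' := by
  obtain ⟨m, rfl⟩ := h
  have := esize_append l m
  have := esize_pos m
  omega

theorem esize_le_of_mem {α : Type} [Enc α] {l : List α} {a : α} (h : a ∈ l) :
    esize a ≤ esize l := by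
  induction l with
  | nil => simp at h
  | cons b l ih =>
    rw [esize_cons]
    rcases List.mem_cons.1 h with rfl | h
    · omega
    · have := ih h; omega

theorem esize_flatMap_le {α β : Type} [Enc α] [Enc β] (l : List α) (f : α → List β) (n : ℕ)
    (h : ∀ a ∈ l, esize (f a) ≤ n) : esize (l.flatMap f) ≤ l.length * n + 1 := by
  induction l with
  | nil => simp
  | cons a l ih =>
    have := ih fun a ha => h a (List.mem_cons_of_mem _ ha)
    have := h a List.mem_cons_self
    have := esize_append (f a) (l.flatMap f)
    rw [List.flatMap_cons, List.length_cons, Nat.succ_mul]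
    omega

namespace PolyTime

open Polynomial

variable {α β γ σ : Type} [Enc α] [Enc β] [Enc γ] [Enc σ]

theorem exists_esize_le {f : α → β} (hf : PolyTime f) :
    ∃ p : Polynomial ℕ, ∀ a, esize (f a) ≤ p.eval (esize a) :=
  let ⟨_, p, h⟩ := hf
  ⟨p, fun a => (h a).1⟩

theorem cons {f : α → β} {g : α → List β} (hf : PolyTime f) (hg : PolyTime g) :
    PolyTime fun a => f a :: g a :=
  (hf.pair hg).of_enc fun _ => rfl

theorem singleton {f : α → β} (hf : PolyTime f) : PolyTime fun a => [f a] :=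
  hf.cons (const _)

theorem tail {f : α → List β} (hf : PolyTime f) : PolyTime fun a => (f a).tail :=
  hf.right fun a => by cases f a <;> rfl

theorem headD {f : α → List ℕ} (hf : PolyTime f) : PolyTime fun a => (f a).headD 0 :=
  hf.left fun a => by cases f a <;> rfl

theorem getD {f : α → List ℕ} (hf : PolyTime f) (i : ℕ) : PolyTime fun a => (f a).getD i 0 := by
  induction i generalizing f with
  | zero =>
    convert hf.headD using 2 with a
    cases f a <;> rfl
  | succ i ih =>
    convert ih hf.tail using 2 with a
    cases f a <;> rfl

theorem reverse {f : α → List β} (hf : PolyTime f) : PolyTime fun a => (f a).reverse := by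
  have key : ∀ l s : List β, l.foldl (fun s b => b :: s) s = l.reverse ++ s := by
    intro l
    induction l with
    | nil => simp
    | cons a l ih => intro s; rw [List.foldl_cons, ih]; simp
  obtain ⟨p, hp⟩ := hf.exists_esize_le
  convert foldl (h := fun y : α × List β × β => y.2.2 :: y.2.1) hf (const [])
    (id.snd.snd.cons id.snd.fst) p ?_ using 2 with a
  · rw [key, List.append_nil]
  · intro a l hl
    rw [key, List.append_nil, esize_reverse]
    exact (esize_le_of_prefix hl).trans (hp a)

/-- Consing the elements of the reversed first list onto the second one is a fold. -/
theorem append {f g : α → List β} (hf : PolyTime f) (hg : PolyTime g) :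
    PolyTime fun a => f a ++ g a := by
  have key : ∀ l s : List β, l.foldl (fun s b => b :: s) s = l.reverse ++ s := by
    intro l
    induction l with
    | nil => simp
    | cons a l ih => intro s; rw [List.foldl_cons, ih]; simp
  obtain ⟨p, hp⟩ := hf.exists_esize_le
  obtain ⟨q, hq⟩ := hg.exists_esize_le
  convert foldl (h := fun y : α × List β × β => y.2.2 :: y.2.1) hf.reverse hg
    (id.snd.snd.cons id.snd.fst) (p + q) ?_ using 2 with a
  · rw [key, List.reverse_reverse]
  · intro a l hl
    have h := esize_append l.reverse (g a)
    have := (esize_le_of_prefix hl).trans ((esize_reverse (f a)).le.trans (hp a))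
    have := hq a
    rw [esize_reverse] at h
    rw [key, eval_add]
    omega

/-- The accumulated list is bounded by the number of pieces times a common bound on their sizes, so
the fold is admissible. -/
theorem flatMap {f : α → List β} {h : α × β → List γ} (hf : PolyTime f) (hh : PolyTime h) :
    PolyTime fun a => (f a).flatMap fun b => h (a, b) := by
  have key : ∀ a (l : List β) (s : List γ), l.foldl (fun s b => s ++ h (a, b)) s =
      s ++ l.flatMap fun b => h (a, b) := by
    intro a l
    induction l with
    | nil => simp
    | cons b l ih => intro s; rw [List.foldl_cons, ih]; simp
  obtain ⟨p, hp⟩ := hf.exists_esize_le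
  obtain ⟨q, hq⟩ := hh.exists_esize_le
  convert foldl (h := fun y : α × List γ × β => y.2.1 ++ h (y.1, y.2.2)) hf (const [])
    (id.snd.fst.append (hh.comp (id.fst.pair id.snd.snd))) (p * q.comp (X + p + 1) + 1) ?_
    using 2 with a
  · rw [key, List.nil_append]
  · intro a l hl
    have hle := (esize_le_of_prefix hl).trans (hp a)
    have hlen := length_le_esize l
    rw [key, List.nil_append]
    refine (esize_flatMap_le l _ (q.eval (esize a + p.eval (esize a) + 1)) fun b hb => ?_).trans ?_
    · refine (hq _).trans (eval_mono_nat q ?_)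
      rw [esize_pair]
      have := esize_le_of_mem hb
      omega
    · simp only [eval_add, eval_mul, eval_comp, eval_X, eval_one]
      gcongr
      omega

theorem map {f : α → List β} {h : α × β → γ} (hf : PolyTime f) (hh : PolyTime h) :
    PolyTime fun a => (f a).map fun b => h (a, b) := by
  convert hf.flatMap hh.singleton using 2 with a
  rw [List.map_eq_flatMap]

theorem not {p : α → Bool} (hp : PolyTime p) : PolyTime fun a => !p a := by
  convert hp.ite (const false) (const true) using 2 with a
  cases p a <;> rfl

theorem and {p q : α → Bool} (hp : PolyTime p) (hq : PolyTime q) :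
    PolyTime fun a => p a && q a := by
  convert hp.ite hq (const false) using 2 with a
  cases p a <;> rfl

theorem any {f : α → List β} {p : α × β → Bool} (hf : PolyTime f) (hp : PolyTime p) :
    PolyTime fun a => (f a).any fun b => p (a, b) := by
  -- Each element that passes the test contributes a unit; the test for `any` is that the resulting
  -- list is not empty.
  convert ((hf.flatMap (hp.ite (const [()]) (const []))).decide_eq (const [])).not using 2 with a
  induction f a with
  | nil => rfl
  | cons b l ih => cases h : p (a, b) <;> simp_all

theorem all {f : α → List β} {p : α × β → Bool} (hf : PolyTime f) (hp : PolyTime p) :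
    PolyTime fun a => (f a).all fun b => p (a, b) := by
  convert (hf.any hp.not).not using 2 with a
  rw [List.not_any_eq_all_not]
  simp

theorem decide_mem [DecidableEq β] {f : α → β} {g : α → List β} (hf : PolyTime f)
    (hg : PolyTime g) : PolyTime fun a => decide (f a ∈ g a) := by
  convert hg.any ((hf.comp id.fst).decide_eq id.snd) using 2 with a
  simp [List.any_eq]

theorem succ {f : α → ℕ} (hf : PolyTime f) : PolyTime fun a => f a + 1 :=
  ((const (β := Unit) ()).pair hf).of_enc fun _ => rfl

/-- A unary number and a list of that many units have the same encoding, so numbers can control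
folds. -/
theorem units {f : α → ℕ} (hf : PolyTime f) : PolyTime fun a => List.replicate (f a) () :=
  hf.of_enc fun a => by
    induction f a with
    | zero => rfl
    | succ n ih => exact congrArg (Tree.node .nil) ih

theorem replicate {f : α → ℕ} {g : α → β} (hf : PolyTime f) (hg : PolyTime g) :
    PolyTime fun a => List.replicate (f a) (g a) := by
  convert hf.units.map (hg.comp id.fst) using 2 with a
  simp

theorem length {f : α → List β} (hf : PolyTime f) : PolyTime fun a => (f a).length := by
  have h : PolyTime fun a => (f a).map fun _ => () := hf.map (const ())
  refine h.of_enc fun a => ?_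
  induction f a with
  | nil => rfl
  | cons b l ih => exact congrArg (Tree.node .nil) ih

/-- A fold that ignores its list elements and conses the current length onto the accumulator
produces the range backwards. -/
theorem range {f : α → ℕ} (hf : PolyTime f) : PolyTime fun a => List.range (f a) := by
  have key : ∀ l : List Unit, l.foldl (fun (s : List ℕ) _ => s.length :: s) [] =
      (List.range l.length).reverse := by
    intro l
    induction l using List.reverseRecOn with
    | nil => rfl
    | append_singleton l a ih => simp [ih, List.range_succ]
  obtain ⟨p, hp⟩ := hf.exists_esize_le
  have h := foldl (h := fun y : α × List ℕ × Unit => y.2.1.length :: y.2.1) hf.units (const [])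
    (id.snd.fst.length.cons id.snd.fst) (p * (p + 3) + 1) ?_
  · convert h.reverse using 2 with a
    rw [key, List.reverse_reverse, List.length_replicate]
  · intro a l hl
    have hle : l.length ≤ f a := by simpa using hl.length_le
    have hpa := hp a
    rw [esize_nat] at hpa
    rw [key, esize_reverse, ← List.flatMap_singleton' (List.range l.length)]
    refine (esize_flatMap_le _ _ (p.eval (esize a) + 3) fun b hb => ?_).trans ?_
    · have := List.mem_range.1 hb
      simp only [esize_cons, esize_nil, esize_nat]
      omega
    · simp only [eval_add, eval_mul, eval_ofNat, eval_one, List.length_range]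
      gcongr
      omega

/-- Numbers are in unary, so listing all smaller numbers is affordable. -/
theorem decide_lt {f g : α → ℕ} (hf : PolyTime f) (hg : PolyTime g) :
    PolyTime fun a => decide (f a < g a) := by
  convert hf.decide_mem hg.range using 2 with a
  simp

/-- The function is a finite table, looked up by a chain of equality tests. -/
theorem of_fintype [Fintype α] (f : α → β) : PolyTime f := by
  classical
  rcases isEmpty_or_nonempty α with h | ⟨⟨a₀⟩⟩
  · exact ⟨.skip, 0, fun a => h.elim a⟩
  have key : ∀ l : List α, PolyTime fun a => if a ∈ l then f a else f a₀ := by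
    intro l
    induction l with
    | nil => simpa using const (f a₀)
    | cons b l ih =>
      convert (id.decide_eq (const b)).ite (const (f b)) ih using 2 with a
      by_cases h : a = b <;> simp [h]
  simpa using key Finset.univ.toList

end PolyTime

end StackProgram

/-! ## Polynomial-time functions after fixed-parameter tractable functions -/

namespace StackProgram

open Function Parameterized

/-! ### Enlarging the set of stacks -/

section LiftCmd

variable {K₁ K : Type} {Γ₁ : K₁ → Type} {Γ : K → Type}

/-- A program, as a program over a larger set of stacks. -/
def Cmd.lift : Cmd Γ₁ → Cmd (Sum.elim Γ₁ Γ)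
  | .skip => .skip
  | .push k a => .push (Sum.inl k) a
  | .case k b => .case (Sum.inl k) fun o : Option (Γ₁ k) => (b o).lift
  | .seq p q => .seq p.lift q.lift
  | .loop k b => .loop (Sum.inl k) fun a : Γ₁ k => (b a).lift

variable [DecidableEq K₁] [DecidableEq K]

theorem Big.lift {c : Cmd Γ₁} {S S' : ∀ k, List (Γ₁ k)} {t : ℕ} (h : Big c S S' t)
    (R : ∀ k, List (Γ k)) : Big (c.lift : Cmd (Sum.elim Γ₁ Γ)) (join S R) (join S' R) t := by
  induction h with
  | skip S => exact .skip _
  | push S k a => rw [← update_join_inl]; exact .push _ _ _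
  | @case S S' k b t _ ih =>
    rw [← update_join_inl] at ih
    exact .case (k := Sum.inl k) ih
  | seq _ _ ih ih' => exact .seq ih ih'
  | loop_nil hS => exact .loop_nil hS
  | @loop_cons S S' S'' k b a l t t' hS _ _ ih ih' =>
    rw [← update_join_inl] at ih
    exact .loop_cons (k := Sum.inl k) hS ih ih'

theorem Runs.lift {c : Cmd Γ₁} {S S' : ∀ k, List (Γ₁ k)} {n : ℕ} (h : Runs c S S' n)
    (R : ∀ k, List (Γ k)) : Runs (c.lift : Cmd (Sum.elim Γ₁ Γ)) (join S R) (join S' R) n :=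
  let ⟨t, ht, hb⟩ := h
  ⟨t, ht, hb.lift R⟩

end LiftCmd

/-- The alphabets of a tree program together with an input stack and an output stack. -/
abbrev Alph (β γ : Type) : Stk ⊕ Unit ⊕ Unit → Type :=
  Sum.elim (fun _ => Bool) (Sum.elim (fun _ => β) fun _ => γ)

/-- Programs with an input stack and an output stack. -/
abbrev IOCmd (β γ : Type) : Type := Cmd (Alph β γ)

/-! ### Programs with an input and an output stack -/

section InputOutput

variable {β γ : Type}

/-- The stacks of a program with input and output. -/
def full (S : Stk → List Bool) (i : List β) (o : List γ) : ∀ k, List (Alph β γ k) :=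
  join S (join (fun _ => i) fun _ => o)

theorem update_full_inl (S : Stk → List Bool) (i : List β) (o : List γ) (k : Stk) (x : List Bool) :
    update (full S i o) (Sum.inl k) x = full (update S k x) i o :=
  update_join_inl _ _ _ _

theorem update_full_inp (S : Stk → List Bool) (i : List β) (o : List γ) (x : List β) :
    update (full S i o) (Sum.inr (Sum.inl ())) x = full S x o := by
  funext k
  rcases k with k | k | k <;> rfl

theorem update_full_out (S : Stk → List Bool) (i : List β) (o : List γ) (x : List γ) :
    update (full S i o) (Sum.inr (Sum.inr ())) x = full S i x := by
  funext k
  rcases k with k | k | k <;> rfl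

section Rules

variable {S S₁ : Stk → List Bool} {i : List β} {o : List γ} {S' S'' : ∀ k, List (Alph β γ k)}
  {k : Stk} {a : Bool} {l : List Bool} {n m : ℕ}

theorem Runs.push_inl (h : S₁ = update S k (a :: S k)) :
    Runs (.push (Sum.inl k) a : IOCmd β γ) (full S i o) (full S₁ i o) 1 :=
  Runs.push (h ▸ (update_full_inl S i o k (a :: S k)).symm)

theorem Runs.case_inl {b : Option Bool → IOCmd β γ} (hS : S k = a :: l)
    (h : Runs (b (some a)) (full (update S k l) i o) S' n) :
    Runs (.case (Sum.inl k) b) (full S i o) S' (n + 1) :=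
  Runs.case_cons (k := Sum.inl k) hS
    (Eq.mp (congrArg (fun S => Runs _ S _ _) (update_full_inl S i o k l).symm) h)

theorem Runs.loop_inl {b : Bool → IOCmd β γ} (hS : S k = a :: l)
    (h : Runs (b a) (full (update S k l) i o) S' n) (h' : Runs (.loop (Sum.inl k) b) S' S'' m) :
    Runs (.loop (Sum.inl k) b) (full S i o) S'' (n + m + 1) :=
  Runs.loop_cons (k := Sum.inl k) hS
    (Eq.mp (congrArg (fun S => Runs _ S _ _) (update_full_inl S i o k l).symm) h) h'

theorem Runs.loop_inl_nil {b : Bool → IOCmd β γ} (hS : S k = []) :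
    Runs (.loop (Sum.inl k) b) (full S i o) (full S i o) 1 :=
  Runs.loop_nil (k := Sum.inl k) hS

theorem Runs.loop_inp_nil {b : β → IOCmd β γ} :
    Runs (.loop (Sum.inr (Sum.inl ())) b) (full S [] o) (full S [] o) 1 :=
  Runs.loop_nil (k := Sum.inr (Sum.inl ())) (S := full S [] o) rfl

theorem Runs.loop_inp {b : β → IOCmd β γ} {x : β}
    (h : Runs (b x) (full S i o) S' n) (h' : Runs (.loop (Sum.inr (Sum.inl ())) b) S' S'' m) :
    Runs (.loop (Sum.inr (Sum.inl ())) b) (full S (x :: i) o) S'' (n + m + 1) :=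
  Runs.loop_cons (k := Sum.inr (Sum.inl ())) (a := x) (l := i) rfl
    (Eq.mp (congrArg (fun S => Runs _ S _ _) (update_full_inp S (x :: i) o i).symm) h) h'

theorem Runs.push_out {x : γ} :
    Runs (.push (Sum.inr (Sum.inr ())) x : IOCmd β γ) (full S i o) (full S i (x :: o)) 1 :=
  Runs.push (k := Sum.inr (Sum.inr ())) (update_full_out S i o (x :: o)).symm

end Rules

/-- Reads the input stack, and puts the reversed input on the data stack, as a list. -/
def load [Enc β] : IOCmd β γ :=
  .seq (.push (Sum.inl Stk.data) false)
    (.loop (Sum.inr (Sum.inl ())) fun a : β => (pushAll (true :: ecode a)).lift)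

/-- Pushing the code of a symbol and then a node symbol conses it to the list on the data stack.
Consing reverses the order of the input stack. -/
theorem runs_loadLoop [Enc β] (m : ℕ) (hm : ∀ a : β, esize a ≤ m) (i : List β) (l : List β)
    (o : List γ) :
    Runs (.loop (Sum.inr (Sum.inl ())) fun a : β => (pushAll (true :: ecode a)).lift : IOCmd β γ)
      (full (dst (ecode l)) i o) (full (dst (ecode (i.reverse ++ l))) [] o)
      (i.length * (m + 3) + 1) := by
  induction i generalizing l with
  | nil => exact Runs.loop_inp_nil.mono (by simp)
  | cons a i ih =>
    have h₁ : Runs ((pushAll (true :: ecode a)).lift : IOCmd β γ) (full (dst (ecode l)) i o)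
      (full (dst (ecode (a :: l))) i o) _ := (runs_pushAll (true :: ecode a) (ecode l)).lift _
    have hlen : (true :: ecode a).length + 1 = esize a + 2 := rfl
    have := hm a
    rw [List.reverse_cons, List.append_assoc, List.singleton_append]
    refine Runs.mono (Runs.loop_inp h₁ (ih (a :: l))) ?_
    rw [List.length_cons (as := i)]
    ring_nf at hlen ⊢
    omega

theorem runs_load [Enc β] (m : ℕ) (hm : ∀ a : β, esize a ≤ m) (i : List β) :
    Runs (load : IOCmd β γ) (full (dst []) i []) (full (dst (ecode i.reverse)) [] [])
      (i.length * (m + 3) + 2) := by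
  have h := runs_loadLoop (γ := γ) m hm i [] []
  rw [List.append_nil] at h
  exact ((Runs.push_inl (update_data _ _ _ _ _ _).symm).seq h).mono (by omega)

/-- Reads a number less than `n` from the data stack and continues with `b`. -/
def readNat : ℕ → (ℕ → IOCmd β γ) → IOCmd β γ
  | 0, _ => .skip
  | n + 1, b => .case (Sum.inl Stk.data) fun
    | some true => .case (Sum.inl Stk.data) fun _ => readNat n fun i => b (i + 1)
    | _ => b 0

/-- Each successor is coded by `true, false`, which takes two pops; the value read is kept in the
control, by the choice of the continuation. -/
theorem runs_readNat {n i : ℕ} (hi : i < n) (b : ℕ → IOCmd β γ) (r f : List Bool) (j : List β)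
    (o : List γ) {S : ∀ k, List (Alph β γ k)} {t : ℕ}
    (h : Runs (b i) (full (st r [] [] [] f) j o) S t) :
    Runs (readNat n b) (full (st (ecode i ++ r) [] [] [] f) j o) S (t + 2 * n) := by
  induction n generalizing i b with
  | zero => simp at hi
  | succ n ih =>
    cases i with
    | zero =>
      refine Runs.mono (Runs.case_inl (a := false) (l := r) rfl (n := t) ?_) (by omega)
      rw [update_data]
      exact h
    | succ i =>
      have h := ih (i := i) (by omega) (fun i => b (i + 1)) h
      refine Runs.mono (Runs.case_inl (a := true) (l := false :: (ecode i ++ r)) rfl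
        (Runs.case_inl (a := false) (l := ecode i ++ r) (n := t + 2 * n) ?_ ?_)) (by omega)
      · rw [update_data]; rfl
      · rw [update_data, update_data]; exact h

/-- The loop that moves a list of numbers less than `n` from the data stack to the output stack,
where each number `i` is replaced by `d i`. -/
def unloadLoop (n : ℕ) (d : ℕ → γ) : IOCmd β γ :=
  .loop (Sum.inl Stk.flag) fun _ => .case (Sum.inl Stk.data) fun
    | some true => readNat n fun i =>
      .seq (.push (Sum.inr (Sum.inr ())) (d i)) (.push (Sum.inl Stk.flag) true)
    | _ => .skip

theorem runs_unloadLoop (n : ℕ) (d : ℕ → γ) (l : List ℕ) (hl : ∀ i ∈ l, i < n) (j : List β)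
    (o : List γ) :
    Runs (unloadLoop n d) (full (st (ecode l) [] [] [] [true]) j o)
      (full (dst []) j ((l.map d).reverse ++ o)) (l.length * (2 * n + 4) + 4) := by
  induction l generalizing o with
  | nil =>
    refine Runs.mono (Runs.loop_inl (a := true) (l := []) rfl
      (Runs.case_inl (a := false) (l := []) ?_ (n := 1)
        (S' := full (dst []) j o) ?_) (m := 1) (.loop_inl_nil ?_)) (by simp)
    · rw [update_flag]; rfl
    · rw [update_flag, update_data]; exact .skip
    · rfl
  | cons i l ih =>
    have h := ih (fun i hi => hl i (List.mem_cons_of_mem _ hi)) (d i :: o)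
    rw [List.map_cons, List.reverse_cons, List.append_assoc, List.singleton_append]
    refine Runs.mono (Runs.loop_inl (a := true) (l := []) rfl (Runs.case_inl (a := true)
      (l := ecode i ++ ecode l) (n := 2 + 2 * n)
      (S' := full (st (ecode l) [] [] [] [true]) j (d i :: o)) ?_ ?_) h) ?_
    · rw [update_flag]; rfl
    · rw [update_flag, update_data]
      exact runs_readNat (hl i List.mem_cons_self) _ _ _ _ _
        (Runs.push_out.seq (Runs.push_inl (update_flag _ _ _ _ _ _).symm))
    · rw [List.length_cons]; ring_nf; omega

end InputOutput

/-- A polynomial-time function from words to words is computed by a program with input and output.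
The program expects the input in reversed order. -/
theorem PolyTime.exists_ioCmd {β γ : Type} [Enc β] [Enc γ] [Fintype β] [Fintype γ] [Nonempty γ]
    {f : List β → List γ} (hf : PolyTime f) :
    ∃ (c : IOCmd β γ) (p : Polynomial ℕ), ∀ w : List β,
      Runs c (full (dst []) w.reverse []) (full (dst []) [] (f w)) (p.eval w.length) := by
  obtain ⟨m, hm⟩ : ∃ m, ∀ a : β, esize a ≤ m :=
    ⟨∑ a : β, esize a, fun a => Finset.single_le_sum (f := fun a : β => esize a)
      (fun _ _ => Nat.zero_le _) (Finset.mem_univ a)⟩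
  -- Output symbols travel through the binary data stack as their indices and are decoded when they
  -- are pushed to the output stack.
  let idx : γ → ℕ := fun a => (Fintype.equivFin γ a).val
  let d : ℕ → γ := fun i =>
    if h : i < Fintype.card γ then (Fintype.equivFin γ).symm ⟨i, h⟩ else Classical.arbitrary γ
  have hd : ∀ a, d (idx a) = a := fun a => by simp [d, idx]
  -- Unloading reverses the list, so the program computes the indices of the reversed output.
  obtain ⟨c, p, hc⟩ := hf.reverse.map (h := fun x : List β × γ => idx x.2)
    ((PolyTime.of_fintype idx).comp PolyTime.id.snd)
  set N := Fintype.card γ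
  refine ⟨.seq load (.seq c.lift (.seq (.push (Sum.inl Stk.flag) true) (unloadLoop N d))),
    Polynomial.C (m + 3) * Polynomial.X + 10 + Polynomial.C (2 * N + 10) *
    p.comp (Polynomial.C (m + 1) * Polynomial.X + 1), fun w => ?_⟩
  have h₁ := runs_load (γ := γ) m hm w.reverse
  rw [List.reverse_reverse, List.length_reverse] at h₁
  have h₂ : Runs (c.lift : IOCmd β γ) (full (dst (ecode w)) [] [])
      (full (dst (ecode (((f w).reverse).map idx))) [] []) (p.eval (esize w)) := by
    have h := (hc w).2 []
    rw [List.append_nil, List.append_nil] at h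
    exact h.lift _
  have h₃ := runs_unloadLoop (β := β) N d (((f w).reverse).map idx)
    (fun i hi => by
      obtain ⟨a, _, rfl⟩ := List.mem_map.1 hi
      exact (Fintype.equivFin γ a).isLt) [] []
  have hid : (((f w).reverse.map idx).map d).reverse = f w := by
    rw [List.map_map, show d ∘ idx = _root_.id from funext hd, List.map_id, List.reverse_reverse]
  rw [hid, List.append_nil] at h₃
  refine (h₁.seq (h₂.seq ((Runs.push_inl (update_flag _ _ _ _ _ _).symm).seq h₃))).mono ?_
  have hw : esize w ≤ (m + 1) * w.length + 1 := by
    clear * - hm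
    induction w with
    | nil => simp
    | cons a w ih =>
      have := hm a
      rw [esize_cons, List.length_cons, Nat.mul_succ]
      omega
  have hp := eval_mono_nat p hw
  have hlen : 2 * (((f w).reverse).map idx).length + 1 ≤ p.eval ((m + 1) * w.length + 1) :=
    (length_le_esize _).trans ((hc w).1.trans hp)
  have h₅ := Nat.mul_le_mul_right (2 * N + 4)
    (show (((f w).reverse).map idx).length ≤ p.eval ((m + 1) * w.length + 1) from by omega)
  simp only [Polynomial.eval_add, Polynomial.eval_mul, Polynomial.eval_comp, Polynomial.eval_X,
    Polynomial.eval_C, Polynomial.eval_one, Polynomial.eval_ofNat]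
  ring_nf at h₅ hp ⊢
  omega

end StackProgram

/-! ### Time bounds and composition with fpt functions -/

namespace StackProgram

open Function Parameterized Turing

/-- Coefficients are natural numbers, so each is at most its square, and each term of `p` at `a * b`
is bounded by a product of terms. This splits a polynomial bound in `f k * p |w|` into a factor
depending on `k` and a polynomial in the length. -/
theorem eval_mul_le (p : Polynomial ℕ) (a b : ℕ) : p.eval (a * b) ≤ p.eval a * p.eval b := by
  simp only [Polynomial.eval_eq_sum_range]
  rw [Finset.sum_mul]
  refine Finset.sum_le_sum fun i hi => ?_
  have h := Finset.single_le_sum (f := fun i => p.coeff i * b ^ i) (fun _ _ => Nat.zero_le _) hi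
  calc p.coeff i * (a * b) ^ i ≤ p.coeff i * p.coeff i * (a * b) ^ i :=
        Nat.mul_le_mul_right _ (Nat.le_mul_self _)
    _ = (p.coeff i * a ^ i) * (p.coeff i * b ^ i) := by rw [mul_pow]; ring
    _ ≤ _ := Nat.mul_le_mul_left _ h

theorem primrec_eval (p : Polynomial ℕ) : Primrec fun n : ℕ => p.eval n := by
  induction p using Polynomial.induction_on' with
  | add p q hp hq =>
    simpa using Primrec.nat_add.comp hp hq
  | monomial i c =>
    have h : Primrec fun n : ℕ => n ^ i := by
      induction i with
      | zero => simpa using Primrec.const 1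
      | succ i ih => simpa [pow_succ] using Primrec.nat_mul.comp ih Primrec.id
    simpa using Primrec.nat_mul.comp (Primrec.const c) h

theorem length_tapeWord {α : Type} (x : List α × ℕ) : (tapeWord x).length = x.2 + x.1.length := by
  simp [tapeWord]

/-- The instance that is represented by a word. -/
def ofTapeWord {α : Type} (y : List (Option α)) : List α × ℕ :=
  (y.flatMap Option.toList, (y.flatMap fun o => if o.isNone then [()] else []).length)

theorem ofTapeWord_tapeWord {α : Type} (x : List α × ℕ) : ofTapeWord (tapeWord x) = x := by
  obtain ⟨w, k⟩ := x
  simp [ofTapeWord, tapeWord, List.flatMap_append, List.flatMap_map, List.flatMap_replicate]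

theorem PolyTime.tapeWord {α β : Type} [Enc α] [Enc β] {f : β → List α × ℕ} (hf : PolyTime f) :
    PolyTime fun b => tapeWord (f b) :=
  (hf.snd.replicate (const none)).append (hf.fst.map (h := fun x : β × α => some x.2)
    (((const (β := Tree) .nil).pair id.snd).of_enc fun _ => rfl))

theorem PolyTime.ofTapeWord {α : Type} [Enc α] [Fintype α] :
    PolyTime (ofTapeWord : List (Option α) → List α × ℕ) :=
  (id.flatMap (h := fun x : List (Option α) × Option α => x.2.toList)
    ((of_fintype Option.toList).comp id.snd)).pair
  (id.flatMap (h := fun x : List (Option α) × Option α => if x.2.isNone then [()] else [])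
    ((of_fintype fun o : Option α => if o.isNone then [()] else []).comp id.snd)).length

theorem full_nil {β γ : Type} : full (dst []) [] [] = fun k => ([] : List (Alph β γ k)) := by
  funext k
  rcases k with k | k | k
  · cases k <;> rfl
  · rfl
  · rfl

theorem full_eq_update_inp {β γ : Type} (i : List β) : full (dst []) i [] =
    update (β := fun k => List (Alph β γ k)) (fun _ => []) (Sum.inr (Sum.inl ())) i :=
  (update_full_inp (dst []) [] [] i).symm.trans (by rw [full_nil])

theorem full_eq_update_out {β γ : Type} (o : List γ) : full (dst []) [] o =
    update (β := fun k => List (Alph β γ k)) (fun _ => []) (Sum.inr (Sum.inr ())) o :=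
  (update_full_out (dst []) [] [] o).symm.trans (by rw [full_nil])

/-- A polynomial-time function after a fixed-parameter tractable function is fixed-parameter
tractable. -/
theorem _root_.Parameterized.FPTComputable.polyTime_comp {α β γ : Type} [Enc β] [Enc γ]
    [Fintype β] [Fintype γ] {T₁ : List α × ℕ → List β × ℕ} {T₂ : List β × ℕ → List γ × ℕ}
    (h₁ : FPTComputable T₁) (h₂ : PolyTime T₂) : FPTComputable fun x => T₂ (T₁ x) := by
  obtain ⟨M, f, p, hf, hM⟩ := h₁
  obtain ⟨c, q, hc⟩ := (h₂.comp PolyTime.ofTapeWord).tapeWord.exists_ioCmd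
  obtain ⟨d, hd⟩ := exists_length_output_le M.tm
  have (k : Stk ⊕ Unit ⊕ Unit) : Fintype (Alph (Option β) (Option γ) k) := by
    rcases k with k | k | k
    · exact inferInstanceAs (Fintype Bool)
    · exact inferInstanceAs (Fintype (Option β))
    · exact inferInstanceAs (Fintype (Option γ))
  -- `R` accounts for the run of `M`, two steps per transferred symbol, the program, and the two
  -- single steps around it.
  let R : Polynomial ℕ := 3 * Polynomial.X + q + 2
  refine ⟨⟨compose M.tm c (Sum.inr (Sum.inl ())) (Sum.inr (Sum.inr ())) M.outputAlphabet,
    M.inputAlphabet, Equiv.refl _⟩, fun k => R.eval (k + 1 + (d + 1) * f k),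
    R.comp (Polynomial.X + 1 + p), ?_, fun w k => ?_⟩
  · have h₁ : Computable fun k : ℕ => k + 1 := Primrec.succ.to_comp
    have h₂ : Computable fun k : ℕ => (d + 1) * f k :=
      Primrec.nat_mul.to_comp.comp (Computable.const (d + 1)) hf
    exact (primrec_eval R).to_comp.comp (Primrec.nat_add.to_comp.comp h₁ h₂)
  · obtain ⟨h⟩ := hM w k
    have hlen := hd _ _ _ h
    simp only [List.length_map, length_tapeWord] at hlen
    set y := tapeWord (T₁ (w, k)) with hy
    obtain ⟨t, ht, hb⟩ := hc y
    have hout : ofTapeWord y = T₁ (w, k) := ofTapeWord_tapeWord _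
    have hylen : y.length = (T₁ (w, k)).2 + (T₁ (w, k)).1.length := length_tapeWord _
    rw [hout] at hb
    -- The transfer applies `M.outputAlphabet`, which undoes the relabelling of the output of `M`.
    have hmap : (y.map M.outputAlphabet.invFun).map M.outputAlphabet = y := by
      simp [List.map_map]
    rw [full_eq_update_inp, full_eq_update_out, ← hmap] at hb
    obtain ⟨hfin⟩ := compose_outputs M.tm c (Sum.inr (Sum.inl ())) (Sum.inr (Sum.inr ()))
      M.outputAlphabet h hb
    have hz : (tapeWord (T₂ (T₁ (w, k)))).map (Equiv.refl (Option γ)).invFun =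
        tapeWord (T₂ (T₁ (w, k))) := List.map_id _
    refine ⟨{ hfin with evals_in_steps := ?_, steps_le_m := hfin.steps_le_m.trans ?_ }⟩
    · have := hfin.evals_in_steps
      exact this.trans (congrArg (fun z => some (haltList _ z)) hz.symm)
    · rw [Polynomial.eval_comp]
      refine le_trans ?_ (eval_mul_le R _ _)
      set A := k + 1 + (d + 1) * f k
      -- The left side bounds both the length of the intermediate word and the time of `M`; each
      -- summand occurs in the expanded product.
      have hL : (k + w.length + d * (f k * p.eval w.length)) + f k * p.eval w.length ≤
          A * (Polynomial.X + 1 + p).eval w.length := by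
        simp only [Polynomial.eval_add, Polynomial.eval_X, Polynomial.eval_one, A]
        ring_nf
        omega
      have h₁ := eval_mono_nat q ((show y.length ≤ _ by omega).trans
        ((Nat.le_add_right _ (f k * p.eval w.length)).trans hL))
      simp only [R, Polynomial.eval_add, Polynomial.eval_mul, Polynomial.eval_X,
        Polynomial.eval_ofNat, List.length_map] at h₁ hL ⊢
      omega

end StackProgram

/-! ## Networks for monotone formulas -/

namespace BackdoorReduction

open StackProgram

/-- Names of variables, before they are written in binary. -/
abbrev Name : Type := List ℕ

/-- An edge `(x, y, l)` from `x` to `y`. It is cut if a name in `l` is selected. -/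
abbrev Edge : Type := Name × Name × List Name

/-- The edge `e` is not cut by the set `U` of selected names. -/
def Live (U : Set Name) (e : Edge) : Prop := ∀ u ∈ e.2.2, u ∉ U

/-- The set `ρ` of names is closed under the edges in `l` that are not cut by `U`. -/
def Respects (U : Set Name) (ρ : Name → Prop) (l : List Edge) : Prop :=
  ∀ e ∈ l, Live U e → ρ e.1 → ρ e.2.1

/-- A network template: given a parameter, a prefix for the names of its inner nodes, a source and a
target, it yields a list of edges. -/
abbrev Template (α : Type) : Type := α × Name × Name × Name → List Edge

/-- The template `N` realizes the condition `P`: the network given by the parameter `a` has no uncut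
path from its source to its target if and only if `P a` holds of the set of selected names. -/
structure Realizes {α : Type} (N : Template α) (P : α → Set Name → Prop) : Prop where
  sound : ∀ a p s t U (ρ : Name → Prop), Respects U ρ (N (a, p, s, t)) → ¬ P a U → ρ s → ρ t
  -- Values outside the nodes with prefix `p` are kept, so the solutions for disjoint subnetworks
  -- can be glued.
  complete : ∀ a p s t U (ρ : Name → Prop), ¬ p <+: s → ¬ p <+: t → (P a U ∨ (ρ s → ρ t)) →
    ∃ ρ' : Name → Prop, (∀ v, ¬ p <+: v → (ρ' v ↔ ρ v)) ∧ Respects U ρ' (N (a, p, s, t))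
  -- At most one label per edge keeps its clause at three literals. The leading `0` keeps labels
  -- apart from nodes, whose names will start with `1`.
  ends : ∀ a p s t, ∀ e ∈ N (a, p, s, t),
    (e.1 = s ∨ p <+: e.1) ∧ (e.2.1 = t ∨ p <+: e.2.1) ∧ e.2.2.length ≤ 1 ∧
      ∀ u ∈ e.2.2, u.head? = some 0
  -- A loop would give a clause with a complementary pair.
  ne : ∀ a p s t, ¬ p <+: s → ¬ p <+: t → s ≠ t → ∀ e ∈ N (a, p, s, t), e.1 ≠ e.2.1

/-- Conditions that are realized by templates computable in polynomial time. -/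
def Definable {α : Type} [Enc α] (P : α → Set Name → Prop) : Prop :=
  ∃ N : Template α, PolyTime N ∧ Realizes N P

theorem prefix_concat_inj {p v : Name} {i j : ℕ} (hi : p ++ [i] <+: v) (hj : p ++ [j] <+: v) :
    i = j := by
  have h := List.prefix_of_prefix_length_le hi hj (by simp)
  obtain ⟨l, hl⟩ := h
  simp only [List.append_assoc, List.append_cancel_left_eq, List.singleton_append,
    List.cons.injEq] at hl
  exact hl.1

/-- Networks with disjoint sets of inner nodes can be treated independently. -/
theorem exists_respects_of_family {U : Set Name} (q : ℕ → Name) (E : ℕ → List Edge)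
    (hq : ∀ i j v, q i <+: v → q j <+: v → i = j) (n : ℕ)
    (hE : ∀ i < n, ∀ e ∈ E i, (q i <+: e.1 ∨ ∀ j, ¬ q j <+: e.1) ∧
      (q i <+: e.2.1 ∨ ∀ j, ¬ q j <+: e.2.1)) (ρ : Name → Prop)
    (h : ∀ i < n, ∃ ρ' : Name → Prop, (∀ v, ¬ q i <+: v → (ρ' v ↔ ρ v)) ∧ Respects U ρ' (E i)) :
    ∃ ρ' : Name → Prop, (∀ v, (∀ i, ¬ q i <+: v) → (ρ' v ↔ ρ v)) ∧
      ∀ i < n, Respects U ρ' (E i) := by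
  choose! f hf using h
  -- On the inner nodes of the network `i` the extension `f i` is used; everywhere else `ρ` is kept.
  refine ⟨fun v => (∃ i, q i <+: v ∧ f i v) ∨ ((∀ i, ¬ q i <+: v) ∧ ρ v), fun v hv => ?_,
    fun i hi e he hl => ?_⟩
  · constructor
    · rintro (⟨i, hi, _⟩ | ⟨_, h⟩)
      · exact absurd hi (hv i)
      · exact h
    · exact fun h => .inr ⟨hv, h⟩
  · have key : ∀ v, (q i <+: v ∨ ∀ j, ¬ q j <+: v) →
        (((∃ i, q i <+: v ∧ f i v) ∨ ((∀ i, ¬ q i <+: v) ∧ ρ v)) ↔ f i v) := by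
      rintro v (hv | hv)
      · constructor
        · rintro (⟨j, hj, h⟩ | ⟨h, _⟩)
          · rwa [hq i j v hv hj]
          · exact absurd hv (h i)
        · exact fun h => .inl ⟨i, hv, h⟩
      · rw [(hf i hi).1 v (hv i)]
        constructor
        · rintro (⟨j, hj, _⟩ | ⟨_, h⟩)
          · exact absurd hj (hv j)
          · exact h
        · exact fun h => .inr ⟨hv, h⟩
    have := (hf i hi).2 e he hl
    rw [← key _ (hE i hi e he).1, ← key _ (hE i hi e he).2] at this
    exact this

namespace Definable

variable {α β : Type} [Enc α] [Enc β]

theorem congr {P Q : α → Set Name → Prop} (hP : Definable P) (h : ∀ a U, P a U ↔ Q a U) :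
    Definable Q := by
  have : P = Q := funext fun a => funext fun U => propext (h a U)
  exact this ▸ hP

theorem comp {P : α → Set Name → Prop} (hP : Definable P) {f : β → α} (hf : PolyTime f) :
    Definable fun b U => P (f b) U := by
  obtain ⟨N, hN, h⟩ := hP
  exact ⟨fun x => N (f x.1, x.2), hN.comp ((hf.comp PolyTime.id.fst).pair PolyTime.id.snd),
    ⟨fun b => h.sound (f b), fun b => h.complete (f b), fun b => h.ends (f b),
      fun b => h.ne (f b)⟩⟩

/-- A condition independent of the selection is an edge that cannot be cut if it is false, and the
empty network if it is true. -/
theorem dec {p : α → Bool} (hp : PolyTime p) : Definable fun a (_ : Set Name) => p a = true := by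
  refine ⟨fun x => if p x.1 then [] else [(x.2.2.1, x.2.2.2, [])],
    (hp.comp PolyTime.id.fst).ite (PolyTime.const [])
      (PolyTime.id.snd.snd.fst.pair (PolyTime.id.snd.snd.snd.pair (PolyTime.const []))).singleton,
    ⟨fun a q s t U ρ hr hP hs => ?_, fun a q s t U ρ _ _ h => ⟨ρ, fun _ _ => Iff.rfl, ?_⟩,
      fun a q s t e he => ?_, fun a q s t _ _ hst e he => ?_⟩⟩
  · exact hr (s, t, []) (by simp [hP]) (by simp [Live]) hs
  · intro e he _ hs
    by_cases hp : p a = true <;> simp [hp] at he h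
    subst he
    exact h hs
  · by_cases hp : p a = true <;> simp [hp] at he
    subst he
    simp
  · by_cases hp : p a = true <;> simp [hp] at he
    subst he
    exact hst

/-- A single edge, cut exactly when the name is selected. -/
theorem lit {u : α → Name} (hu : PolyTime u) : Definable fun a U => 0 :: u a ∈ U := by
  refine ⟨fun x => [(x.2.2.1, x.2.2.2, [0 :: u x.1])],
    (PolyTime.id.snd.snd.fst.pair (PolyTime.id.snd.snd.snd.pair
      ((PolyTime.const 0).cons (hu.comp PolyTime.id.fst)).singleton)).singleton,
    ⟨fun a q s t U ρ hr hP hs => ?_, fun a q s t U ρ _ _ h => ⟨ρ, fun _ _ => Iff.rfl, ?_⟩,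
      fun a q s t e he => ?_, fun a q s t _ _ hst e he => ?_⟩⟩
  · exact hr (s, t, [0 :: u a]) (by simp) (by simpa [Live] using hP) hs
  · intro e he hl hs
    rw [List.mem_singleton] at he
    subst he
    have : ¬ (0 :: u a ∈ U) := by simpa [Live] using hl
    exact h.resolve_left this hs
  · rw [List.mem_singleton] at he
    subst he
    simp
  · rw [List.mem_singleton] at he
    subst he
    exact hst

theorem ite {p : α → Bool} {P Q : α → Set Name → Prop} (hp : PolyTime p) (hP : Definable P)
    (hQ : Definable Q) : Definable fun a U => if p a then P a U else Q a U := by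
  obtain ⟨N, hN, h⟩ := hP
  obtain ⟨M, hM, h'⟩ := hQ
  refine ⟨fun x => if p x.1 then N x else M x, (hp.comp PolyTime.id.fst).ite hN hM,
    ⟨fun a => ?_, fun a => ?_, fun a => ?_, fun a => ?_⟩⟩
  · cases hp : p a
    · simpa [hp] using h'.sound a
    · simpa [hp] using h.sound a
  · cases hp : p a
    · simpa [hp] using h'.complete a
    · simpa [hp] using h.complete a
  · cases hp : p a
    · simpa [hp] using h'.ends a
    · simpa [hp] using h.ends a
  · cases hp : p a
    · simpa [hp] using h'.ne a
    · simpa [hp] using h.ne a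

theorem not_prefix_append {p s : Name} (h : ¬ p <+: s) (l : Name) : ¬ p ++ l <+: s :=
  fun h' => h ((List.prefix_append p l).trans h')

/-- Parallel connection: all networks share source and target, and a single one with an uncut path
suffices to connect them. -/
theorem all {n : α → ℕ} {P : α × ℕ → Set Name → Prop} (hn : PolyTime n) (hP : Definable P) :
    Definable fun a U => ∀ i < n a, P (a, i) U := by
  obtain ⟨N, hN, h⟩ := hP
  refine ⟨fun x => (List.range (n x.1)).flatMap fun i =>
      N ((x.1, i), x.2.1 ++ [i], x.2.2.1, x.2.2.2),
    (hn.comp PolyTime.id.fst).range.flatMap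
      (h := fun y : (α × Name × Name × Name) × ℕ =>
        N ((y.1.1, y.2), y.1.2.1 ++ [y.2], y.1.2.2.1, y.1.2.2.2))
      (hN.comp ((PolyTime.id.fst.fst.pair PolyTime.id.snd).pair
        ((PolyTime.id.fst.snd.fst.append PolyTime.id.snd.singleton).pair
          (PolyTime.id.fst.snd.snd.fst.pair PolyTime.id.fst.snd.snd.snd)))),
    ⟨fun a p s t U ρ hr hP hs => ?_, fun a p s t U ρ hps hpt hP => ?_,
      fun a p s t e he => ?_, fun a p s t hps hpt hst e he => ?_⟩⟩
  · push Not at hP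
    obtain ⟨i, hi, hP⟩ := hP
    exact h.sound (a, i) (p ++ [i]) s t U ρ
      (fun e he => hr e (List.mem_flatMap.2 ⟨i, List.mem_range.2 hi, he⟩)) hP hs
  · obtain ⟨ρ', h₁, h₂⟩ := exists_respects_of_family (U := U) (fun i => p ++ [i])
      (fun i => N ((a, i), p ++ [i], s, t)) (fun i j v => prefix_concat_inj) (n a)
      (fun i hi e he => by
        obtain ⟨h₁, h₂, _⟩ := h.ends _ _ _ _ e he
        refine ⟨h₁.symm.imp_right fun h j => ?_, h₂.symm.imp_right fun h j => ?_⟩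
        · exact h ▸ not_prefix_append hps _
        · exact h ▸ not_prefix_append hpt _) ρ
      (fun i hi => h.complete (a, i) _ s t U ρ (not_prefix_append hps _) (not_prefix_append hpt _)
        (hP.imp_left fun h => h i hi))
    refine ⟨ρ', fun v hv => h₁ v fun i => not_prefix_append hv _, fun e he => ?_⟩
    obtain ⟨i, hi, he⟩ := List.mem_flatMap.1 he
    exact h₂ i (List.mem_range.1 hi) e he
  · obtain ⟨i, hi, he⟩ := List.mem_flatMap.1 he
    obtain ⟨h₁, h₂, h₃⟩ := h.ends _ _ _ _ e he
    exact ⟨h₁.imp_right (List.prefix_append p [i]).trans,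
      h₂.imp_right (List.prefix_append p [i]).trans, h₃⟩
  · obtain ⟨i, hi, he⟩ := List.mem_flatMap.1 he
    exact h.ne _ _ _ _ (not_prefix_append hps _) (not_prefix_append hpt _) hst e he

/-- Series connection through the nodes `p ++ [1, i]`, walked from `i = n a` down to `0`; a cut in
one network suffices to disconnect. The subnetworks use the disjoint prefixes `p ++ [0, i]`. For `n
a = 0` an uncut path remains, as the empty disjunction requires. -/
theorem ex {n : α → ℕ} {P : α × ℕ → Set Name → Prop} (hn : PolyTime n) (hP : Definable P) :
    Definable fun a U => ∃ i < n a, P (a, i) U := by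
  obtain ⟨N, hN, h⟩ := hP
  have hq : ∀ (p : Name) (i : ℕ), p ++ [0, i] = p ++ [0] ++ [i] := by simp
  have hd : ∀ (p : Name) (i j : ℕ), ¬ p ++ [0, i] <+: p ++ [1, j] := fun p i j h => by
    rw [List.prefix_append_right_inj] at h
    simp [List.cons_prefix_cons] at h
  refine ⟨fun x => (x.2.2.1, x.2.1 ++ [1, n x.1], []) :: (x.2.1 ++ [1, 0], x.2.2.2, []) ::
      (List.range (n x.1)).flatMap fun i =>
        N ((x.1, i), x.2.1 ++ [0, i], x.2.1 ++ [1, i + 1], x.2.1 ++ [1, i]),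
    (PolyTime.id.snd.snd.fst.pair ((PolyTime.id.snd.fst.append ((PolyTime.const 1).cons
      (hn.comp PolyTime.id.fst).singleton)).pair (PolyTime.const []))).cons
    (((PolyTime.id.snd.fst.append (PolyTime.const [1, 0])).pair
      (PolyTime.id.snd.snd.snd.pair (PolyTime.const []))).cons
    ((hn.comp PolyTime.id.fst).range.flatMap
      (h := fun y : (α × Name × Name × Name) × ℕ =>
        N ((y.1.1, y.2), y.1.2.1 ++ [0, y.2], y.1.2.1 ++ [1, y.2 + 1], y.1.2.1 ++ [1, y.2]))
      (hN.comp ((PolyTime.id.fst.fst.pair PolyTime.id.snd).pair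
        ((PolyTime.id.fst.snd.fst.append ((PolyTime.const 0).cons PolyTime.id.snd.singleton)).pair
          ((PolyTime.id.fst.snd.fst.append ((PolyTime.const 1).cons
            PolyTime.id.snd.succ.singleton)).pair
          (PolyTime.id.fst.snd.fst.append ((PolyTime.const 1).cons
            PolyTime.id.snd.singleton))))))) ),
    ⟨fun a p s t U ρ hr hP hs => ?_, fun a p s t U ρ hps hpt hP => ?_,
      fun a p s t e he => ?_, fun a p s t hps hpt hst e he => ?_⟩⟩
  · push Not at hP
    have hstart : ρ (p ++ [1, n a]) :=
      hr (s, p ++ [1, n a], []) (by simp) (by simp [Live]) hs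
    have hwalk : ∀ d ≤ n a, ρ (p ++ [1, n a - d]) := by
      intro d
      induction d with
      | zero => intro _; exact hstart
      | succ d ih =>
        intro hd
        have h₁ := ih (by omega)
        have h₂ := h.sound (a, n a - (d + 1)) (p ++ [0, n a - (d + 1)])
          (p ++ [1, n a - (d + 1) + 1]) (p ++ [1, n a - (d + 1)]) U ρ
          (fun e he => hr e (by
            simp only [List.mem_cons, List.mem_flatMap, List.mem_range]
            exact .inr (.inr ⟨n a - (d + 1), by omega, he⟩))) (hP _ (by omega))
        exact h₂ (by rwa [show n a - (d + 1) + 1 = n a - d by omega])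
    have hend := hwalk (n a) le_rfl
    rw [Nat.sub_self] at hend
    exact hr (p ++ [1, 0], t, []) (by simp) (by simp [Live]) hend
  -- Values at the connecting nodes: if the disjunct `i` holds, exactly the nodes with index above
  -- `i` belong to `ρ₀`, so the only change occurs across the cut network. Otherwise `ρ s → ρ t`,
  -- and all of them take the value of `ρ s`.
  · obtain ⟨ρ₀, h₀, hs, ht, hb⟩ : ∃ ρ₀ : Name → Prop, (∀ v, ¬ p <+: v → (ρ₀ v ↔ ρ v)) ∧
        (ρ s → ρ₀ (p ++ [1, n a])) ∧ (ρ₀ (p ++ [1, 0]) → ρ t) ∧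
        ∀ i < n a, P (a, i) U ∨ (ρ₀ (p ++ [1, i + 1]) → ρ₀ (p ++ [1, i])) := by
      have hval : ∀ (f : ℕ → Prop) v, ¬ p <+: v →
          ((ρ v ∧ ¬ p <+: v ∨ ∃ i, v = p ++ [1, i] ∧ f i) ↔ ρ v) := by
        intro f v hv
        constructor
        · rintro (⟨h, _⟩ | ⟨i, rfl, _⟩)
          · exact h
          · exact absurd (List.prefix_append _ _) hv
        · exact fun h => .inl ⟨h, hv⟩
      have hval' : ∀ (f : ℕ → Prop) i,
          ((ρ (p ++ [1, i]) ∧ ¬ p <+: p ++ [1, i] ∨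
            ∃ j, p ++ [1, i] = p ++ [1, j] ∧ f j) ↔ f i) := by
        intro f i
        simp
      rcases hP with ⟨i, hi, hP⟩ | hP
      · refine ⟨fun v => ρ v ∧ ¬ p <+: v ∨ ∃ j, v = p ++ [1, j] ∧ i < j, hval _, ?_, ?_, ?_⟩
        · intro _; rw [hval']; exact hi
        · intro h; have := (hval' (fun j => i < j) 0).1 h; omega
        · intro j hj
          beta_reduce
          rw [hval', hval']
          by_cases hij : j = i
          · exact .inl (hij ▸ hP)
          · right; intro h; omega
      · refine ⟨fun v => ρ v ∧ ¬ p <+: v ∨ ∃ j, v = p ++ [1, j] ∧ ρ s,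
          hval fun _ => ρ s, ?_, ?_, ?_⟩
        · intro hs; exact (hval' (fun _ => ρ s) _).2 hs
        · intro h; exact hP ((hval' (fun _ => ρ s) _).1 h)
        · intro j hj
          right
          intro h
          exact (hval' (fun _ => ρ s) _).2 ((hval' (fun _ => ρ s) _).1 h)
    obtain ⟨ρ', h₁, h₂⟩ := exists_respects_of_family (U := U) (fun i => p ++ [0, i])
      (fun i => N ((a, i), p ++ [0, i], p ++ [1, i + 1], p ++ [1, i]))
      (fun i j v hi hj => by
        rw [hq] at hi hj
        exact prefix_concat_inj hi hj) (n a)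
      (fun i hi e he => by
        obtain ⟨h₁, h₂, _⟩ := h.ends _ _ _ _ e he
        refine ⟨h₁.symm.imp_right fun h j => ?_, h₂.symm.imp_right fun h j => ?_⟩
        · exact h ▸ hd _ _ _
        · exact h ▸ hd _ _ _) ρ₀
      (fun i hi => h.complete (a, i) _ _ _ U ρ₀ (hd _ _ _) (hd _ _ _) (hb i hi))
    have hout : ∀ v, ¬ p <+: v → (ρ' v ↔ ρ v) := fun v hv =>
      (h₁ v fun i => not_prefix_append hv _).trans (h₀ v hv)
    refine ⟨ρ', hout, fun e he => ?_⟩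
    simp only [List.mem_cons, List.mem_flatMap, List.mem_range] at he
    rcases he with rfl | rfl | ⟨i, hi, he⟩
    · intro _ h
      exact (h₁ _ fun i => hd _ _ _).2 (hs ((hout s hps).1 h))
    · intro _ h
      exact (hout t hpt).2 (ht ((h₁ _ fun i => hd _ _ _).1 h))
    · exact h₂ i hi e he
  · simp only [List.mem_cons, List.mem_flatMap, List.mem_range] at he
    rcases he with rfl | rfl | ⟨i, hi, he⟩
    · simp
    · simp
    · obtain ⟨h₁, h₂, h₃⟩ := h.ends _ _ _ _ e he
      refine ⟨.inr ?_, .inr ?_, h₃⟩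
      · rcases h₁ with h₁ | h₁
        · exact h₁ ▸ List.prefix_append _ _
        · exact (List.prefix_append p [0, i]).trans h₁
      · rcases h₂ with h₂ | h₂
        · exact h₂ ▸ List.prefix_append _ _
        · exact (List.prefix_append p [0, i]).trans h₂
  · simp only [List.mem_cons, List.mem_flatMap, List.mem_range] at he
    rcases he with rfl | rfl | ⟨i, hi, he⟩
    · exact fun (h : s = p ++ [1, n a]) => hps (h ▸ List.prefix_append _ _)
    · exact fun (h : p ++ [1, 0] = t) => hpt (h ▸ List.prefix_append _ _)
    · exact h.ne _ _ _ _ (hd _ _ _) (hd _ _ _) (by simp) e he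

theorem and {P Q : α → Set Name → Prop} (hP : Definable P) (hQ : Definable Q) :
    Definable fun a U => P a U ∧ Q a U := by
  refine (all (n := fun _ => 2) (PolyTime.const 2) ((hP.comp PolyTime.id.fst).ite
    (PolyTime.id.snd.decide_eq (PolyTime.const 0)) (hQ.comp PolyTime.id.fst))).congr
    fun a U => ⟨fun h => ⟨?_, ?_⟩, fun h i hi => ?_⟩
  · simpa using h 0 (by norm_num)
  · simpa using h 1 (by norm_num)
  · by_cases h0 : i = 0
    · simpa [h0] using h.1
    · simpa [h0] using h.2

theorem or {P Q : α → Set Name → Prop} (hP : Definable P) (hQ : Definable Q) :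
    Definable fun a U => P a U ∨ Q a U := by
  refine (ex (n := fun _ => 2) (PolyTime.const 2) ((hP.comp PolyTime.id.fst).ite
    (PolyTime.id.snd.decide_eq (PolyTime.const 0)) (hQ.comp PolyTime.id.fst))).congr
    fun a U => ⟨fun ⟨i, hi, h⟩ => ?_, fun h => h.elim (fun h => ⟨0, ?_⟩) fun h => ⟨1, ?_⟩⟩
  · by_cases h0 : i = 0
    · exact .inl (by simpa [h0] using h)
    · exact .inr (by simpa [h0] using h)
  · simpa using h
  · simpa using h

end Definable

end BackdoorReduction

/-! ## The monotone formula of a weighted definability instance -/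

namespace BackdoorReduction

open StackProgram Parameterized

/-- The list `l` represents a `q`-tuple of elements of a structure with `n` elements. -/
def IsTuple (n q : ℕ) (l : List ℕ) : Prop := l.length = q ∧ ∀ i ∈ l, i < n

/-- The list that represents a tuple. -/
def tupleList {n q : ℕ} (x : Fin q → Fin n) : List ℕ := List.ofFn fun i => (x i).val

theorem tupleList_injective {n q : ℕ} : Function.Injective (tupleList (n := n) (q := q)) :=
  fun _ _ h => funext fun i => Fin.ext (congrFun (List.ofFn_injective h) i)

theorem isTuple_iff {n q : ℕ} {l : List ℕ} :
    IsTuple n q l ↔ ∃ x : Fin q → Fin n, l = tupleList x := by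
  constructor
  · rintro ⟨rfl, h⟩
    exact ⟨fun i => ⟨l[i], h _ (List.getElem_mem _)⟩, List.ext_getElem (by simp [tupleList])
      fun i h₁ h₂ => by simp [tupleList]⟩
  · rintro ⟨x, rfl⟩
    refine ⟨by simp [tupleList], fun i hi => ?_⟩
    obtain ⟨j, rfl⟩ := (List.mem_ofFn' _ _).1 hi
    exact (x j).isLt

theorem getD_tupleList {n q : ℕ} (x : Fin q → Fin n) (i : Fin q) :
    (tupleList x).getD i.val 0 = x i := by
  rw [List.getD_eq_getElem _ _ (by simp [tupleList])]
  simp [tupleList]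

theorem isTuple_succ {n q : ℕ} {l : List ℕ} :
    IsTuple n (q + 1) l ↔ ∃ i l', l = i :: l' ∧ i < n ∧ IsTuple n q l' := by
  cases l with
  | nil => simp [IsTuple]
  | cons i l =>
    simp only [IsTuple, List.length_cons, Nat.add_right_cancel_iff, List.mem_cons,
      forall_eq_or_imp, List.cons.injEq]
    constructor
    · rintro ⟨h, hi, h'⟩
      exact ⟨i, l, ⟨rfl, rfl⟩, hi, h, h'⟩
    · rintro ⟨_, _, ⟨rfl, rfl⟩, hi, h, h'⟩
      exact ⟨h, hi, h'⟩

/-- Quantification over tuples is iterated quantification over elements. The induction on `q` is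
outside the program, so each fixed `q` gets its own polynomial. -/
theorem Definable.allTuples (q : ℕ) : ∀ {α : Type} [Enc α] {n : α → ℕ}
    {P : α × List ℕ → Set Name → Prop}, PolyTime n → Definable P →
      Definable fun a U => ∀ l, IsTuple (n a) q l → P (a, l) U := by
  induction q with
  | zero =>
    intro α _ n P hn hP
    refine (hP.comp (PolyTime.id.pair (PolyTime.const []))).congr fun a U => ?_
    simp [IsTuple]
  | succ q ih =>
    intro α _ n P hn hP
    refine (Definable.all hn (ih (P := fun x : (α × ℕ) × List ℕ => P (x.1.1, x.1.2 :: x.2))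
      (n := fun x => n x.1) (hn.comp (g := fun x : α × ℕ => x.1) PolyTime.id.fst) (hP.comp (PolyTime.id.fst.fst.pair
        (PolyTime.id.fst.snd.cons PolyTime.id.snd))))).congr fun a U => ?_
    simp only [isTuple_succ]
    constructor
    · rintro h _ ⟨i, l, rfl, hi, hl⟩
      exact h i hi l hl
    · intro h i hi l hl
      exact h _ ⟨i, l, rfl, hi, hl⟩

theorem Definable.exTuples (q : ℕ) : ∀ {α : Type} [Enc α] {n : α → ℕ}
    {P : α × List ℕ → Set Name → Prop}, PolyTime n → Definable P →
      Definable fun a U => ∃ l, IsTuple (n a) q l ∧ P (a, l) U := by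
  induction q with
  | zero =>
    intro α _ n P hn hP
    refine (hP.comp (PolyTime.id.pair (PolyTime.const []))).congr fun a U => ?_
    simp [IsTuple]
  | succ q ih =>
    intro α _ n P hn hP
    refine (Definable.ex hn (ih (P := fun x : (α × ℕ) × List ℕ => P (x.1.1, x.1.2 :: x.2))
      (n := fun x => n x.1) (hn.comp (g := fun x : α × ℕ => x.1) PolyTime.id.fst) (hP.comp (PolyTime.id.fst.fst.pair
        (PolyTime.id.fst.snd.cons PolyTime.id.snd))))).congr fun a U => ?_
    simp only [isTuple_succ]
    constructor
    · rintro ⟨i, hi, l, hl, h⟩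
      exact ⟨_, ⟨i, l, rfl, hi, hl⟩, h⟩
    · rintro ⟨_, ⟨i, l, rfl, hi, hl⟩, h⟩
      exact ⟨i, hi, l, hl, h⟩

theorem _root_.StackProgram.PolyTime.ofFn {α β : Type} [Enc α] [Enc β] {q : ℕ}
    {f : Fin q → α → β} (hf : ∀ i, PolyTime (f i)) :
    PolyTime fun a => List.ofFn fun i => f i a := by
  induction q with
  | zero => simpa using PolyTime.const []
  | succ q ih =>
    simp only [List.ofFn_succ]
    exact (hf 0).cons (ih fun i => hf i.succ)

/-! ### Monotone evaluation of quantifier-free formulas -/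

section Formula

variable {r : ℕ} {ar : Fin r → ℕ} {s v : ℕ}

/-- The data of an instance: the number of elements, the parameter, and the facts. -/
abbrev Inst (r : ℕ) : Type := ℕ × ℕ × List (Fin r × List ℕ)

/-- The tuple `l` is selected by one of the selectors. -/
def Sel (k : ℕ) (U : Set Name) (l : List ℕ) : Prop := ∃ j < k, 0 :: j :: l ∈ U

/-- The selector `j` selects an `s`-tuple different from `l`. -/
def SelNe (n s : ℕ) (U : Set Name) (j : ℕ) (l : List ℕ) : Prop :=
  ∃ l', IsTuple n s l' ∧ l' ≠ l ∧ 0 :: j :: l' ∈ U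

/-- A monotone version of the truth (`b = true`) or falsity (`b = false`) of a quantifier-free
formula, where the variables have the values `e`. -/
def Ev (c : Inst r) (e : List ℕ) (U : Set Name) : Bool → QFFormula ar s v → Prop
  | true, .eq i j => e.getD i 0 = e.getD j 0
  | false, .eq i j => e.getD i 0 ≠ e.getD j 0
  | true, .rel R t => (R, List.ofFn fun i => e.getD (t i) 0) ∈ c.2.2
  | false, .rel R t => (R, List.ofFn fun i => e.getD (t i) 0) ∉ c.2.2
  | true, .relVar t => Sel c.2.1 U (List.ofFn fun i => e.getD (t i) 0)
  | false, .relVar t => ∀ j < c.2.1, SelNe c.1 s U j (List.ofFn fun i => e.getD (t i) 0)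
  | b, .not ψ => Ev c e U (!b) ψ
  | true, .and ψ χ => Ev c e U true ψ ∧ Ev c e U true χ
  | false, .and ψ χ => Ev c e U false ψ ∨ Ev c e U false χ
  | true, .or ψ χ => Ev c e U true ψ ∨ Ev c e U true χ
  | false, .or ψ χ => Ev c e U false ψ ∧ Ev c e U false χ

theorem definable_selNe {α : Type} [Enc α] {n j : α → ℕ} {l : α → List ℕ} (s : ℕ)
    (hn : PolyTime n) (hj : PolyTime j) (hl : PolyTime l) :
    Definable fun a U => SelNe (n a) s U (j a) (l a) := by
  refine (Definable.exTuples s (P := fun x U => if decide (x.2 = l x.1) then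
    false = true else 0 :: j x.1 :: x.2 ∈ U) hn
    (Definable.ite (PolyTime.id.snd.decide_eq (hl.comp PolyTime.id.fst))
      (Definable.dec (PolyTime.const false))
      (Definable.lit ((hj.comp PolyTime.id.fst).cons PolyTime.id.snd)))).congr fun a U => ?_
  refine exists_congr fun l' => and_congr_right fun _ => ?_
  by_cases h : l' = l a <;> simp [h]

/-- The formula is fixed, so the induction builds one template per formula. Both truth values are
treated together because negation exchanges them. -/
theorem definable_ev (b : Bool) (ψ : QFFormula ar s v) :
    Definable fun (x : Inst r × List ℕ) U => Ev x.1 x.2 U b ψ := by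
  have harg : ∀ {q : ℕ} (t : Fin q → Fin v), PolyTime fun x : Inst r × List ℕ =>
      List.ofFn fun i => x.2.getD (t i) 0 :=
    fun t => PolyTime.ofFn fun i => PolyTime.id.snd.getD _
  have hk : PolyTime fun x : Inst r × List ℕ => x.1.2.1 := PolyTime.id.fst.snd.fst
  induction ψ generalizing b with
  | eq i j =>
    have h : PolyTime fun x : Inst r × List ℕ => decide (x.2.getD i 0 = x.2.getD j 0) :=
      (PolyTime.id.snd.getD i).decide_eq (PolyTime.id.snd.getD j)
    cases b
    · exact (Definable.dec h.not).congr fun x U => by simp [Ev]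
    · exact (Definable.dec h).congr fun x U => by simp [Ev]
  | rel R t =>
    have h := ((PolyTime.const R).pair (harg t)).decide_mem PolyTime.id.fst.snd.snd
    cases b
    · exact (Definable.dec h.not).congr fun x U => by simp [Ev]
    · exact (Definable.dec h).congr fun x U => by simp [Ev]
  | relVar t =>
    cases b
    · exact (Definable.all hk (definable_selNe s PolyTime.id.fst.fst.fst PolyTime.id.snd
        ((harg t).comp PolyTime.id.fst))).congr fun x U => Iff.rfl
    · exact (Definable.ex hk (Definable.lit (PolyTime.id.snd.cons
        ((harg t).comp PolyTime.id.fst)))).congr fun x U => Iff.rfl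
  | not ψ ih => exact (ih !b).congr fun x U => by cases b <;> rfl
  | and ψ χ ih ih' =>
    cases b
    · exact (ih false).or (ih' false)
    · exact (ih true).and (ih' true)
  | or ψ χ ih ih' =>
    cases b
    · exact (ih false).and (ih' false)
    · exact (ih true).or (ih' true)

/-- The facts of a structure, as a list of relation symbols with lists of numbers. -/
def factList (A : FinStructure ar) : List (Fin r × List ℕ) :=
  A.facts.map fun a => (a.1, tupleList a.2)

theorem mem_factList (A : FinStructure ar) (R : Fin r) (x : Fin (ar R) → Fin A.n) :
    (R, tupleList x) ∈ factList A ↔ ⟨R, x⟩ ∈ A.facts := by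
  simp only [factList, List.mem_map, Prod.mk.injEq]
  constructor
  · rintro ⟨⟨R', y⟩, h, hR, hxy⟩
    subst hR
    exact tupleList_injective hxy ▸ h
  · intro h
    exact ⟨_, h, rfl, rfl⟩

/-- The hypotheses `hS` and `hS'` say that the monotone renderings of membership and non-membership
are correct; then they are correct for all formulas. -/
theorem ev_iff (A : FinStructure ar) (k : ℕ) (S : Finset (Fin s → Fin A.n)) (U : Set Name)
    (hS : ∀ x : Fin s → Fin A.n, Sel k U (tupleList x) ↔ x ∈ S)
    (hS' : ∀ x : Fin s → Fin A.n, (∀ j < k, SelNe A.n s U j (tupleList x)) ↔ x ∉ S)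
    (e : Fin v → Fin A.n) (ψ : QFFormula ar s v) :
    (Ev (A.n, k, factList A) (tupleList e) U true ψ ↔ ψ.Holds A S e) ∧
    (Ev (A.n, k, factList A) (tupleList e) U false ψ ↔ ¬ ψ.Holds A S e) := by
  have harg : ∀ {q : ℕ} (t : Fin q → Fin v), (List.ofFn fun i => (tupleList e).getD (t i) 0) =
      tupleList fun i => e (t i) := fun t => by simp only [getD_tupleList]; rfl
  induction ψ with
  | eq i j => simp only [Ev, QFFormula.Holds, getD_tupleList, Fin.ext_iff, ne_eq, and_self]
  | rel R t => simp only [Ev, QFFormula.Holds, harg, mem_factList, and_self]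
  | relVar t => simp only [Ev, QFFormula.Holds, harg, hS, hS', and_self]
  | not ψ ih => simp only [Ev, QFFormula.Holds, Bool.not_true, Bool.not_false, ih, not_not, and_self]
  | and ψ χ ih ih' => simp only [Ev, QFFormula.Holds, ih, ih', not_and_or, and_self]
  | or ψ χ ih ih' => simp only [Ev, QFFormula.Holds, ih, ih', not_or, and_self]

end Formula

/-- The monotone formula of an instance: each selector selects a tuple, different selectors select
different tuples, and the given formula holds of the relation that consists of the selected
tuples. -/
def InstFormula (φ : PiTwoFormula) (c : Inst φ.r) (U : Set Name) : Prop :=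
  (∀ j < c.2.1, ∃ l, IsTuple c.1 φ.s l ∧ 0 :: j :: l ∈ U) ∧
  (∀ j < c.2.1, ∀ j' < c.2.1, j = j' ∨
    ∀ l, IsTuple c.1 φ.s l → SelNe c.1 φ.s U j l ∨ SelNe c.1 φ.s U j' l) ∧
  ∀ x, IsTuple c.1 φ.m x → ∃ y, IsTuple c.1 φ.l y ∧ Ev c (x ++ y) U true φ.matrix

theorem definable_instFormula (φ : PiTwoFormula) : Definable (InstFormula φ) := by
  have hk : PolyTime fun x : Inst φ.r => x.2.1 := PolyTime.id.snd.fst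
  have hn : PolyTime fun x : Inst φ.r => x.1 := PolyTime.id.fst
  refine Definable.and ?_ (Definable.and ?_ ?_)
  · exact Definable.all hk (Definable.exTuples φ.s
      (P := fun (y : (Inst φ.r × ℕ) × List ℕ) U => 0 :: y.1.2 :: y.2 ∈ U)
      (n := fun x => x.1.1) (hn.comp (g := fun x : Inst φ.r × ℕ => x.1) PolyTime.id.fst)
      (Definable.lit (PolyTime.id.fst.snd.cons PolyTime.id.snd)))
  · refine Definable.all hk (Definable.all (n := fun x => x.1.2.1) (hk.comp (g := fun x : Inst φ.r × ℕ => x.1) PolyTime.id.fst)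
      (P := fun (x : (Inst φ.r × ℕ) × ℕ) U => x.1.2 = x.2 ∨ ∀ l, IsTuple x.1.1.1 φ.s l →
        SelNe x.1.1.1 φ.s U x.1.2 l ∨ SelNe x.1.1.1 φ.s U x.2 l) (Definable.or ?_ ?_))
    · exact (Definable.dec (PolyTime.id.fst.snd.decide_eq PolyTime.id.snd)).congr
        fun x U => by simp
    · exact Definable.allTuples φ.s (n := fun x => x.1.1.1)
        (P := fun (x : ((Inst φ.r × ℕ) × ℕ) × List ℕ) U => SelNe x.1.1.1.1 φ.s U x.1.1.2 x.2 ∨ SelNe x.1.1.1.1 φ.s U x.1.2 x.2)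
        PolyTime.id.fst.fst.fst
        (Definable.or
          (definable_selNe φ.s PolyTime.id.fst.fst.fst.fst PolyTime.id.fst.fst.snd PolyTime.id.snd)
          (definable_selNe φ.s PolyTime.id.fst.fst.fst.fst PolyTime.id.fst.snd PolyTime.id.snd))
  · exact Definable.allTuples φ.m (P := fun (x : Inst φ.r × List ℕ) U => ∃ y, IsTuple x.1.1 φ.l y ∧
        Ev x.1 (x.2 ++ y) U true φ.matrix) hn
      (Definable.exTuples φ.l (n := fun x => x.1.1)
        (P := fun (x : (Inst φ.r × List ℕ) × List ℕ) U => Ev x.1.1 (x.1.2 ++ x.2) U true φ.matrix)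
        (hn.comp (g := fun x : Inst φ.r × List ℕ => x.1) PolyTime.id.fst)
        ((definable_ev true φ.matrix).comp
          (f := fun x : (Inst φ.r × List ℕ) × List ℕ => (x.1.1, x.1.2 ++ x.2))
          (PolyTime.id.fst.fst.pair (PolyTime.id.fst.snd.append PolyTime.id.snd))))

theorem tupleList_append {n m l : ℕ} (x : Fin m → Fin n) (y : Fin l → Fin n) :
    tupleList (Fin.append x y) = tupleList x ++ tupleList y := by
  rw [tupleList, tupleList, tupleList, ← List.ofFn_fin_append]
  congr 1
  funext i
  refine Fin.addCases (fun i => ?_) (fun i => ?_) i <;> simp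

/-- The formula of an instance holds of a set of names in which the selector `j` selects exactly
the tuple `a j` if and only if the tuples `a j` are pairwise different and form a solution. -/
theorem instFormula_iff (φ : PiTwoFormula) (A : FinStructure φ.ar) {k : ℕ}
    (a : Fin k → Fin φ.s → Fin A.n) (U : Set Name)
    (hU : ∀ (j : Fin k) (l : List ℕ), 0 :: j.val :: l ∈ U ↔ l = tupleList (a j)) :
    InstFormula φ (A.n, k, factList A) U ↔
      Function.Injective a ∧ φ.Models A (Finset.univ.image a) := by
  have hne : ∀ (j : Fin k) (x : Fin φ.s → Fin A.n),
      SelNe A.n φ.s U j (tupleList x) ↔ a j ≠ x := by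
    intro j x
    simp only [SelNe, hU]
    constructor
    · rintro ⟨_, _, h, rfl⟩ rfl
      exact h rfl
    · intro h
      exact ⟨_, isTuple_iff.2 ⟨_, rfl⟩, fun h' => h (tupleList_injective h'), rfl⟩
  have hev := fun e => (ev_iff (v := φ.m + φ.l) A k (Finset.univ.image a) U (fun x => by
      simp only [Sel, Finset.mem_image, Finset.mem_univ, true_and]
      constructor
      · rintro ⟨j, hj, h⟩
        exact ⟨⟨j, hj⟩, (tupleList_injective ((hU ⟨j, hj⟩ _).1 h)).symm⟩
      · rintro ⟨j, rfl⟩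
        exact ⟨j, j.isLt, (hU j _).2 rfl⟩) (fun x => by
      simp only [Finset.mem_image, Finset.mem_univ, true_and, not_exists]
      constructor
      · intro h j
        exact (hne j x).1 (h j j.isLt)
      · intro h j hj
        exact (hne ⟨j, hj⟩ x).2 (h _)) e φ.matrix).1
  refine (and_iff_right ?_).trans (and_congr ?_ ?_)
  · exact fun j hj => ⟨_, isTuple_iff.2 ⟨a ⟨j, hj⟩, rfl⟩, (hU ⟨j, hj⟩ _).2 rfl⟩
  · constructor
    · intro h i j hij
      rcases h i i.isLt j j.isLt with h | h
      · exact Fin.ext h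
      · rcases h _ (isTuple_iff.2 ⟨a i, rfl⟩) with h | h
        · exact absurd rfl ((hne i _).1 h)
        · exact absurd hij.symm ((hne j _).1 h)
    · intro h j hj j' hj'
      refine or_iff_not_imp_left.2 fun hjj l hl => ?_
      obtain ⟨x, rfl⟩ := isTuple_iff.1 hl
      rw [show j = (⟨j, hj⟩ : Fin k).val from rfl, show j' = (⟨j', hj'⟩ : Fin k).val from rfl,
        hne, hne]
      by_contra! h'
      exact hjj (congrArg Fin.val (h (h'.1.trans h'.2.symm)))
  · constructor
    · intro h x
      obtain ⟨l, hl, h⟩ := h _ (isTuple_iff.2 ⟨x, rfl⟩)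
      obtain ⟨y, rfl⟩ := isTuple_iff.1 hl
      rw [← tupleList_append] at h
      exact ⟨y, (hev _).1 h⟩
    · intro h l hl
      obtain ⟨x, rfl⟩ := isTuple_iff.1 hl
      obtain ⟨y, hy⟩ := h x
      refine ⟨_, isTuple_iff.2 ⟨y, rfl⟩, ?_⟩
      rw [← tupleList_append]
      exact (hev _).2 hy

/-- Counting replaces negation: the `k` selectors need `k` different names, and there are at most
`k`, so `U` consists of exactly one name per selector. -/
theorem exists_models_of_instFormula (φ : PiTwoFormula) (A : FinStructure φ.ar) {k : ℕ}
    {U : Finset Name} (hcard : U.card ≤ k) (h : InstFormula φ (A.n, k, factList A) U) :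
    ∃ S : Finset (Fin φ.s → Fin A.n), S.card = k ∧ φ.Models A S := by
  have h₁ : ∀ j : Fin k, ∃ x : Fin φ.s → Fin A.n, 0 :: j.val :: tupleList x ∈ U := fun j => by
    obtain ⟨l, hl, hU⟩ := h.1 j j.isLt
    obtain ⟨x, rfl⟩ := isTuple_iff.1 hl
    exact ⟨x, hU⟩
  choose a ha using h₁
  have hinj : Function.Injective fun j : Fin k => 0 :: j.val :: tupleList (a j) := fun i j h =>
    Fin.ext (by simpa using (List.cons.inj (List.cons.inj h).2).1)
  have himg : Finset.univ.image (fun j : Fin k => 0 :: j.val :: tupleList (a j)) = U :=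
    Finset.eq_of_subset_of_card_le (by
      intro u hu
      obtain ⟨j, _, rfl⟩ := Finset.mem_image.1 hu
      exact ha j) (by rwa [Finset.card_image_of_injective _ hinj, Finset.card_univ,
        Fintype.card_fin])
  have hU : ∀ (j : Fin k) (l : List ℕ),
      0 :: j.val :: l ∈ (U : Set Name) ↔ l = tupleList (a j) := by
    intro j l
    rw [← himg, Finset.mem_coe, Finset.mem_image]
    constructor
    · rintro ⟨i, _, h⟩
      simp only [List.cons.injEq, true_and] at h
      rw [← h.2, Fin.ext h.1]
    · rintro rfl
      exact ⟨j, Finset.mem_univ _, rfl⟩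
  obtain ⟨hi, hm⟩ := (instFormula_iff φ A a U hU).1 h
  exact ⟨_, by rw [Finset.card_image_of_injective _ hi, Finset.card_univ, Fintype.card_fin], hm⟩

/-- An enumeration of the solution `S` tells which tuple each selector selects. -/
theorem exists_instFormula_of_models (φ : PiTwoFormula) (A : FinStructure φ.ar) {k : ℕ}
    {S : Finset (Fin φ.s → Fin A.n)} (hcard : S.card = k) (hS : φ.Models A S) :
    ∃ U : Finset Name, U.card ≤ k ∧ (∀ u ∈ U, u.head? = some 0) ∧
      InstFormula φ (A.n, k, factList A) U := by
  let e := S.equivFinOfCardEq hcard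
  let a : Fin k → Fin φ.s → Fin A.n := fun j => e.symm j
  have himg : Finset.univ.image a = S := by
    ext x
    simp only [Finset.mem_image, Finset.mem_univ, true_and, a]
    constructor
    · rintro ⟨j, rfl⟩
      exact (e.symm j).2
    · intro hx
      exact ⟨e ⟨x, hx⟩, by simp⟩
  refine ⟨Finset.univ.image fun j : Fin k => 0 :: j.val :: tupleList (a j),
    Finset.card_image_le.trans (by simp), fun u hu => ?_, (instFormula_iff φ A a _ ?_).2 ⟨?_, ?_⟩⟩
  · obtain ⟨j, _, rfl⟩ := Finset.mem_image.1 hu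
    rfl
  · intro j l
    rw [Finset.mem_coe, Finset.mem_image]
    constructor
    · rintro ⟨i, _, h⟩
      simp only [List.cons.injEq, true_and] at h
      rw [← h.2, Fin.ext h.1]
    · rintro rfl
      exact ⟨j, Finset.mem_univ _, rfl⟩
  · exact Subtype.val_injective.comp e.symm.injective
  · rwa [himg]

end BackdoorReduction

/-! ## Reading structures -/

namespace BackdoorReduction

open StackProgram Parameterized

variable {r : ℕ}

/-- The word of a list of numbers, each of which is written in unary after a separator. -/
def argsWord (r : ℕ) (l : List ℕ) : List (Fin r ⊕ Bool) :=
  l.flatMap fun i => Sum.inr false :: List.replicate i (Sum.inr true)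

/-- The word of a structure with `n` elements and a given list of facts. -/
def structWord (n : ℕ) (l : List (Fin r × List ℕ)) : List (Fin r ⊕ Bool) :=
  List.replicate n (Sum.inr true) ++ l.flatMap fun a => Sum.inl a.1 :: argsWord r a.2

/-- The state of the parser, which reads words from right to left: the number of tally marks, the
list of arguments, and the list of facts that have been read. -/
abbrev ParserState (r : ℕ) : Type := ℕ × List ℕ × List (Fin r × List ℕ)

/-- The transition function of the parser. -/
def parseStep (a : Fin r ⊕ Bool) (x : ParserState r) : ParserState r :=
  match a with
  | .inl R => (0, [], (R, x.2.1) :: x.2.2)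
  | .inr false => (0, x.1 :: x.2.1, x.2.2)
  | .inr true => (x.1 + 1, x.2)

/-- The final state of the parser. -/
def parse (w : List (Fin r ⊕ Bool)) : ParserState r := w.foldr parseStep (0, [], [])

theorem foldr_parseStep_replicate (n : ℕ) (x : ParserState r) :
    (List.replicate n (Sum.inr true)).foldr parseStep x = (x.1 + n, x.2) := by
  induction n with
  | zero => rfl
  | succ n ih => rw [List.replicate_succ, List.foldr_cons, ih]; rfl

theorem foldr_parseStep_argsWord (l : List ℕ) (L : List (Fin r × List ℕ)) :
    (argsWord r l).foldr parseStep (0, [], L) = (0, l, L) := by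
  induction l with
  | nil => rfl
  | cons i l ih =>
    rw [argsWord, List.flatMap_cons, List.foldr_append]
    change List.foldr parseStep ((argsWord r l).foldr parseStep (0, [], L)) _ = _
    rw [ih, List.foldr_cons, foldr_parseStep_replicate]
    simp [parseStep]

/-- Read from the right, each argument is closed by its separator and each fact by its relation
symbol; the tally marks left at the end count the universe. -/
theorem parse_structWord (n : ℕ) (l : List (Fin r × List ℕ)) :
    parse (structWord n l) = (n, [], l) := by
  have h : (l.flatMap fun a => Sum.inl a.1 :: argsWord r a.2).foldr parseStep (0, [], []) =
      (0, [], l) := by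
    induction l with
    | nil => rfl
    | cons a l ih =>
      rw [List.flatMap_cons, List.foldr_append, ih, List.foldr_cons, foldr_parseStep_argsWord]
      rfl
  rw [parse, structWord, List.foldr_append, h, foldr_parseStep_replicate, Nat.zero_add]

/-- The test whether a word describes a structure. -/
def isStructWord (ar : Fin r → ℕ) (w : List (Fin r ⊕ Bool)) : Bool :=
  decide (0 < (parse w).1) &&
  ((parse w).2.2.all fun a => decide (a.2.length = ar a.1) &&
    a.2.all fun i => decide (i < (parse w).1)) &&
  decide (structWord (parse w).1 (parse w).2.2 = w)

theorem word_eq {ar : Fin r → ℕ} (A : FinStructure ar) : A.word = structWord A.n (factList A) := by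
  simp only [FinStructure.word, structWord, factList, argsWord, tupleList, List.flatMap_map]
  congr 1
  refine List.flatMap_congr fun a _ => ?_
  rw [show (List.ofFn fun i => (a.2 i).val) = (List.ofFn a.2).map Fin.val from
    List.map_ofFn.symm, List.flatMap_map]

theorem parse_word {ar : Fin r → ℕ} (A : FinStructure ar) :
    parse A.word = (A.n, [], factList A) := by
  rw [word_eq, parse_structWord]

/-- The parser accepts every word, so malformed ones are detected by writing the parsed data again
and comparing; the other tests check arities and ranges. -/
theorem isStructWord_iff {ar : Fin r → ℕ} {w : List (Fin r ⊕ Bool)} :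
    isStructWord ar w = true ↔ ∃ A : FinStructure ar, w = A.word := by
  constructor
  · intro h
    simp only [isStructWord, Bool.and_eq_true, decide_eq_true_eq, List.all_eq_true] at h
    obtain ⟨⟨h₀, h₁⟩, h₂⟩ := h
    obtain ⟨l, hl⟩ : ∃ l : List (Σ R : Fin r, Fin (ar R) → Fin (parse w).1),
        l.map (fun a => (a.1, tupleList a.2)) = (parse w).2.2 := by
      revert h₁
      generalize (parse w).2.2 = L
      intro h₁
      induction L with
      | nil => exact ⟨[], rfl⟩
      | cons a L ih =>
        obtain ⟨l, hl⟩ := ih fun b hb => h₁ b (List.mem_cons_of_mem _ hb)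
        obtain ⟨x, hx⟩ := isTuple_iff.1 (h₁ a List.mem_cons_self)
        exact ⟨⟨a.1, x⟩ :: l, by rw [List.map_cons, hl, ← hx]⟩
    refine ⟨⟨_, h₀, l⟩, ?_⟩
    rw [word_eq, factList, hl, h₂]
  · rintro ⟨A, rfl⟩
    simp only [isStructWord, Bool.and_eq_true, decide_eq_true_eq, List.all_eq_true, parse_word]
    refine ⟨⟨A.pos, fun a ha => ?_⟩, (word_eq A).symm⟩
    obtain ⟨b, _, rfl⟩ := List.mem_map.1 ha
    exact isTuple_iff.2 ⟨b.2, rfl⟩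

/-- Each letter increases the size of the state by at most a constant depending on `r`; this is the
size bound needed for the fold. -/
theorem esize_foldl_parseStep_le (l : List (Fin r ⊕ Bool)) (x : ParserState r) :
    esize (l.foldl (fun x a => parseStep a x) x) ≤ (2 * r + 10) * l.length + esize x := by
  induction l generalizing x with
  | nil => simp
  | cons a l ih =>
    rw [List.foldl_cons, List.length_cons]
    refine (ih _).trans ?_
    have : esize (parseStep a x) ≤ esize x + (2 * r + 10) := by
      obtain ⟨c, L, F⟩ := x
      have hc := esize_nat c
      rcases a with R | _ | _
      · have hR : esize R = 2 * R.val + 1 := esize_nat R.val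
        have := R.isLt
        simp only [parseStep, esize_pair, esize_cons, esize_nil, esize_zero]
        omega
      · simp only [parseStep, esize_pair, esize_cons, esize_zero]
        omega
      · simp only [parseStep, esize_pair, esize_succ]
        omega
    rw [Nat.mul_add]
    omega

theorem polyTime_parse : PolyTime (parse (r := r)) := by
  have hstep : PolyTime fun y : List (Fin r ⊕ Bool) × ParserState r × (Fin r ⊕ Bool) =>
      parseStep y.2.2 y.2.1 := by
    have hs : PolyTime fun y : List (Fin r ⊕ Bool) × ParserState r × (Fin r ⊕ Bool) => y.2.2 :=
      PolyTime.id.snd.snd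
    have hx : PolyTime fun y : List (Fin r ⊕ Bool) × ParserState r × (Fin r ⊕ Bool) => y.2.1 :=
      PolyTime.id.snd.fst
    -- The relation symbol is obtained as a list with at most one element, from which the new fact
    -- is formed by `map`.
    have hrel : PolyTime fun a : Fin r ⊕ Bool => (a.elim (fun R => [R]) fun _ => []) :=
      PolyTime.of_fintype _
    convert (hs.decide_eq (PolyTime.const (Sum.inr true))).ite (hx.fst.succ.pair hx.snd)
      ((hs.decide_eq (PolyTime.const (Sum.inr false))).ite
        ((PolyTime.const 0).pair ((hx.fst.cons hx.snd.fst).pair hx.snd.snd))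
        ((PolyTime.const 0).pair ((PolyTime.const []).pair
          (((hrel.comp hs).map (PolyTime.id.snd.pair (hx.snd.fst.comp PolyTime.id.fst))).append
            hx.snd.snd)))) using 2 with y
    rcases y with ⟨w, x, R | _ | _⟩ <;> simp [parseStep]
  have h := PolyTime.foldl (PolyTime.id (α := List (Fin r ⊕ Bool))).reverse
    (PolyTime.const (0, [], [])) hstep (Polynomial.C (2 * r + 10) * Polynomial.X + 10)
    fun w l hl => by
      refine (esize_foldl_parseStep_le l _).trans ?_
      simp only [Polynomial.eval_add, Polynomial.eval_mul, Polynomial.eval_C, Polynomial.eval_X,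
        Polynomial.eval_ofNat, esize_pair, esize_zero, esize_nil]
      have := length_le_esize w
      have hlen := hl.length_le
      rw [List.length_reverse] at hlen
      gcongr
      · omega
      · norm_num
  convert h using 2 with w
  rw [List.foldl_reverse]
  rfl

theorem polyTime_argsWord : PolyTime (argsWord r) :=
  PolyTime.id.flatMap (h := fun y : List ℕ × ℕ => Sum.inr false :: List.replicate y.2 (Sum.inr true))
    ((PolyTime.const _).cons (PolyTime.id.snd.replicate (PolyTime.const _)))

theorem polyTime_isStructWord (ar : Fin r → ℕ) : PolyTime (isStructWord ar) := by
  have hc : PolyTime fun w : List (Fin r ⊕ Bool) => (parse w).1 := polyTime_parse.fst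
  have hl : PolyTime fun w : List (Fin r ⊕ Bool) => (parse w).2.2 := polyTime_parse.snd.snd
  have hF : PolyTime fun y : List (Fin r ⊕ Bool) × (Fin r × List ℕ) => y.2 := PolyTime.id.snd
  have har : PolyTime ar := PolyTime.of_fintype ar
  refine (((PolyTime.const 0).decide_lt hc).and (hl.all
    (p := fun y => decide (y.2.2.length = ar y.2.1) && y.2.2.all fun i => decide (i < (parse y.1).1))
    ((hF.snd.length.decide_eq (har.comp hF.fst)).and (hF.snd.all
    (p := fun z : (List (Fin r ⊕ Bool) × (Fin r × List ℕ)) × ℕ => decide (z.2 < (parse z.1.1).1))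
    (PolyTime.id.snd.decide_lt (hc.comp PolyTime.id.fst.fst)))))).and
    (PolyTime.decide_eq ?_ PolyTime.id)
  exact (hc.replicate (PolyTime.const _)).append (hl.flatMap
    (h := fun y : List (Fin r ⊕ Bool) × (Fin r × List ℕ) => Sum.inl y.2.1 :: argsWord r y.2.2)
    (((PolyTime.of_fintype fun R : Fin r => (Sum.inl R : Fin r ⊕ Bool)).comp hF.fst).cons
      (polyTime_argsWord.comp hF.snd)))

end BackdoorReduction

/-! ## Formulas from networks -/

namespace BackdoorReduction

open StackProgram Parameterized CNFFormula BackdoorDetection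

/-! ### Restriction, satisfiability and renaming of clause sets -/

section ClauseSets

variable {V : Type} [DecidableEq V]

theorem mem_restrict {F : ClauseSet V} {B : Finset V} {τ : V → Bool} {D : Finset (Literal V)} :
    D ∈ restrict F B τ ↔
      ∃ C ∈ F, (∀ l ∈ C, l.1 ∈ B → l.2 ≠ τ l.1) ∧ C \ falseLits B τ = D := by
  simp only [restrict, Finset.mem_image, Finset.mem_filter, and_assoc]
  refine exists_congr fun C => and_congr_right fun _ => and_congr_left fun _ => ?_
  simp only [Finset.eq_empty_iff_forall_notMem, Finset.mem_inter, trueLits, Finset.mem_image,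
    not_and, not_exists]
  constructor
  · exact fun h l hl hB hτ => h l hl l.1 hB (Prod.ext rfl hτ.symm)
  · rintro h l hl x hB rfl
    exact h _ hl hB rfl

theorem satisfiable_of_forall {G : ClauseSet V} (σ : V → Bool)
    (h : ∀ C ∈ G, ∃ l ∈ C, l.2 = σ l.1) : Satisfiable G := by
  refine ⟨σ, Finset.eq_empty_of_forall_notMem fun D hD => ?_⟩
  obtain ⟨C, hC, hne, _⟩ := mem_restrict.1 hD
  obtain ⟨l, hl, hσ⟩ := h C hC
  exact hne l hl (Finset.mem_biUnion.2 ⟨C, hC, Finset.mem_image_of_mem _ hl⟩) hσ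

/-- The renaming `r_X` makes `F` Horn if and only if no clause of `F` contains two literals that
become positive. -/
theorem horn_rename_iff {X : Finset V} {F : ClauseSet V} :
    Horn (rename X F) ↔ ∀ C ∈ F, ∀ l ∈ C, ∀ l' ∈ C, l.2 = !decide (l.1 ∈ X) →
      l'.2 = !decide (l'.1 ∈ X) → l = l' := by
  have hpos : ∀ l : Literal V, l.2 = !decide (l.1 ∈ X) →
      (if l.1 ∈ X then (l.1, !l.2) else l) = (l.1, true) := by
    rintro ⟨x, b⟩ h
    by_cases hx : x ∈ X <;> simp_all
  have hpos' : ∀ (l : Literal V), (if l.1 ∈ X then (l.1, !l.2) else l).2 = true →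
      l.2 = !decide (l.1 ∈ X) := by
    rintro ⟨x, b⟩ h
    by_cases hx : x ∈ X <;> simp_all
  simp only [Horn, rename, Finset.forall_mem_image, Finset.card_le_one, Finset.mem_filter, and_imp]
  refine forall₂_congr fun C _ => ?_
  constructor
  · intro h l hl l' hl' hp hp'
    have := h hl (by rw [hpos l hp]) hl' (by rw [hpos l' hp'])
    rw [hpos l hp, hpos l' hp', Prod.mk.injEq] at this
    refine Prod.ext this.1 ?_
    rw [hp, hp', this.1]
  · intro h l hl hp l' hl' hp'
    rw [h l hl l' hl' (hpos' l hp) (hpos' l' hp')]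

end ClauseSets

/-- The binary word of a name. -/
def nameWord (v : Name) : Var := v.flatMap fun i => List.replicate i true ++ [false]

/-- Decoding from the right: `false` opens a new entry `0`, and each `true` increments the first
entry. -/
theorem nameWord_injective : Function.Injective nameWord := by
  let f : Bool → Name → Name := fun b v => if b then v.modifyHead (· + 1) else 0 :: v
  refine Function.LeftInverse.injective (g := fun x => x.foldr f []) fun v => ?_
  induction v with
  | nil => rfl
  | cons i v ih =>
    have h : ∀ i, (List.replicate i true).foldr f (0 :: v) = i :: v := by
      intro i
      induction i with
      | zero => rfl
      | succ i ih => rw [List.replicate_succ, List.foldr_cons, ih]; rfl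
    change (nameWord v).foldr f [] = v at ih
    change (nameWord (i :: v)).foldr f [] = i :: v
    rw [nameWord, List.flatMap_cons, List.foldr_append, List.foldr_append]
    change List.foldr f (f false ((nameWord v).foldr f [])) _ = _
    rw [ih]
    exact h i

/-- The state of a parser for formulas, which reads words from right to left. -/
def parseLetter (a : Letter) (x : Var × List (Literal Var) × FormulaText) :
    Var × List (Literal Var) × FormulaText :=
  match a with
  | .inl b => (b :: x.1, x.2)
  | .inr (some ε) => ([], (x.1, ε) :: x.2.1, x.2.2)
  | .inr none => ([], [], x.2.1 :: x.2.2)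

theorem foldr_parseLetter_word (E : FormulaText) :
    (FormulaText.word E).foldr parseLetter ([], [], []) = ([], [], E) := by
  have h₁ : ∀ (x y : Var) (z : List (Literal Var) × FormulaText),
      (x.map Sum.inl).foldr parseLetter (y, z) = (x ++ y, z) := by
    intro x y z
    induction x with
    | nil => rfl
    | cons b x ih => rw [List.map_cons, List.foldr_cons, ih]; rfl
  have h₂ : ∀ (C : List (Literal Var)) (E : FormulaText),
      (C.flatMap fun l => Sum.inr (some l.2) :: l.1.map Sum.inl).foldr parseLetter ([], [], E) =
        ([], C, E) := by
    intro C E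
    induction C with
    | nil => rfl
    | cons l C ih =>
      rw [List.flatMap_cons, List.foldr_append, ih, List.foldr_cons, h₁, List.append_nil]
      rfl
  induction E with
  | nil => rfl
  | cons C E ih =>
    rw [FormulaText.word, List.flatMap_cons, List.foldr_append]
    change List.foldr parseLetter ((FormulaText.word E).foldr parseLetter ([], [], [])) _ = _
    rw [ih, List.foldr_cons, h₂]
    rfl

/-- Unique readability: the formula in a yes-instance is determined by its word. -/
theorem word_injective : Function.Injective FormulaText.word := fun E E' h => by
  have := congrArg (fun w => (w.foldr parseLetter ([], [], [])).2.2) h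
  simpa only [foldr_parseLetter_word] using this

/-- Provides a fixed no-instance, to which malformed inputs are sent. -/
theorem word_ne_singleton (E : FormulaText) (b : Bool) : FormulaText.word E ≠ [Sum.inl b] := fun h => by
  have := foldr_parseLetter_word E
  rw [h] at this
  exact absurd (congrArg Prod.fst this) (by simp [parseLetter])

/-- The clause of an edge. -/
def edgeClause (e : Edge) : List (Literal Name) :=
  (e.1, true) :: (e.2.1, false) :: e.2.2.map fun u => (u, true)

/-! ### The formula of a network -/

section Gadget

variable {α : Type} (N : Template α) (a : α)

/-- The clauses of the copy `c` of a network: they force the source of the network into and the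
target out of each set of variables whose complement defines a Horn renaming. -/
def copyClauses (c : ℕ) : List (List (Literal Name)) :=
  -- The entries `1`, `2`, `3` after `[1, c]` denote source, target and an auxiliary variable; `[1,
  -- c, 0]` is the prefix of the inner nodes.
  [([1, c, 2], true), ([1, c, 1], true)] :: [([1, c, 1], false), ([1, c, 3], true)] ::
    [([1, c, 1], false), ([1, c, 3], false)] ::
    (N (a, [1, c, 0], [1, c, 1], [1, c, 2])).map edgeClause

/-- The clauses of `k + 1` copies of a network. -/
def clauses (k : ℕ) : List (List (Literal Name)) := (List.range (k + 1)).flatMap (copyClauses N a)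

/-- The formula that consists of `k + 1` copies of a network. -/
def text (k : ℕ) : FormulaText := (clauses N a k).map fun C => C.map fun l => (nameWord l.1, l.2)

variable {N a} {k : ℕ}

theorem mem_toClauseSet_text {D : Finset (Literal Var)} :
    D ∈ (text N a k).toClauseSet ↔
      ∃ C ∈ clauses N a k, (C.map fun l => (nameWord l.1, l.2)).toFinset = D := by
  simp [FormulaText.toClauseSet, text]

theorem mem_map_nameWord {C : List (Literal Name)} {v : Name} {b : Bool} :
    (nameWord v, b) ∈ (C.map fun l => (nameWord l.1, l.2)).toFinset ↔ (v, b) ∈ C := by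
  simp only [List.mem_toFinset, List.mem_map, Prod.mk.injEq]
  constructor
  · rintro ⟨⟨v', b'⟩, h, hv, rfl⟩
    rwa [← nameWord_injective hv]
  · exact fun h => ⟨_, h, rfl, rfl⟩

theorem mem_clauses {C : List (Literal Name)} :
    C ∈ clauses N a k ↔ ∃ c ≤ k, C = [([1, c, 2], true), ([1, c, 1], true)] ∨
      C = [([1, c, 1], false), ([1, c, 3], true)] ∨ C = [([1, c, 1], false), ([1, c, 3], false)] ∨
      ∃ e ∈ N (a, [1, c, 0], [1, c, 1], [1, c, 2]), C = edgeClause e := by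
  simp only [clauses, copyClauses, List.mem_flatMap, List.mem_range, List.mem_cons, List.mem_map,
    Nat.lt_succ_iff, eq_comm (a := C)]

theorem head?_ne_of_prefix {c : ℕ} {v : Name} (h : [1, c] <+: v) : v.head? ≠ some 0 := by
  obtain ⟨l, rfl⟩ := h
  simp

variable {P : α → Set Name → Prop}

theorem prefix_of_mem (hN : Realizes N P) {c : ℕ} {e : Edge}
    (he : e ∈ N (a, [1, c, 0], [1, c, 1], [1, c, 2])) : [1, c] <+: e.1 ∧ [1, c] <+: e.2.1 := by
  obtain ⟨h₁, h₂, _⟩ := hN.ends _ _ _ _ e he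
  have hp : ∀ i, [1, c] <+: [1, c, i] := fun i => List.prefix_append [1, c] [i]
  exact ⟨h₁.elim (fun h => h ▸ hp 1) (hp 0).trans, h₂.elim (fun h => h ▸ hp 2) (hp 0).trans⟩

/-- An edge clause has only one negative literal, on the end of the edge. It differs from the start
by `ne`, and from the label because labels begin with `0`. -/
theorem isCNF_text (hN : Realizes N P) : IsCNF (text N a k).toClauseSet := by
  intro D hD x ⟨h₁, h₂⟩
  obtain ⟨C, hC, rfl⟩ := mem_toClauseSet_text.1 hD
  obtain ⟨⟨v, b⟩, _, hv⟩ := List.mem_map.1 (List.mem_toFinset.1 h₁)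
  obtain rfl : nameWord v = x := congrArg Prod.fst hv
  rw [mem_map_nameWord] at h₁ h₂
  obtain ⟨c, _, rfl | rfl | rfl | ⟨e, he, rfl⟩⟩ := mem_clauses.1 hC
  · simp at h₂
  · simp at h₁ h₂
    simp [h₁] at h₂
  · simp at h₁
  · have hne := hN.ne _ _ _ _ (by simp) (by simp) (by simp) e he
    have hp := head?_ne_of_prefix (prefix_of_mem hN he).2
    have hl := (hN.ends _ _ _ _ e he).2.2.2
    simp only [edgeClause, List.mem_cons, List.mem_map, Prod.mk.injEq, and_true, and_false,
      Bool.false_eq_true, Bool.true_eq_false, false_or, or_false, exists_false,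
      exists_eq_right] at h₁ h₂
    subst h₂
    rcases h₁ with h₁ | h₁
    · exact hne h₁.symm
    · exact hp (hl _ h₁)

theorem hasWidthAtMost_text (hN : Realizes N P) : HasWidthAtMost 3 (text N a k).toClauseSet := by
  intro D hD
  obtain ⟨C, hC, rfl⟩ := mem_toClauseSet_text.1 hD
  refine (List.toFinset_card_le _).trans ?_
  obtain ⟨c, _, rfl | rfl | rfl | ⟨e, he, rfl⟩⟩ := mem_clauses.1 hC
  · simp
  · simp
  · simp
  · have := (hN.ends _ _ _ _ e he).2.2.1
    simp only [edgeClause, List.map_cons, List.length_cons, List.length_map]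
    omega

/-- In a copy without backdoor variables among its nodes, the complement of the renaming set
contains the source but not the target. If the condition failed for the selector names set to true,
an uncut path would contradict this. -/
theorem exists_of_isWeakBackdoor (hN : Realizes N P) {B : Finset Var} (hcard : B.card ≤ k)
    (hB : IsWeakBackdoor RHorn (text N a k).toClauseSet B) :
    ∃ U : Finset Name, U.card ≤ k ∧ P a U := by
  obtain ⟨τ, _, X, hX⟩ := hB
  rw [horn_rename_iff] at hX
  -- The Horn condition for a clause not satisfied by `τ`, restricted to its literals outside `B`:
  -- at most one of them becomes positive.
  have key : ∀ C ∈ clauses N a k, (∀ v b, (v, b) ∈ C → nameWord v ∈ B → b ≠ τ (nameWord v)) →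
      ∀ v b v' b', (v, b) ∈ C → (v', b') ∈ C → nameWord v ∉ B → nameWord v' ∉ B →
      b = (!decide (nameWord v ∈ X)) → b' = (!decide (nameWord v' ∈ X)) → v = v' ∧ b = b' := by
    intro C hC hlive v b v' b' hv hv' hB hB' hb hb'
    have hmem : ∀ u β, (u, β) ∈ C → nameWord u ∉ B → (nameWord u, β) ∈
        (C.map fun l => (nameWord l.1, l.2)).toFinset \ falseLits B τ := by
      intro u β hu huB
      refine Finset.mem_sdiff.2 ⟨mem_map_nameWord.2 hu, fun h => ?_⟩
      obtain ⟨y, hy, h⟩ := Finset.mem_image.1 h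
      obtain rfl : y = nameWord u := congrArg Prod.fst h
      exact huB hy
    have := hX _ (mem_restrict.2 ⟨_, mem_toClauseSet_text.2 ⟨C, hC, rfl⟩, fun l hl hlB => ?_, rfl⟩)
      _ (hmem v b hv hB) _ (hmem v' b' hv' hB') hb hb'
    · exact ⟨nameWord_injective (congrArg Prod.fst this), congrArg Prod.snd this⟩
    · obtain ⟨⟨u, β⟩, hu, rfl⟩ := List.mem_map.1 (List.mem_toFinset.1 hl)
      exact hlive u β hu hlB
  -- Pigeonhole: `k + 1` copies with disjoint sets of nodes, and at most `k` backdoor variables.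
  obtain ⟨c, hc, hfree⟩ : ∃ c ≤ k, ∀ v, [1, c] <+: v → nameWord v ∉ B := by
    by_contra! h
    choose! f hf hfB using h
    have := Finset.card_le_card_of_injOn (s := Finset.range (k + 1)) (t := B)
      (fun c => nameWord (f c)) (fun c hc => hfB c (by simpa [Nat.lt_succ_iff] using hc))
      (fun c hc d hd h => by
        have h₁ := hf c (by simpa [Nat.lt_succ_iff] using hc)
        have h₂ := hf d (by simpa [Nat.lt_succ_iff] using hd)
        rw [nameWord_injective h] at h₁
        exact prefix_concat_inj (p := [1]) h₁ h₂)
    rw [Finset.card_range] at this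
    omega
  have hnode : ∀ i, nameWord [1, c, i] ∉ B := fun i => hfree _ (List.prefix_append [1, c] [i])
  -- Only names set to true cut edges, since they satisfy the clauses in which they are labels.
  let U : Finset Name := (B.filter fun x => τ x = true).preimage nameWord nameWord_injective.injOn
  have hU : ∀ u, u ∈ (U : Set Name) ↔ nameWord u ∈ B ∧ τ (nameWord u) = true := fun u => by
    simp [U]
  refine ⟨U, ?_, ?_⟩
  · refine (Finset.card_le_card_of_injOn nameWord (fun u hu => ?_) nameWord_injective.injOn).trans
      hcard
    exact ((hU u).1 hu).1
  · by_contra hP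
    have hres : Respects U (fun v => nameWord v ∉ X) (N (a, [1, c, 0], [1, c, 1], [1, c, 2])) := by
      intro e he hlive h₁ h₂
      obtain ⟨hp, hp'⟩ := prefix_of_mem hN he
      have := key (edgeClause e) (mem_clauses.2 ⟨c, hc, .inr (.inr (.inr ⟨e, he, rfl⟩))⟩)
        (fun v b hv hvB hb => ?_) e.1 true e.2.1 false (by simp [edgeClause]) (by simp [edgeClause])
        (hfree _ hp) (hfree _ hp') (by simpa using h₁) (by simpa using h₂)
      · exact absurd this.2 (by simp)
      · simp only [edgeClause, List.mem_cons, List.mem_map, Prod.mk.injEq] at hv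
        rcases hv with ⟨rfl, _⟩ | ⟨rfl, _⟩ | ⟨u, hu, rfl, rfl⟩
        · exact hfree _ hp hvB
        · exact hfree _ hp' hvB
        · exact hlive u hu ((hU u).2 ⟨hvB, hb.symm⟩)
    have hfree' : ∀ (C : List (Literal Name)), (∀ l ∈ C, ∃ i, l.1 = [1, c, i]) →
        ∀ v b, (v, b) ∈ C → nameWord v ∈ B → b ≠ τ (nameWord v) := by
      intro C hC v b hv hB
      obtain ⟨i, hi⟩ := hC _ hv
      obtain rfl : v = [1, c, i] := hi
      exact absurd hB (hnode i)
    -- If the source were in `X`, its negative literal would become positive in two clauses, and one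
    -- of the complementary literals on `[1, c, 3]` would too.
    have hs : nameWord [1, c, 1] ∉ X := by
      intro hs
      by_cases hq : nameWord [1, c, 3] ∈ X
      · have := key _ (mem_clauses.2 ⟨c, hc, .inr (.inr (.inl rfl))⟩) (hfree' _ (by simp))
          [1, c, 1] false [1, c, 3] false (by simp) (by simp) (hnode _) (hnode _)
          (by simpa using hs) (by simpa using hq)
        simp at this
      · have := key _ (mem_clauses.2 ⟨c, hc, .inr (.inl rfl)⟩) (hfree' _ (by simp))
          [1, c, 1] false [1, c, 3] true (by simp) (by simp) (hnode _) (hnode _)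
          (by simpa using hs) (by simpa using hq)
        simp at this
    have ht := hN.sound a _ _ _ U _ hres hP hs
    have := key _ (mem_clauses.2 ⟨c, hc, .inl rfl⟩) (hfree' _ (by simp))
      [1, c, 2] true [1, c, 1] true (by simp) (by simp) (hnode _) (hnode _)
      (by simpa using ht) (by simpa using hs)
    simp at this

theorem exists_isWeakBackdoor (hN : Realizes N P) {U : Finset Name} (hcard : U.card ≤ k)
    (hU : ∀ u ∈ U, u.head? = some 0) (hP : P a U) :
    ∃ B : Finset Var, B.card ≤ k ∧ IsWeakBackdoor RHorn (text N a k).toClauseSet B := by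
  classical
  -- Starting from the set of all sources, `ρ` is extended to the inner nodes of each copy; this is
  -- possible because `P` holds.
  obtain ⟨ρ, hρ, hres⟩ := exists_respects_of_family (U := (U : Set Name)) (fun c => [1, c, 0])
    (fun c => N (a, [1, c, 0], [1, c, 1], [1, c, 2]))
    (fun i j v hi hj => by
      have h := List.prefix_of_prefix_length_le hi hj (by simp)
      simpa [List.cons_prefix_cons] using h) (k + 1)
    (fun c _ e he => by
      obtain ⟨h₁, h₂, _⟩ := hN.ends _ _ _ _ e he
      refine ⟨h₁.symm.imp_right fun h j => ?_, h₂.symm.imp_right fun h j => ?_⟩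
      · rw [h]; simp [List.cons_prefix_cons]
      · rw [h]; simp [List.cons_prefix_cons]) (fun v => ∃ c, v = [1, c, 1])
    (fun c _ => hN.complete a _ _ _ U _ (by simp) (by simp) (.inl hP))
  have hρs : ∀ c, ρ [1, c, 1] := fun c => (hρ _ (by simp [List.cons_prefix_cons])).2 ⟨c, rfl⟩
  have hρt : ∀ c, ¬ ρ [1, c, 2] := fun c h => by
    have := (hρ _ (by simp [List.cons_prefix_cons])).1 h
    simp at this
  have hρq : ∀ c, ¬ ρ [1, c, 3] := fun c h => by
    have := (hρ _ (by simp [List.cons_prefix_cons])).1 h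
    simp at this
  have hρ0 : ∀ u : Name, u.head? = some 0 → ¬ ρ u := fun u hu h => by
    obtain ⟨c, rfl⟩ := (hρ u fun c h => by
      obtain ⟨l, rfl⟩ := h
      simp at hu).1 h
    simp at hu
  -- A surviving clause has at most one literal that becomes positive. It also has a literal that
  -- becomes negative, on a variable that is not a selector name and hence not in the backdoor; the
  -- second fact yields satisfiability.
  have key : ∀ C ∈ clauses N a k, (∀ v, (v, true) ∈ C → v ∉ U) →
      (∀ v b v' b', (v, b) ∈ C → (v', b') ∈ C → b = decide (ρ v) → b' = decide (ρ v') →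
        v = v' ∧ b = b') ∧ ∃ v b, (v, b) ∈ C ∧ v.head? ≠ some 0 ∧ b = !decide (ρ v) := by
    intro C hC hlive
    obtain ⟨c, hc, rfl | rfl | rfl | ⟨e, he, rfl⟩⟩ := mem_clauses.1 hC
    · refine ⟨?_, [1, c, 2], true, by simp, by simp, by simp [hρt]⟩
      simp only [List.mem_cons, List.not_mem_nil, or_false, Prod.mk.injEq]
      rintro v b v' b' (⟨rfl, rfl⟩ | ⟨rfl, rfl⟩) (⟨rfl, rfl⟩ | ⟨rfl, rfl⟩) <;> simp [hρt]
    · refine ⟨?_, [1, c, 1], false, by simp, by simp, by simp [hρs]⟩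
      simp only [List.mem_cons, List.not_mem_nil, or_false, Prod.mk.injEq]
      rintro v b v' b' (⟨rfl, rfl⟩ | ⟨rfl, rfl⟩) (⟨rfl, rfl⟩ | ⟨rfl, rfl⟩) <;> simp [hρs, hρq]
    · refine ⟨?_, [1, c, 1], false, by simp, by simp, by simp [hρs]⟩
      simp only [List.mem_cons, List.not_mem_nil, or_false, Prod.mk.injEq]
      rintro v b v' b' (⟨rfl, rfl⟩ | ⟨rfl, rfl⟩) (⟨rfl, rfl⟩ | ⟨rfl, rfl⟩) <;> simp [hρs]
    · have hl := (hN.ends _ _ _ _ e he).2.2.2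
      obtain ⟨hp, hp'⟩ := prefix_of_mem hN he
      have himp : ρ e.1 → ρ e.2.1 := hres c (Nat.lt_succ_of_le hc) e he
        fun u hu => hlive u (by simp [edgeClause, hu])
      constructor
      · simp only [edgeClause, List.mem_cons, List.mem_map, Prod.mk.injEq]
        rintro v b v' b' (⟨rfl, rfl⟩ | ⟨rfl, rfl⟩ | ⟨u, hu, rfl, rfl⟩)
          (⟨rfl, rfl⟩ | ⟨rfl, rfl⟩ | ⟨u', hu', rfl, rfl⟩)
        · simp
        · simpa using himp
        · simp [hρ0 _ (hl _ hu')]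
        · simpa using fun h h' => absurd (himp h') h
        · simp
        · simp [hρ0 _ (hl _ hu')]
        · simp [hρ0 _ (hl _ hu)]
        · simp [hρ0 _ (hl _ hu)]
        · simp [hρ0 _ (hl _ hu)]
      · by_cases h : ρ e.1
        · exact ⟨e.2.1, false, by simp [edgeClause], head?_ne_of_prefix hp', by simp [himp h]⟩
        · exact ⟨e.1, true, by simp [edgeClause], head?_ne_of_prefix hp, by simp [h]⟩
  -- A renaming set must be finite, so the complement of `ρ` is taken among the names that occur.
  let X : Finset Var :=
    (((clauses N a k).flatten.map Prod.fst).toFinset.filter fun v => ¬ ρ v).image nameWord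
  have hX : ∀ C ∈ clauses N a k, ∀ v b, (v, b) ∈ C → (nameWord v ∈ X ↔ ¬ ρ v) := by
    intro C hC v b hv
    simp only [X, Finset.mem_image, Finset.mem_filter, List.mem_toFinset]
    constructor
    · rintro ⟨v', ⟨_, h⟩, h'⟩
      rwa [← nameWord_injective h']
    · exact fun h => ⟨v, ⟨List.mem_map.2 ⟨_, List.mem_flatten.2 ⟨C, hC, hv⟩, rfl⟩, h⟩, rfl⟩
  have hmem : ∀ v, nameWord v ∈ U.image nameWord ↔ v ∈ U := fun v =>
    nameWord_injective.mem_finset_image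
  have hD : ∀ D ∈ restrict (text N a k).toClauseSet (U.image nameWord) fun _ => true,
      ∃ C ∈ clauses N a k, (∀ v, (v, true) ∈ C → v ∉ U) ∧
        (C.map fun l => (nameWord l.1, l.2)).toFinset \
          falseLits (U.image nameWord) (fun _ => true) = D := by
    intro D hD
    obtain ⟨_, hC', h, rfl⟩ := mem_restrict.1 hD
    obtain ⟨C, hC, rfl⟩ := mem_toClauseSet_text.1 hC'
    exact ⟨C, hC, fun v hv hvU => h _ (mem_map_nameWord.2 hv) ((hmem v).2 hvU) rfl, rfl⟩
  -- The assignment that is true exactly on `X` makes every literal true that the renaming turns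
  -- negative.
  refine ⟨U.image nameWord, Finset.card_image_le.trans hcard, fun _ => true,
    satisfiable_of_forall (fun x => decide (x ∈ X)) ?_, X, horn_rename_iff.2 ?_⟩
  · intro D hD'
    obtain ⟨C, hC, hlive, rfl⟩ := hD D hD'
    obtain ⟨v, b, hv, h0, hb⟩ := (key C hC hlive).2
    refine ⟨(nameWord v, b), Finset.mem_sdiff.2 ⟨mem_map_nameWord.2 hv, fun h => ?_⟩, ?_⟩
    · obtain ⟨y, hy, h⟩ := Finset.mem_image.1 h
      obtain rfl : y = nameWord v := congrArg Prod.fst h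
      exact h0 (hU v ((hmem v).1 hy))
    · simp only [hX C hC v b hv]
      simpa using hb
  · intro D hD'
    obtain ⟨C, hC, hlive, rfl⟩ := hD D hD'
    intro l hl l' hl' h h'
    obtain ⟨⟨v, b⟩, hv, rfl⟩ := List.mem_map.1 (List.mem_toFinset.1 (Finset.mem_sdiff.1 hl).1)
    obtain ⟨⟨v', b'⟩, hv', rfl⟩ := List.mem_map.1 (List.mem_toFinset.1 (Finset.mem_sdiff.1 hl').1)
    simp only [hX C hC v b hv] at h
    simp only [hX C hC v' b' hv'] at h'
    obtain ⟨rfl, rfl⟩ := (key C hC hlive).1 v b v' b' hv hv' (by simpa using h) (by simpa using h')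
    rfl

end Gadget

end BackdoorReduction

/-! ## The reduction -/

namespace BackdoorReduction

open StackProgram Parameterized CNFFormula BackdoorDetection

theorem polyTime_nameWord : PolyTime nameWord :=
  PolyTime.id.flatMap (h := fun y : Name × ℕ => List.replicate y.2 true ++ [false])
    ((PolyTime.id.snd.replicate (PolyTime.const true)).append (PolyTime.const [false]))

theorem polyTime_edgeClause : PolyTime edgeClause :=
  (PolyTime.id.fst.pair (PolyTime.const true)).cons
    ((PolyTime.id.snd.fst.pair (PolyTime.const false)).cons
      (PolyTime.id.snd.snd.map (h := fun y : Edge × Name => (y.2, true))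
        (PolyTime.id.snd.pair (PolyTime.const true))))

theorem polyTime_text {α : Type} [Enc α] {N : Template α} (hN : PolyTime N) :
    PolyTime fun x : α × ℕ => text N x.1 x.2 := by
  have hnode : ∀ i : ℕ, PolyTime fun y : (α × ℕ) × ℕ => [1, y.2, i] := fun i =>
    (PolyTime.const 1).cons (PolyTime.id.snd.cons (PolyTime.const [i]))
  have hlit : ∀ (i : ℕ) (b : Bool),
      PolyTime fun y : (α × ℕ) × ℕ => (([1, y.2, i], b) : Literal Name) := fun i b =>
    (hnode i).pair (PolyTime.const b)
  have hcopy : PolyTime fun y : (α × ℕ) × ℕ => copyClauses N y.1.1 y.2 :=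
    ((hlit 2 true).cons (hlit 1 true).singleton).cons
      (((hlit 1 false).cons (hlit 3 true).singleton).cons
      (((hlit 1 false).cons (hlit 3 false).singleton).cons
      ((hN.comp (PolyTime.id.fst.fst.pair ((hnode 0).pair ((hnode 1).pair (hnode 2))))).map
        (h := fun z => edgeClause z.2) (polyTime_edgeClause.comp PolyTime.id.snd))))
  have hclauses : PolyTime fun x : α × ℕ => clauses N x.1 x.2 :=
    PolyTime.id.snd.succ.range.flatMap hcopy
  exact hclauses.map (h := fun y => y.2.map fun l => (nameWord l.1, l.2))
    (PolyTime.id.snd.map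
      (h := fun z : ((α × ℕ) × List (Literal Name)) × Literal Name => (nameWord z.2.1, z.2.2))
      ((polyTime_nameWord.comp PolyTime.id.snd.fst).pair PolyTime.id.snd.snd))

theorem polyTime_word : PolyTime FormulaText.word := by
  have hsign : PolyTime fun b : Bool => (Sum.inr (some b) : Letter) := PolyTime.of_fintype _
  have hletter : PolyTime fun b : Bool => (Sum.inl b : Letter) := PolyTime.of_fintype _
  exact PolyTime.id.flatMap
    (h := fun y : FormulaText × List (Literal Var) =>
      (Sum.inr none : Letter) :: y.2.flatMap fun l => Sum.inr (some l.2) :: l.1.map Sum.inl)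
    ((PolyTime.const (Sum.inr none : Letter)).cons (PolyTime.id.snd.flatMap
      (h := fun z : (FormulaText × List (Literal Var)) × Literal Var =>
        (Sum.inr (some z.2.2) : Letter) :: z.2.1.map Sum.inl)
      ((hsign.comp PolyTime.id.snd.snd).cons (PolyTime.id.snd.fst.map
        (h := fun u => Sum.inl u.2) (hletter.comp PolyTime.id.snd)))))

/-- The reduction from weighted definability, for a template that realizes the formula. -/
def reduction {r : ℕ} (ar : Fin r → ℕ) (N : Template (Inst r)) (x : List (Fin r ⊕ Bool) × ℕ) :
    List Letter × ℕ :=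
  if isStructWord ar x.1 then
    (FormulaText.word (text N ((parse x.1).1, x.2, (parse x.1).2.2) x.2), x.2)
  else ([Sum.inl true], 0)

theorem polyTime_reduction {r : ℕ} (ar : Fin r → ℕ) {N : Template (Inst r)} (hN : PolyTime N) :
    PolyTime (reduction ar N) := by
  have hk : PolyTime fun x : List (Fin r ⊕ Bool) × ℕ => x.2 := PolyTime.id.snd
  have hp : PolyTime fun x : List (Fin r ⊕ Bool) × ℕ => parse x.1 :=
    polyTime_parse.comp PolyTime.id.fst
  exact ((polyTime_isStructWord ar).comp (g := fun x : List (Fin r ⊕ Bool) × ℕ => x.1)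
    PolyTime.id.fst).ite
      ((polyTime_word.comp ((polyTime_text hN).comp
        ((hp.fst.pair (hk.pair hp.snd.snd)).pair hk))).pair hk) (PolyTime.const _)

theorem reduction_snd_le {r : ℕ} (ar : Fin r → ℕ) (N : Template (Inst r))
    (x : List (Fin r ⊕ Bool) × ℕ) : (reduction ar N x).2 ≤ x.2 := by
  unfold reduction
  split <;> simp

/-- Keeping `𝒟` arbitrary above width three treats general CNF and 3CNF inputs at once. -/
theorem reduction_mem_iff (φ : PiTwoFormula) {N : Template (Inst φ.r)}
    (hN : Realizes N (InstFormula φ)) {𝒟 : ClauseSet Var → Prop}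
    (h𝒟 : ∀ F, HasWidthAtMost 3 F → 𝒟 F) (x : List (Fin φ.r ⊕ Bool) × ℕ) :
    x ∈ (weightedDefinability φ).yes ↔
      reduction φ.ar N x ∈ (weakBackdoorDetection RHorn 𝒟).yes := by
  obtain ⟨w, k⟩ := x
  by_cases hw : isStructWord φ.ar w = true
  · obtain ⟨A, rfl⟩ := isStructWord_iff.1 hw
    have hred : reduction φ.ar N (A.word, k) =
        (FormulaText.word (text N (A.n, k, factList A) k), k) := by
      simp only [reduction, hw, if_true, parse_word]
    rw [hred]
    constructor
    · rintro ⟨A', hA, S, hS, hm⟩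
      obtain ⟨U, hcard, hU, hP⟩ := exists_instFormula_of_models φ A' hS hm
      -- `A` and `A'` have the same word, so parsing shows that they agree in size and list of
      -- facts.
      have h := (parse_word A).symm.trans ((congrArg parse hA).trans (parse_word A'))
      simp only [Prod.mk.injEq, true_and] at h
      dsimp only at hP hcard
      rw [← h.1, ← h.2] at hP
      exact ⟨_, rfl, isCNF_text hN, h𝒟 _ (hasWidthAtMost_text hN),
        exists_isWeakBackdoor hN hcard hU hP⟩
    · rintro ⟨E, hE, _, _, B, hcard, hB⟩
      obtain rfl := word_injective hE
      obtain ⟨U, hcard, hP⟩ := exists_of_isWeakBackdoor hN hcard hB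
      exact ⟨A, rfl, exists_models_of_instFormula φ A hcard hP⟩
  · refine iff_of_false ?_ ?_
    · rintro ⟨A, hA, _⟩
      exact hw (isStructWord_iff.2 ⟨A, hA⟩)
    · rintro ⟨E, hE, _⟩
      simp only [reduction, hw] at hE
      exact word_ne_singleton E true hE.symm

theorem wTwoHard_weakBackdoorDetection {𝒟 : ClauseSet Var → Prop}
    (h𝒟 : ∀ F, HasWidthAtMost 3 F → 𝒟 F) : WTwoHard (weakBackdoorDetection RHorn 𝒟) := by
  rintro P ⟨φ, T, hT, ⟨g, hg, hTg⟩, hyes⟩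
  obtain ⟨N, hN, hreal⟩ := definable_instFormula φ
  have hcomp := FPTComputable.polyTime_comp (β := Fin φ.r ⊕ Bool) (γ := Letter) (T₁ := T) hT
    (polyTime_reduction φ.ar hN)
  refine ⟨fun x => reduction φ.ar N (T x), hcomp,
    ⟨g, hg, fun w k => (reduction_snd_le _ _ _).trans (hTg w k)⟩, fun w k => ?_⟩
  exact (hyes w k).trans (reduction_mem_iff φ hreal h𝒟 _)

end BackdoorReduction

/-- Weak RHorn-Backdoor Set Detection is W[2]-hard, and it remains W[2]-hard if the input is
restricted to 3CNF formulas. -/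
theorem mainTheorem6 :
    Parameterized.WTwoHard
      (BackdoorDetection.weakBackdoorDetection CNFFormula.RHorn fun _ => True) ∧
    Parameterized.WTwoHard
      (BackdoorDetection.weakBackdoorDetection CNFFormula.RHorn (CNFFormula.HasWidthAtMost 3)) :=
  ⟨BackdoorReduction.wTwoHard_weakBackdoorDetection fun _ _ => trivial,
    BackdoorReduction.wTwoHard_weakBackdoorDetection fun _ h => h⟩
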